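/- Let $H\in(0,1)$, $T>0$, and let $B=(B_t)_{t\in[0,T]}$ be a fractional Brownian motion with Hurst coefficient $H$ on a probability space $(\Omega,\mathcal F,P)$, that is, a centred Gaussian process with $E[B_tB_s]=\frac12(t^{2H}+s^{2H}-|t-s|^{2H})$. For $n\ge 1$ put $t_j^n=jT/n$, $$d_{n,j}=B_{t^n_{j+1}}-2B_{t^n_j}+B_{t^n_{j-1}},\qquad V_{n}=\sum_{j=1}^{n-1}d_{n,j}^2,$$ and for $n\ge2$ $$\widehat H_n^{(2)}=0\vee\Big(\frac12-\frac1{2\log 2}\log\frac{V_{2n}}{V_n}\Big)\wedge 1 .$$ Let $L$ be the Ornstein–Uhlenbeck operator (equal to $-k$ on the $k$-th Wiener chaos) of the Gaussian Hilbert space spanned by $B$, that is, the closed linear span of $\{B_t:t\in[0,T]\}$ in $L^2(P)$. For $s\in\mathbb R$ and $p\in(1,\infty)$ let $\|F\|_{s,p}=\|(I-L)^{s/2}F\|_{L^p}$ be the norm of the Sobolev space $\mathbb D_{s,p}$ of Wiener functionals, and let $\mathbb D_\infty=\bigcap_{s,p}\mathbb D_{s,p}$. For $\nu\in\mathbb R$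 write $X_n=O_M(n^\nu)$ if $X_n\in\mathbb D_\infty$ for all $n$ and $\|X_n\|_{s,p}=O(n^\nu)$ as $n\to\infty$ for all $s\in\mathbb R$, $p\in(1,\infty)$. Then there is a sequence $(\psi_n)_{n\ge1}$ of Wiener functionals such that: (i) $\psi_n:\Omega\to[0,1]$ and $\psi_n\in\mathbb D_\infty$ for all $n$, and $\|\psi_n-1\|_{s,p}=O(n^{-\ell})$ as $n\to\infty$ for all $s\in\mathbb R$, $p\in(1,\infty)$, $\ell>0$. (ii) For $n\ge2$ the random variables $Z_n=(2\log 2)\sqrt n\,(\widehat H^{(2)}_n-H)\,\psi_n$ belong to $\mathbb D_\infty$ and admit the stochastic expansion $Z_n=M_n+n^{-1/2}N_n$, where $$M_n=-n^{1/2}\Big\{\Big[\frac{V_{2n}}{E[V_{2n}]}-1\Big]-\Big[\frac{V_{n}}{E[V_{n}]}-1\Big]\Big\}$$ and $$N_n=n\Big\{\frac12\Big[\frac{V_{2n}}{E[V_{2n}]}-1\Big]^2-\frac12\Big[\frac{V_{n}}{E[V_{n}]}-1\Big]^2\Big\}-\frac12+O_M(n^{-1/2}).$$ -/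

import Mathlib

open MeasureTheory ProbabilityTheory Filter Topology
open scoped ENNReal

noncomputable section

/-- `(B t)`, `t ∈ [0, T]`, is a fractional Brownian motion with Hurst coefficient `H`:
a centred Gaussian process with covariance `(t^{2H} + s^{2H} - |t - s|^{2H}) / 2`.
Only the values of `B` on `[0, T]` play a role, here and in all definitions below. -/
structure IsFractionalBrownianMotion {Ω : Type*} [MeasurableSpace Ω] (P : Measure Ω)
    (H T : ℝ) (B : ℝ → Ω → ℝ) : Prop where
  measurable : ∀ t ∈ Set.Icc 0 T, Measurable (B t)
  gaussian : IsGaussianProcess (fun t : Set.Icc (0 : ℝ) T => B t) P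
  mean_eq : ∀ t ∈ Set.Icc 0 T, ∫ ω, B t ω ∂P = 0
  cov_eq : ∀ t ∈ Set.Icc 0 T, ∀ s ∈ Set.Icc 0 T,
    ∫ ω, B t ω * B s ω ∂P = (t ^ (2 * H) + s ^ (2 * H) - |t - s| ^ (2 * H)) / 2

/-! ### Sobolev spaces of Wiener functionals

The Hilbert space `𝔥` is the completion of the step functions on `[0, T]` for
`⟨1_{[0,t]}, 1_{[0,s]}⟩ = E[B_t B_s]`, and the isonormal process `𝕎` is the isometry
`𝔥 → L²(P)` with `𝕎(1_{[0,t]}) = B_t`. So `{𝕎(h) : h ∈ 𝔥}` is the closed linear span in `L²(P)`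
of the variables `B_t`, and `‖h‖ = 1` means `E[𝕎(h)²] = 1`. -/

/-- The first Wiener chaos `{𝕎(h) : h ∈ 𝔥}`: the square integrable random variables that are
`L²(P)`-limits of finite linear combinations of the `B t`, `t ∈ [0, T]`. -/
def firstChaos {Ω : Type*} [MeasurableSpace Ω] (P : Measure Ω) (T : ℝ) (B : ℝ → Ω → ℝ) :
    Set (Ω → ℝ) :=
  {ξ | MemLp ξ 2 P ∧ ∃ u : ℕ → Ω → ℝ, (∀ m, u m ∈ Submodule.span ℝ (B '' Set.Icc 0 T)) ∧
    Tendsto (fun m => eLpNorm (u m - ξ) 2 P) atTop (𝓝 0)}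

/-- The σ-algebra generated by `(B t)`, `t ∈ [0, T]`. -/
abbrev sigmaB {Ω : Type*} (T : ℝ) (B : ℝ → Ω → ℝ) : MeasurableSpace Ω :=
  ⨆ t ∈ Set.Icc (0 : ℝ) T, MeasurableSpace.comap (B t) inferInstance

/-- `F` is (the class of) an element of `L^p` of the Wiener space, that is, a `p`-integrable
functional measurable, up to null sets, for the σ-algebra generated by `B`. -/
def MemWienerLp {Ω : Type*} [MeasurableSpace Ω] (P : Measure Ω) (T : ℝ) (B : ℝ → Ω → ℝ)
    (p : ℝ) (F : Ω → ℝ) : Prop :=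
  MemLp F (ENNReal.ofReal p) P ∧ AEStronglyMeasurable[sigmaB T B] F P

/-- `G = (I - L)^{s/2} F`, where `L` is the Ornstein–Uhlenbeck operator. The `k`-th Wiener chaos is
spanned by the Hermite functionals `H_k(𝕎(h))`, `‖h‖ = 1`, and `L` is multiplication by `-k` on it,
so `(I - L)^{s/2} H_k(𝕎(h)) = (1 + k)^{s/2} H_k(𝕎(h))`. The `H_k(𝕎(h))`, for all `k` and `h`,
span the polynomial functionals, and `(I - L)^{s/2}` acts on all other functionals by duality:
`E[G Q] = E[F (I - L)^{s/2} Q]` for polynomial functionals `Q`.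
There is at most one such `G`, up to null sets, in the `L^p` of the Wiener space, `p > 1`. -/
def IsBesselPower {Ω : Type*} [MeasurableSpace Ω] (P : Measure Ω) (T : ℝ) (B : ℝ → Ω → ℝ)
    (s : ℝ) (F G : Ω → ℝ) : Prop :=
  ∀ (k : ℕ), ∀ ξ ∈ firstChaos P T B, ∫ ω, ξ ω ^ 2 ∂P = 1 →
    ∫ ω, G ω * Polynomial.aeval (ξ ω) (Polynomial.hermite k) ∂P =
      ∫ ω, F ω * ((1 + (k : ℝ)) ^ (s / 2) * Polynomial.aeval (ξ ω) (Polynomial.hermite k)) ∂P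

/-- `F ∈ 𝔻_{s,p}`, for a random variable `F` in `L^p` (for `s < 0` the space `𝔻_{s,p}` also has
generalized functionals, which do not matter for `𝔻_∞`): `(I - L)^{s/2} F` is in `L^p`. -/
def MemSobolev {Ω : Type*} [MeasurableSpace Ω] (P : Measure Ω) (T : ℝ) (B : ℝ → Ω → ℝ)
    (s p : ℝ) (F : Ω → ℝ) : Prop :=
  MemWienerLp P T B p F ∧ ∃ G, MemWienerLp P T B p G ∧ IsBesselPower P T B s F G

/-- The norm `‖F‖_{s,p} = ‖(I - L)^{s/2} F‖_{L^p}`. The infimum is over the versions of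
`(I - L)^{s/2} F`, which are almost surely equal; it is `∞` if there is none. -/
def sobolevNorm {Ω : Type*} [MeasurableSpace Ω] (P : Measure Ω) (T : ℝ) (B : ℝ → Ω → ℝ)
    (s p : ℝ) (F : Ω → ℝ) : ℝ≥0∞ :=
  ⨅ (G : Ω → ℝ) (_ : MemWienerLp P T B p G ∧ IsBesselPower P T B s F G),
    eLpNorm G (ENNReal.ofReal p) P

/-- `F ∈ 𝔻_∞`, the intersection of the `𝔻_{s,p}` over `s ∈ ℝ` and `1 < p < ∞`. -/
def MemDInfty {Ω : Type*} [MeasurableSpace Ω] (P : Measure Ω) (T : ℝ) (B : ℝ → Ω → ℝ)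
    (F : Ω → ℝ) : Prop :=
  ∀ s p : ℝ, 1 < p → MemSobolev P T B s p F

/-- `‖X_n‖_{s,p} = O(n^ν)` as `n → ∞`. -/
def SobolevBigO {Ω : Type*} [MeasurableSpace Ω] (P : Measure Ω) (T : ℝ) (B : ℝ → Ω → ℝ)
    (s p : ℝ) (X : ℕ → Ω → ℝ) (ν : ℝ) : Prop :=
  ∃ C : ℝ, ∀ᶠ n : ℕ in atTop, sobolevNorm P T B s p (X n) ≤ ENNReal.ofReal (C * (n : ℝ) ^ ν)

/-- `X_n = O_M(n^ν)`: `X_n ∈ 𝔻_∞` and `‖X_n‖_{s,p} = O(n^ν)` for all `s ∈ ℝ`, `1 < p < ∞`. -/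
def IsBigOM {Ω : Type*} [MeasurableSpace Ω] (P : Measure Ω) (T : ℝ) (B : ℝ → Ω → ℝ)
    (X : ℕ → Ω → ℝ) (ν : ℝ) : Prop :=
  (∀ n, MemDInfty P T B (X n)) ∧ ∀ s p : ℝ, 1 < p → SobolevBigO P T B s p X ν

/-! ### The estimator -/

/-- The second-order difference `d_{n,j} = B_{t_{j+1}} - 2 B_{t_j} + B_{t_{j-1}}`,
`t_j = j T / n`. -/
def secondDiff {Ω : Type*} (T : ℝ) (B : ℝ → Ω → ℝ) (n j : ℕ) (ω : Ω) : ℝ :=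
  B (((j : ℝ) + 1) * T / n) ω - 2 * B ((j : ℝ) * T / n) ω + B (((j : ℝ) - 1) * T / n) ω

/-- The quadratic variation `V_{n,T}^{(2)} = ∑_{j=1}^{n-1} d_{n,j}²`. -/
def quadVar {Ω : Type*} (T : ℝ) (B : ℝ → Ω → ℝ) (n : ℕ) (ω : Ω) : ℝ :=
  ∑ j ∈ Finset.Ico 1 n, secondDiff T B n j ω ^ 2

/-- `V_{n,T}^{(2)} / E[V_{n,T}^{(2)}] - 1`. -/
def normQuadVar {Ω : Type*} [MeasurableSpace Ω] (P : Measure Ω) (T : ℝ) (B : ℝ → Ω → ℝ)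
    (n : ℕ) (ω : Ω) : ℝ :=
  quadVar T B n ω / (∫ ω', quadVar T B n ω' ∂P) - 1

/-- The estimator `0 ∨ (1/2 - (1 / (2 log 2)) log (V_{2n,T}^{(2)} / V_{n,T}^{(2)})) ∧ 1` of `H`,
for `n ≥ 2`. -/
def hurstEstimator {Ω : Type*} (T : ℝ) (B : ℝ → Ω → ℝ) (n : ℕ) (ω : Ω) : ℝ :=
  max 0 (min (1 / 2 - 1 / (2 * Real.log 2) *
    Real.log (quadVar T B (2 * n) ω / quadVar T B n ω)) 1)

/-- `Z_n = (2 log 2) √n (Ĥ_n^{(2)} - H) ψ_n`. -/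
def truncatedError {Ω : Type*} (H T : ℝ) (B : ℝ → Ω → ℝ) (ψ : ℕ → Ω → ℝ) (n : ℕ) (ω : Ω) : ℝ :=
  2 * Real.log 2 * √(n : ℝ) * (hurstEstimator T B n ω - H) * ψ n ω

/-- `M_n = - n^{1/2} {[V_{2n,T}^{(2)} / E V_{2n,T}^{(2)} - 1] - [V_{n,T}^{(2)} / E V_{n,T}^{(2)} - 1]}`. -/
def mainTerm {Ω : Type*} [MeasurableSpace Ω] (P : Measure Ω) (T : ℝ) (B : ℝ → Ω → ℝ)
    (n : ℕ) (ω : Ω) : ℝ :=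
  -(√(n : ℝ) * (normQuadVar P T B (2 * n) ω - normQuadVar P T B n ω))

end

/-!
The normalized quadratic variations `F_n = V_n / E[V_n] - 1` and `F_{2n}` are centred quadratic
forms of a Gaussian vector of size `O(n)` whose covariance operator has norm `O(1 / n)`: the
covariance of two second differences is `(T / n)^{2H}` times a summable function of their distance
(`summable_abs_secondDiffCov`), so Schur's test applies (`exists_isGaussianFamily_diffVector`).

**The expansion.** With a smooth cutoff `χ`, equal to `1` near `0` and supported in a small
neighbourhood of `0`, put `ψ_n = χ(F_n) χ(F_{2n})` for large `n` and `ψ_n = 0` otherwise. Where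
`ψ_n ≠ 0` the estimator is not clamped, and since `E[V_{2n}] / E[V_n] = 2^{1-2H} (2n-1) / (2n-2)`,
`(2 log 2) (Ĥ_n - H) = -(log (1 + F_{2n}) - log (1 + F_n) + c_n)` with
`c_n = log ((2n-1) / (2n-2)) = 1 / (2n) + O(n⁻²)` (`hurstEstimator_sub`, `gridCorrection_bounds`).
Taylor's formula for the logarithm gives the terms of first and second order in `F`, and `c_n` gives
the constant `-1/2`. What is left is `n` times a sum of three kinds of terms: functions of `F_n` or
`F_{2n}` that vanish to third order at `0`, terms with a factor `1 - χ`, which vanishes near `0`,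
and constants `O(n⁻²)`.

**The Sobolev norms.** Let `F = f(Y)` with `Y` a Gaussian vector of law `μ` from the process and `f`
of temperate growth. Then `(I - L)^{s/2} F` is `(I - L)^{-r} (I - L)^m f` at `Y`, where
`r = m - s/2 > 0`, `L f(x) = E[D²f(x)(Y, Y)] - Df(x)(x)` is the Ornstein–Uhlenbeck operator in
finite dimensions, and `(I - L)^{-r}` is an average of Mehler operators. The latter is a contraction
of `L^p(μ)`, so `‖F‖_{s,p} ≤ ‖(I - L)^m f‖_{L^p(μ)}` (`sobolevNorm_randomVector_le`). That this is
the operator which multiplies Hermite functionals by `(1 + k)^{s/2}` follows from the symmetry of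
`L` and of the Mehler operators for the joint law of `Y` and an element of the first chaos; both
symmetries come from the invariance of `μ ⊗ μ` under rotations.

**The orders of magnitude.** It remains to bound `(I - L)^m f` in `L^p` uniformly in `n`. For this,
`GradedFamily` assigns an order to families of functionals: `k` to `φ(F_n)` if `φ` vanishes to order
`k` at `0`, and `2` to the factor `1 / n`. By the product and chain rules for `L` and its carré du
champ `Γ`, and since `Γ` of two quadratic forms is `1 / n` times a quadratic form with bounded
coefficients, `L` preserves the order (`GradedFamily.ornsteinUhlenbeck`). A family of order `k` is
`O(n^{-k/2})` in every `L^p` (`GradedFamily.exists_eLpNorm_le`); the moments of `F_n` are bounded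
through `E[L(F_n^{2q})] = 0` and `L F_n = -2 F_n`. The remainder is `n` times a family of order `3`,
hence `O(n^{-1/2})`, and `1 - ψ_n` has every order.
-/

/-! ### Functions of temperate growth under a Gaussian measure -/

section GaussianCalculus

open Function

set_option linter.unusedSectionVars false

variable {E F : Type*} [NormedAddCommGroup E] [NormedSpace ℝ E] [NormedAddCommGroup F]
  [NormedSpace ℝ F]

lemma Function.HasTemperateGrowth.fderiv_right {f : E → F} (hf : f.HasTemperateGrowth) :
    (fderiv ℝ f).HasTemperateGrowth := by
  refine ⟨(contDiff_infty_iff_fderiv.1 hf.1).2, fun n => ?_⟩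
  obtain ⟨k, C, h⟩ := hf.2 (n + 1)
  exact ⟨k, C, fun x => by rw [norm_iteratedFDeriv_fderiv]; exact h x⟩

lemma Function.HasTemperateGrowth.differentiable {f : E → F} (hf : f.HasTemperateGrowth) :
    Differentiable ℝ f := hf.1.differentiable (by simp)

lemma Function.HasTemperateGrowth.clm_apply {G : Type*} [NormedAddCommGroup G] [NormedSpace ℝ G]
    {a : E → F →L[ℝ] G} {b : E → F} (ha : a.HasTemperateGrowth) (hb : b.HasTemperateGrowth) :
    (fun x => a x (b x)).HasTemperateGrowth :=
  (ContinuousLinearMap.id ℝ (F →L[ℝ] G)).bilinear_hasTemperateGrowth ha hb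

lemma Function.HasTemperateGrowth.clm_comp {a : E → F} (L : F →L[ℝ] ℝ)
    (ha : a.HasTemperateGrowth) : (fun x => L (a x)).HasTemperateGrowth :=
  L.hasTemperateGrowth.comp ha

lemma Function.HasTemperateGrowth.norm_le {f : E → F} (hf : f.HasTemperateGrowth) :
    ∃ (k : ℕ) (C : ℝ), 0 ≤ C ∧ ∀ x, ‖f x‖ ≤ C * (1 + ‖x‖) ^ k := by
  obtain ⟨k, C, h⟩ := hf.2 0
  refine ⟨k, C, ?_, fun x => by simpa using h x⟩
  have := h 0
  simp only [norm_zero, add_zero, one_pow, mul_one] at this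
  exact (norm_nonneg _).trans this

variable [MeasurableSpace E] [BorelSpace E] [SecondCountableTopology E] [CompleteSpace E]

lemma ProbabilityTheory.IsGaussian.memLp_of_norm_le (μ : Measure E) [IsGaussian μ]
    {f : E → F} (hf : AEStronglyMeasurable f μ) {k : ℕ} {C : ℝ}
    (h : ∀ x, ‖f x‖ ≤ C * (1 + ‖x‖) ^ k) {p : ℝ≥0∞} (hp : p ≠ ∞) : MemLp f p μ := by
  have h0 : MemLp (fun x : E => ‖x‖) (k * p) μ :=
    (IsGaussian.memLp_id μ _ (ENNReal.mul_ne_top (by simp) hp)).norm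
  have h1 : MemLp (fun x : E => 1 + ‖x‖) (k * p) μ := MemLp.add (memLp_const (1 : ℝ)) h0
  have h2 : MemLp (fun x : E => (1 + ‖x‖) ^ k) p μ := by
    rcases Nat.eq_zero_or_pos k with rfl | hk
    · simpa using memLp_const 1
    · have := h1.norm_rpow_div (k : ℝ≥0∞)
      have hk' : (k : ℝ≥0∞) ≠ 0 := by simpa using hk.ne'
      rw [mul_comm, mul_div_assoc, ENNReal.div_self hk' (by simp), mul_one] at this
      refine this.congr_norm (by fun_prop) (ae_of_all _ fun x => ?_)
      simp
  exact (h2.const_mul C).mono' hf (ae_of_all _ h)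

lemma Function.HasTemperateGrowth.memLp (μ : Measure E) [IsGaussian μ] {f : E → ℝ}
    (hf : f.HasTemperateGrowth) {p : ℝ≥0∞} (hp : p ≠ ∞) : MemLp f p μ := by
  obtain ⟨k, C, -, h⟩ := hf.norm_le
  exact IsGaussian.memLp_of_norm_le μ hf.1.continuous.aestronglyMeasurable h hp

lemma Function.HasTemperateGrowth.integrable (μ : Measure E) [IsGaussian μ] {f : E → ℝ}
    (hf : f.HasTemperateGrowth) : Integrable f μ :=
  memLp_one_iff_integrable.1 (hf.memLp μ (by simp))

/-! ### Integration by parts and the Ornstein–Uhlenbeck operator -/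

lemma integrable_apply_apply (μ : Measure E) [IsGaussian μ] (M : E →L[ℝ] E →L[ℝ] ℝ) :
    Integrable (fun y => M y y) μ :=
  Function.HasTemperateGrowth.integrable μ (f := fun y => M y y)
    (M.hasTemperateGrowth.clm_apply .id)

/-- The contraction `M ↦ ∫ M(y, y) dμ(y)` of a bilinear form with the covariance of a centred
Gaussian measure `μ`; with this, second order operators need no choice of a basis. -/
noncomputable def covTrace (μ : Measure E) [IsGaussian μ] : (E →L[ℝ] E →L[ℝ] ℝ) →L[ℝ] ℝ :=
  LinearMap.mkContinuous
    { toFun := fun M : E →L[ℝ] E →L[ℝ] ℝ => ∫ y, M y y ∂μ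
      map_add' := fun M N => by
        simp only [add_apply]
        exact integral_add (integrable_apply_apply μ M) (integrable_apply_apply μ N)
      map_smul' := fun c M => by
        simp only [smul_apply, RingHom.id_apply]
        exact integral_smul c _ }
    (∫ y, ‖y‖ ^ 2 ∂μ)
    (fun M => by
      have h2 : Integrable (fun y : E => ‖y‖ ^ 2) μ :=
        (IsGaussian.memLp_id μ 2 (by simp)).integrable_norm_pow (by simp)
      rw [mul_comm, ← integral_const_mul]
      refine norm_integral_le_of_norm_le (h2.const_mul _) (ae_of_all _ fun y => ?_)
      calc ‖M y y‖ ≤ ‖M‖ * ‖y‖ * ‖y‖ := M.le_opNorm₂ y y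
        _ = ‖M‖ * ‖y‖ ^ 2 := by ring)

lemma covTrace_apply (μ : Measure E) [IsGaussian μ] (M : E →L[ℝ] E →L[ℝ] ℝ) :
    covTrace μ M = ∫ y, M y y ∂μ := rfl

lemma hasDerivAt_apply_rotation {g : E → E →L[ℝ] ℝ} (hg : Differentiable ℝ g) (z : E × E)
    (θ : ℝ) : HasDerivAt (fun θ => g (ContinuousLinearMap.rotation θ z).1
        (ContinuousLinearMap.rotation θ z).2)
      (fderiv ℝ g (ContinuousLinearMap.rotation θ z).1 (ContinuousLinearMap.rotation θ z).2
          (ContinuousLinearMap.rotation θ z).2 -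
        g (ContinuousLinearMap.rotation θ z).1 (ContinuousLinearMap.rotation θ z).1) θ := by
  simp only [ContinuousLinearMap.rotation_apply]
  have hx : HasDerivAt (fun θ => Real.cos θ • z.1 + Real.sin θ • z.2)
      (-Real.sin θ • z.1 + Real.cos θ • z.2) θ :=
    ((Real.hasDerivAt_cos θ).smul_const _).add ((Real.hasDerivAt_sin θ).smul_const _)
  have hy : HasDerivAt (fun θ => -Real.sin θ • z.1 + Real.cos θ • z.2)
      (-Real.cos θ • z.1 + -Real.sin θ • z.2) θ :=
    ((Real.hasDerivAt_sin θ).neg.smul_const _).add ((Real.hasDerivAt_cos θ).smul_const _)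
  have hgx := (hg (Real.cos θ • z.1 + Real.sin θ • z.2)).hasFDerivAt.comp_hasDerivAt
    θ hx
  refine (hgx.clm_apply hy).congr_deriv ?_
  rw [show -Real.cos θ • z.1 + -Real.sin θ • z.2 = -(Real.cos θ • z.1 + Real.sin θ • z.2) by
    simp only [neg_smul]; abel, map_neg]
  simp [sub_eq_add_neg]

lemma norm_rotation_le (θ : ℝ) (z : E × E) : ‖ContinuousLinearMap.rotation θ z‖ ≤ 2 * ‖z‖ := by
  rw [ContinuousLinearMap.rotation_apply]
  have h1 := norm_fst_le z
  have h2 := norm_snd_le z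
  have hc := Real.abs_cos_le_one θ
  have hs := Real.abs_sin_le_one θ
  have key : ∀ a b : ℝ, |a| ≤ 1 → |b| ≤ 1 → ‖a • z.1 + b • z.2‖ ≤ 2 * ‖z‖ := by
    intro a b ha hb
    refine (norm_add_le _ _).trans ?_
    rw [norm_smul, norm_smul, Real.norm_eq_abs, Real.norm_eq_abs]
    nlinarith [norm_nonneg z.1, norm_nonneg z.2]
  rw [Prod.norm_def]
  exact max_le (key _ _ hc hs) (key _ _ (by rwa [abs_neg]) hc)

/-- If `D` is the derivative of `G` along the rotations of `E × E`, then `D` has integral `0`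
against `μ ⊗ μ`, since the integral of `G` is invariant under rotations. -/
lemma integral_rotation_deriv_eq_zero (μ : Measure E) [IsGaussian μ] (hμ : ∫ x, x ∂μ = 0)
    {G D : E × E → ℝ} (hGt : G.HasTemperateGrowth) (hDt : D.HasTemperateGrowth)
    (hd : ∀ z θ, HasDerivAt (fun θ => G (ContinuousLinearMap.rotation θ z))
      (D (ContinuousLinearMap.rotation θ z)) θ) :
    ∫ z, D z ∂(μ.prod μ) = 0 := by
  have hrot : ∀ θ, ∫ z, G (ContinuousLinearMap.rotation θ z) ∂(μ.prod μ) =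
      ∫ z, G z ∂(μ.prod μ) := by
    intro θ
    conv_rhs => rw [← IsGaussian.map_rotation_eq_self (μ := μ) (by simpa using hμ) θ]
    rw [integral_map (by fun_prop) hGt.1.continuous.aestronglyMeasurable]
  obtain ⟨k, C, hC, hb⟩ := hDt.norm_le
  have hbound : ∀ θ (z : E × E),
      ‖D (ContinuousLinearMap.rotation θ z)‖ ≤ C * 2 ^ k * (1 + ‖z‖) ^ k := by
    intro θ z
    refine (hb _).trans ?_
    rw [mul_assoc, ← mul_pow]
    gcongr
    nlinarith [norm_rotation_le θ z, norm_nonneg z]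
  have hint : Integrable (fun z : E × E => C * 2 ^ k * (1 + ‖z‖) ^ k) (μ.prod μ) :=
    memLp_one_iff_integrable.1 (IsGaussian.memLp_of_norm_le _ (by fun_prop) (k := k)
      (C := C * 2 ^ k) (fun z => (Real.norm_of_nonneg (by positivity)).le) (by simp))
  have hmain := (hasDerivAt_integral_of_dominated_loc_of_deriv_le (μ := μ.prod μ)
    (F := fun θ z => G (ContinuousLinearMap.rotation θ z))
    (F' := fun θ z => D (ContinuousLinearMap.rotation θ z)) (x₀ := (0 : ℝ))
    (s := Set.univ) (bound := fun z => C * 2 ^ k * (1 + ‖z‖) ^ k) univ_mem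
    (Eventually.of_forall fun θ =>
      (hGt.1.continuous.comp (ContinuousLinearMap.rotation θ).continuous).aestronglyMeasurable)
    ((hGt.comp (ContinuousLinearMap.rotation 0).hasTemperateGrowth).integrable _)
    (hDt.1.continuous.comp (ContinuousLinearMap.rotation 0).continuous).aestronglyMeasurable
    (ae_of_all _ fun z θ _ => hbound θ z) hint
    (ae_of_all _ fun z θ _ => hd z θ)).2
  simp only [hrot] at hmain
  have h0 := hmain.unique (hasDerivAt_const 0 _)
  have hrot0 : ∀ z : E × E, ContinuousLinearMap.rotation 0 z = z := fun z => by
    simp [ContinuousLinearMap.rotation_apply]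
  simpa only [hrot0] using h0

/-- Gaussian integration by parts, in the form `E[g(X)(X)] = E[tr_μ Dg(X)]` for a covector field
`g`. The integral of `(x, y) ↦ g x y` against `μ ⊗ μ` is invariant under rotations of `E × E`, and
the identity is the derivative of this invariance at the angle `0`. -/
theorem integral_apply_self_eq_integral_covTrace (μ : Measure E) [IsGaussian μ]
    (hμ : ∫ x, x ∂μ = 0) {g : E → E →L[ℝ] ℝ} (hg : g.HasTemperateGrowth) :
    ∫ x, g x x ∂μ = ∫ x, covTrace μ (fderiv ℝ g x) ∂μ := by
  have hfd := hg.fderiv_right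
  have hfst : HasTemperateGrowth (fun z : E × E => z.1) :=
    (ContinuousLinearMap.fst ℝ E E).hasTemperateGrowth
  have hsnd : HasTemperateGrowth (fun z : E × E => z.2) :=
    (ContinuousLinearMap.snd ℝ E E).hasTemperateGrowth
  have hg1 : HasTemperateGrowth (fun z : E × E => g z.1) := hg.comp hfst
  have hd1 : HasTemperateGrowth (fun z : E × E => fderiv ℝ g z.1) := hfd.comp hfst
  have hDt : HasTemperateGrowth (fun z : E × E => fderiv ℝ g z.1 z.2 z.2 - g z.1 z.1) :=
    ((hd1.clm_apply hsnd).clm_apply hsnd).fun_sub (hg1.clm_apply hfst)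
  have h0 := integral_rotation_deriv_eq_zero μ hμ (hg1.clm_apply hsnd) hDt
    (fun z θ => hasDerivAt_apply_rotation hg.differentiable z θ)
  rw [integral_prod _ (hDt.integrable _)] at h0
  have hin : ∀ x : E, ∫ y, (fderiv ℝ g x y y - g x x) ∂μ =
      covTrace μ (fderiv ℝ g x) - g x x := by
    intro x
    rw [integral_sub (integrable_apply_apply μ _) (integrable_const _), covTrace_apply]
    simp
  have h1 : ∫ x, (covTrace μ (fderiv ℝ g x) - g x x) ∂μ = 0 := by
    rw [← h0]
    exact integral_congr_ae (ae_of_all _ fun x => (hin x).symm)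
  rw [integral_sub] at h1
  · linarith
  · exact HasTemperateGrowth.integrable μ (f := fun x => covTrace μ (fderiv ℝ g x))
      (hfd.clm_comp _)
  · exact HasTemperateGrowth.integrable μ (f := fun x => g x x) (hg.clm_apply .id)

/-- The carré du champ operator `Γ(f, g)(x) = ∫ Df(x)(y) Dg(x)(y) dμ(y)`. -/
noncomputable def carreDuChamp (μ : Measure E) [IsGaussian μ] (f g : E → ℝ) (x : E) : ℝ :=
  covTrace μ ((fderiv ℝ f x).smulRight (fderiv ℝ g x))

/-- The Ornstein–Uhlenbeck operator `L f(x) = ∫ D²f(x)(y, y) dμ(y) - Df(x)(x)` of a centred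
Gaussian measure `μ`. -/
noncomputable def ornsteinUhlenbeck (μ : Measure E) [IsGaussian μ] (f : E → ℝ) (x : E) : ℝ :=
  covTrace μ (fderiv ℝ (fderiv ℝ f) x) - fderiv ℝ f x x

lemma carreDuChamp_apply (μ : Measure E) [IsGaussian μ] (f g : E → ℝ) (x : E) :
    carreDuChamp μ f g x = ∫ y, fderiv ℝ f x y * fderiv ℝ g x y ∂μ := by
  simp [carreDuChamp, covTrace_apply]

lemma carreDuChamp_comm (μ : Measure E) [IsGaussian μ] (f g : E → ℝ) :
    carreDuChamp μ f g = carreDuChamp μ g f := by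
  funext x; simp only [carreDuChamp_apply, mul_comm]

lemma hasTemperateGrowth_ornsteinUhlenbeck (μ : Measure E) [IsGaussian μ] {f : E → ℝ}
    (hf : f.HasTemperateGrowth) : (ornsteinUhlenbeck μ f).HasTemperateGrowth := by
  have h1 := hf.fderiv_right
  have h2 := h1.fderiv_right
  have h3 : HasTemperateGrowth (fun x => covTrace μ (fderiv ℝ (fderiv ℝ f) x)) :=
    h2.clm_comp _
  have h4 : HasTemperateGrowth (fun x => fderiv ℝ f x x) := h1.clm_apply .id
  exact h3.fun_sub h4

lemma hasTemperateGrowth_carreDuChamp (μ : Measure E) [IsGaussian μ] {f g : E → ℝ}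
    (hf : f.HasTemperateGrowth) (hg : g.HasTemperateGrowth) :
    (carreDuChamp μ f g).HasTemperateGrowth := by
  have h1 := hf.fderiv_right
  have h2 := hg.fderiv_right
  have h3 : HasTemperateGrowth (fun x => (fderiv ℝ f x).smulRight (fderiv ℝ g x)) :=
    ContinuousLinearMap.bilinear_hasTemperateGrowth (𝕜 := ℝ) (D := E) (E := E →L[ℝ] ℝ)
      (F := E →L[ℝ] ℝ) (G := E →L[ℝ] E →L[ℝ] ℝ)
      (ContinuousLinearMap.smulRightL ℝ E (E →L[ℝ] ℝ)) h1 h2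
  exact h3.clm_comp _

/-- `Γ` is the Dirichlet form of `-L`. -/
lemma integral_mul_ornsteinUhlenbeck (μ : Measure E) [IsGaussian μ] (hμ : ∫ x, x ∂μ = 0)
    {f h : E → ℝ} (hf : f.HasTemperateGrowth) (hh : h.HasTemperateGrowth) :
    ∫ x, h x * ornsteinUhlenbeck μ f x ∂μ = -∫ x, carreDuChamp μ h f x ∂μ := by
  have hf1 := hf.fderiv_right
  have hf2 := hf1.fderiv_right
  have hh1 := hh.fderiv_right
  have h3 : HasTemperateGrowth (fun x => covTrace μ (fderiv ℝ (fderiv ℝ f) x)) :=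
    hf2.clm_comp _
  have key := integral_apply_self_eq_integral_covTrace μ hμ
    (g := fun x => h x • fderiv ℝ f x) (by fun_prop)
  have hd : ∀ x, fderiv ℝ (fun x => h x • fderiv ℝ f x) x =
      h x • fderiv ℝ (fderiv ℝ f) x +
        (fderiv ℝ h x).smulRight (fderiv ℝ f x) := fun x =>
    fderiv_fun_smul (hh.differentiable x) (hf1.differentiable x)
  simp only [hd, map_add, map_smul, smul_apply, smul_eq_mul] at key
  rw [integral_add] at key
  · simp only [ornsteinUhlenbeck, mul_sub]
    rw [integral_sub, key]
    · simp only [carreDuChamp]; ring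
    · exact HasTemperateGrowth.integrable μ (hh.fun_mul h3)
    · exact HasTemperateGrowth.integrable μ
        (f := fun x => h x * fderiv ℝ f x x) (hh.fun_mul (hf1.clm_apply .id))
  · exact HasTemperateGrowth.integrable μ (hh.fun_mul h3)
  · exact HasTemperateGrowth.integrable μ (hasTemperateGrowth_carreDuChamp μ hh hf)

/-- `L` is symmetric in `L²(μ)`. -/
lemma integral_ornsteinUhlenbeck_mul_comm (μ : Measure E) [IsGaussian μ] (hμ : ∫ x, x ∂μ = 0)
    {f h : E → ℝ} (hf : f.HasTemperateGrowth) (hh : h.HasTemperateGrowth) :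
    ∫ x, ornsteinUhlenbeck μ f x * h x ∂μ = ∫ x, f x * ornsteinUhlenbeck μ h x ∂μ := by
  rw [integral_mul_ornsteinUhlenbeck μ hμ hh hf, carreDuChamp_comm,
    ← integral_mul_ornsteinUhlenbeck μ hμ hf hh]
  simp only [mul_comm]

lemma integral_ornsteinUhlenbeck (μ : Measure E) [IsGaussian μ] (hμ : ∫ x, x ∂μ = 0)
    {f : E → ℝ} (hf : f.HasTemperateGrowth) : ∫ x, ornsteinUhlenbeck μ f x ∂μ = 0 := by
  have := integral_mul_ornsteinUhlenbeck μ hμ hf (h := fun _ => 1) (by fun_prop)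
  simpa [carreDuChamp_apply] using this

/-! ### Product and chain rules -/

lemma carreDuChamp_const_left (μ : Measure E) [IsGaussian μ] (c : ℝ) (g : E → ℝ) :
    carreDuChamp μ (fun _ => c) g = 0 := by
  funext x; simp [carreDuChamp_apply]

lemma carreDuChamp_add_left (μ : Measure E) [IsGaussian μ] {f₁ f₂ : E → ℝ} (g : E → ℝ)
    (h₁ : f₁.HasTemperateGrowth) (h₂ : f₂.HasTemperateGrowth) (x : E) :
    carreDuChamp μ (fun x => f₁ x + f₂ x) g x = carreDuChamp μ f₁ g x + carreDuChamp μ f₂ g x := by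
  simp only [carreDuChamp]
  rw [fderiv_fun_add (h₁.differentiable x) (h₂.differentiable x), ← map_add]
  congr 1; ext y z; simp [add_mul]

lemma carreDuChamp_const_mul_left (μ : Measure E) [IsGaussian μ] {f : E → ℝ} (g : E → ℝ)
    (h : f.HasTemperateGrowth) (c : ℝ) (x : E) :
    carreDuChamp μ (fun x => c * f x) g x = c * carreDuChamp μ f g x := by
  simp only [carreDuChamp]
  rw [fderiv_const_mul (h.differentiable x), ← smul_eq_mul, ← map_smul]
  congr 1; ext y z; simp [mul_assoc]

lemma carreDuChamp_mul_left (μ : Measure E) [IsGaussian μ] {f₁ f₂ : E → ℝ} (g : E → ℝ)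
    (h₁ : f₁.HasTemperateGrowth) (h₂ : f₂.HasTemperateGrowth) (x : E) :
    carreDuChamp μ (fun x => f₁ x * f₂ x) g x =
      f₁ x * carreDuChamp μ f₂ g x + f₂ x * carreDuChamp μ f₁ g x := by
  simp only [carreDuChamp]
  rw [fderiv_fun_mul (h₁.differentiable x) (h₂.differentiable x), ← smul_eq_mul, ← smul_eq_mul,
    ← map_smul, ← map_smul, ← map_add]
  congr 1; ext y z; simp [add_mul, mul_assoc]

lemma fderiv_comp_real {f : E → ℝ} {φ : ℝ → ℝ} (hφ : Differentiable ℝ φ) (hf : Differentiable ℝ f)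
    (x : E) : fderiv ℝ (fun x => φ (f x)) x = deriv φ (f x) • fderiv ℝ f x :=
  ((hφ (f x)).hasDerivAt.comp_hasFDerivAt x (hf x).hasFDerivAt).fderiv

lemma carreDuChamp_comp_left (μ : Measure E) [IsGaussian μ] {f : E → ℝ} (g : E → ℝ) {φ : ℝ → ℝ}
    (hφ : φ.HasTemperateGrowth) (hf : f.HasTemperateGrowth) (x : E) :
    carreDuChamp μ (fun x => φ (f x)) g x = deriv φ (f x) * carreDuChamp μ f g x := by
  simp only [carreDuChamp]
  rw [fderiv_comp_real hφ.differentiable hf.differentiable, ← smul_eq_mul, ← map_smul]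
  congr 1; ext y z; simp [mul_assoc]

lemma ornsteinUhlenbeck_const (μ : Measure E) [IsGaussian μ] (c : ℝ) :
    ornsteinUhlenbeck μ (fun _ => c) = 0 := by
  funext x; simp [ornsteinUhlenbeck]

lemma ornsteinUhlenbeck_add (μ : Measure E) [IsGaussian μ] {f₁ f₂ : E → ℝ}
    (h₁ : f₁.HasTemperateGrowth) (h₂ : f₂.HasTemperateGrowth) (x : E) :
    ornsteinUhlenbeck μ (fun x => f₁ x + f₂ x) x =
      ornsteinUhlenbeck μ f₁ x + ornsteinUhlenbeck μ f₂ x := by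
  have hd : fderiv ℝ (fun x => f₁ x + f₂ x) =
      fun x => fderiv ℝ f₁ x + fderiv ℝ f₂ x :=
    funext fun x => fderiv_fun_add (h₁.differentiable x) (h₂.differentiable x)
  simp only [ornsteinUhlenbeck, hd]
  rw [fderiv_fun_add (h₁.fderiv_right.differentiable x) (h₂.fderiv_right.differentiable x), map_add,
    add_apply]
  ring

lemma ornsteinUhlenbeck_const_mul (μ : Measure E) [IsGaussian μ] {f : E → ℝ}
    (h : f.HasTemperateGrowth) (c : ℝ) (x : E) :
    ornsteinUhlenbeck μ (fun x => c * f x) x = c * ornsteinUhlenbeck μ f x := by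
  have hd : fderiv ℝ (fun x => c * f x) = fun x => c • fderiv ℝ f x :=
    funext fun x => fderiv_const_mul (h.differentiable x) c
  simp only [ornsteinUhlenbeck, hd]
  rw [fderiv_fun_const_smul (h.fderiv_right.differentiable x), map_smul, smul_apply]
  simp only [smul_eq_mul]; ring

lemma ornsteinUhlenbeck_mul (μ : Measure E) [IsGaussian μ] {f₁ f₂ : E → ℝ}
    (h₁ : f₁.HasTemperateGrowth) (h₂ : f₂.HasTemperateGrowth) (x : E) :
    ornsteinUhlenbeck μ (fun x => f₁ x * f₂ x) x =
      f₁ x * ornsteinUhlenbeck μ f₂ x + f₂ x * ornsteinUhlenbeck μ f₁ x +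
        2 * carreDuChamp μ f₁ f₂ x := by
  have hd : fderiv ℝ (fun x => f₁ x * f₂ x) =
      fun x => f₁ x • fderiv ℝ f₂ x + f₂ x • fderiv ℝ f₁ x :=
    funext fun x => fderiv_fun_mul (h₁.differentiable x) (h₂.differentiable x)
  have e1 := h₁.fderiv_right
  have e2 := h₂.fderiv_right
  simp only [ornsteinUhlenbeck, hd]
  rw [fderiv_fun_add ((h₁.fun_smul e2).differentiable x) ((h₂.fun_smul e1).differentiable x),
    fderiv_fun_smul (h₁.differentiable x) (e2.differentiable x),
    fderiv_fun_smul (h₂.differentiable x) (e1.differentiable x)]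
  simp only [map_add, map_smul, add_apply, smul_apply, smul_eq_mul]
  have h3 : carreDuChamp μ f₂ f₁ x = carreDuChamp μ f₁ f₂ x := by rw [carreDuChamp_comm]
  have h4 : covTrace μ ((fderiv ℝ f₁ x).smulRight (fderiv ℝ f₂ x)) =
    carreDuChamp μ f₁ f₂ x := rfl
  have h5 : covTrace μ ((fderiv ℝ f₂ x).smulRight (fderiv ℝ f₁ x)) =
    carreDuChamp μ f₂ f₁ x := rfl
  rw [h4, h5, h3]; ring

lemma hasTemperateGrowth_deriv {φ : ℝ → ℝ} (hφ : φ.HasTemperateGrowth) :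
    (deriv φ).HasTemperateGrowth := by
  have h := hφ.fderiv_right
  have : deriv φ = fun x => fderiv ℝ φ x 1 := by funext x; simp
  rw [this]
  exact h.clm_apply (.const 1)

lemma ornsteinUhlenbeck_comp (μ : Measure E) [IsGaussian μ] {f : E → ℝ} {φ : ℝ → ℝ}
    (hφ : φ.HasTemperateGrowth) (hf : f.HasTemperateGrowth) (x : E) :
    ornsteinUhlenbeck μ (fun x => φ (f x)) x =
      deriv φ (f x) * ornsteinUhlenbeck μ f x +
        deriv (deriv φ) (f x) * carreDuChamp μ f f x := by
  have hφ1 := hasTemperateGrowth_deriv hφ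
  have hc : HasTemperateGrowth (fun x => deriv φ (f x)) := hφ1.comp hf
  have hd : fderiv ℝ (fun x => φ (f x)) = fun x => deriv φ (f x) • fderiv ℝ f x :=
    funext fun x => fderiv_comp_real hφ.differentiable hf.differentiable x
  simp only [ornsteinUhlenbeck, hd]
  rw [fderiv_fun_smul (hc.differentiable x) (hf.fderiv_right.differentiable x),
    fderiv_comp_real hφ1.differentiable hf.differentiable]
  simp only [map_add, map_smul, smul_apply, smul_eq_mul]
  have : covTrace μ ((deriv (deriv φ) (f x) • fderiv ℝ f x).smulRight
      (fderiv ℝ f x)) = deriv (deriv φ) (f x) * carreDuChamp μ f f x := by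
    rw [carreDuChamp, ← smul_eq_mul, ← map_smul]
    congr 1; ext y z; simp [mul_assoc]
  rw [this]; ring

end GaussianCalculus

/-! ### Hermite polynomials as eigenfunctions -/

section Hermite

open Function Polynomial

set_option linter.unusedSectionVars false

lemma Polynomial.derivative_hermite_succ (n : ℕ) :
    derivative (hermite (n + 1)) = ((n : ℤ[X]) + 1) * hermite n := by
  induction n with
  | zero => simp
  | succ n ih =>
    rw [hermite_succ (n + 1), derivative_sub, derivative_mul, ih, derivative_mul]
    have h := hermite_succ n
    simp only [derivative_X, derivative_add, derivative_natCast, derivative_one]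
    push_cast
    rw [h]; ring

lemma hasTemperateGrowth_aeval (p : ℤ[X]) : HasTemperateGrowth (fun u : ℝ => aeval u p) := by
  simp only [aeval_eq_sum_range, zsmul_eq_mul]
  exact HasTemperateGrowth.sum fun i _ => by fun_prop

variable {E : Type*} [NormedAddCommGroup E] [NormedSpace ℝ E]
  [MeasurableSpace E] [BorelSpace E] [SecondCountableTopology E] [CompleteSpace E]

lemma hasTemperateGrowth_aeval_dual (ℓ : E →L[ℝ] ℝ) (p : ℤ[X]) :
    HasTemperateGrowth (fun x => aeval (ℓ x) p) :=
  (hasTemperateGrowth_aeval p).comp ℓ.hasTemperateGrowth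

lemma carreDuChamp_dual (μ : Measure E) [IsGaussian μ] (ℓ : E →L[ℝ] ℝ) (x : E) :
    carreDuChamp μ ℓ ℓ x = ∫ y, ℓ y ^ 2 ∂μ := by
  simp [carreDuChamp_apply, sq]

lemma ornsteinUhlenbeck_dual (μ : Measure E) [IsGaussian μ] (ℓ : E →L[ℝ] ℝ) (x : E) :
    ornsteinUhlenbeck μ ℓ x = -ℓ x := by
  have : fderiv ℝ ℓ = fun _ => ℓ := by funext x; simp
  simp [ornsteinUhlenbeck, this]

lemma ornsteinUhlenbeck_hermite (μ : Measure E) [IsGaussian μ] {ℓ : E →L[ℝ] ℝ}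
    (hℓ : ∫ y, ℓ y ^ 2 ∂μ = 1) (k : ℕ) (x : E) :
    ornsteinUhlenbeck μ (fun x => aeval (ℓ x) (hermite k)) x =
      -(k : ℝ) * aeval (ℓ x) (hermite k) := by
  rw [ornsteinUhlenbeck_comp μ (hasTemperateGrowth_aeval _) ℓ.hasTemperateGrowth,
    carreDuChamp_dual, hℓ, ornsteinUhlenbeck_dual]
  have hd : ∀ p : ℤ[X], deriv (fun u : ℝ => aeval u p) = fun u => aeval u (derivative p) :=
    fun p => funext fun u => Polynomial.deriv_aeval p
  rw [hd, hd]
  have h1 : derivative (hermite (k + 1)) =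
      hermite k + X * derivative (hermite k) - derivative (derivative (hermite k)) := by
    rw [hermite_succ, derivative_sub, derivative_mul, derivative_X, one_mul]
  rw [derivative_hermite_succ] at h1
  have h2 := congrArg (aeval (ℓ x)) h1
  simp only [map_mul, map_add, map_natCast, map_one, map_sub, aeval_X] at h2
  linarith

/-- Gaussian integration by parts along a single functional `ℓ`. -/
lemma integral_dual_mul_comp (μ : Measure E) [IsGaussian μ] (hμ : ∫ x, x ∂μ = 0) (ℓ : E →L[ℝ] ℝ)
    {φ : ℝ → ℝ} (hφ : φ.HasTemperateGrowth) :
    ∫ y, ℓ y * φ (ℓ y) ∂μ = (∫ y, ℓ y ^ 2 ∂μ) * ∫ y, deriv φ (ℓ y) ∂μ := by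
  have h := integral_mul_ornsteinUhlenbeck μ hμ ℓ.hasTemperateGrowth
    (hφ.comp ℓ.hasTemperateGrowth)
  have e1 : ∀ x, carreDuChamp μ (φ ∘ ℓ) ℓ x = deriv φ (ℓ x) * ∫ y, ℓ y ^ 2 ∂μ := fun x => by
    rw [← carreDuChamp_dual μ ℓ x]
    exact carreDuChamp_comp_left μ _ hφ ℓ.hasTemperateGrowth x
  simp only [e1, ornsteinUhlenbeck_dual, comp_apply, mul_neg, integral_neg, neg_inj,
    integral_mul_const] at h
  rw [mul_comm, ← h]
  simp only [mul_comm]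

end Hermite

/-! ### The Mehler formula and negative powers of `I - L` -/

section Mehler

open Function Polynomial

set_option linter.unusedSectionVars false

variable {E : Type*} [NormedAddCommGroup E] [NormedSpace ℝ E]
  [MeasurableSpace E] [BorelSpace E] [SecondCountableTopology E] [CompleteSpace E]

/-- The Mehler operator `g ↦ ∫ g(cos θ x + sin θ y) dμ(y)`, which is the Ornstein–Uhlenbeck
semigroup at the time `t` with `cos θ = e⁻ᵗ`. -/
noncomputable def mehler (μ : Measure E) (θ : ℝ) (g : E → ℝ) (x : E) : ℝ :=
  ∫ y, g (Real.cos θ • x + Real.sin θ • y) ∂μ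

lemma hasTemperateGrowth_comp_affine {F : Type*} [NormedAddCommGroup F] [NormedSpace ℝ F]
    {g : E → F} (hg : g.HasTemperateGrowth) (x : E) (c : ℝ) :
    HasTemperateGrowth (fun y => g (x + c • y)) :=
  hg.comp (f := fun y => x + c • y)
    ((HasTemperateGrowth.const x).fun_add ((c • ContinuousLinearMap.id ℝ E).hasTemperateGrowth))

/-- The Mehler operator multiplies the `k`-th Hermite functionals by `cos^k θ`; both sides satisfy
the three-term recursion of the Hermite polynomials, by integration by parts in `y`. -/
lemma mehler_hermite (μ : Measure E) [IsGaussian μ] (hμ : ∫ x, x ∂μ = 0) {ℓ : E →L[ℝ] ℝ}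
    (hℓ : ∫ y, ℓ y ^ 2 ∂μ = 1) (θ : ℝ) (k : ℕ) (x : E) :
    mehler μ θ (fun x => aeval (ℓ x) (hermite k)) x =
      Real.cos θ ^ k * aeval (ℓ x) (hermite k) := by
  set c := Real.cos θ
  set s := Real.sin θ
  have hcs : s ^ 2 + c ^ 2 = 1 := Real.sin_sq_add_cos_sq θ
  have hint : ∀ p : ℤ[X], Integrable (fun y => aeval (c * ℓ x + s * ℓ y) p) μ := fun p => by
    have := (hasTemperateGrowth_comp_affine (hasTemperateGrowth_aeval_dual ℓ p) (c • x) s)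
    simpa using this.integrable μ
  have hint' : ∀ p : ℤ[X], Integrable (fun y => ℓ y * aeval (c * ℓ x + s * ℓ y) p) μ := fun p => by
    have := (hasTemperateGrowth_comp_affine (hasTemperateGrowth_aeval_dual ℓ p) (c • x) s)
    simpa using (ℓ.hasTemperateGrowth.fun_mul this).integrable μ
  have hibp : ∀ p : ℤ[X], ∫ y, ℓ y * aeval (c * ℓ x + s * ℓ y) p ∂μ =
      s * ∫ y, aeval (c * ℓ x + s * ℓ y) (derivative p) ∂μ := by
    intro p
    have h := integral_dual_mul_comp μ hμ ℓ (φ := fun u => aeval (c * ℓ x + s * u) p)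
      ((hasTemperateGrowth_aeval p).comp (f := fun u : ℝ => c * ℓ x + s * u) (by fun_prop))
    rw [h, hℓ, one_mul, ← integral_const_mul]
    congr 1; funext y
    have h1 : HasDerivAt (fun u : ℝ => c * ℓ x + s * u) s (ℓ y) := by
      simpa using ((hasDerivAt_id (ℓ y)).const_mul s).const_add (c * ℓ x)
    have h2 := (Polynomial.hasDerivAt_aeval p (c * ℓ x + s * ℓ y)).comp (ℓ y) h1
    exact h2.deriv.trans (mul_comm _ _)
  have hrec : ∀ n, ∫ y, aeval (c * ℓ x + s * ℓ y) (hermite (n + 1)) ∂μ =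
      c * ℓ x * (∫ y, aeval (c * ℓ x + s * ℓ y) (hermite n) ∂μ) -
        c ^ 2 * ∫ y, aeval (c * ℓ x + s * ℓ y) (derivative (hermite n)) ∂μ := by
    intro n
    have e : ∀ y, aeval (c * ℓ x + s * ℓ y) (hermite (n + 1)) =
        (c * ℓ x * aeval (c * ℓ x + s * ℓ y) (hermite n) +
          s * (ℓ y * aeval (c * ℓ x + s * ℓ y) (hermite n))) -
        aeval (c * ℓ x + s * ℓ y) (derivative (hermite n)) := fun y => by
      rw [hermite_succ]; simp only [map_sub, map_mul, aeval_X]; ring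
    simp only [e]
    have i1 := (hint (hermite n)).const_mul (c * ℓ x)
    have i2 := (hint' (hermite n)).const_mul s
    have i3 : Integrable (fun y => c * ℓ x * aeval (c * ℓ x + s * ℓ y) (hermite n) +
        s * (ℓ y * aeval (c * ℓ x + s * ℓ y) (hermite n))) μ := i1.add i2
    rw [integral_sub i3 (hint _),
      integral_add i1 i2, integral_const_mul,
      integral_const_mul, hibp]
    linear_combination (∫ y, aeval (c * ℓ x + s * ℓ y) (derivative (hermite n)) ∂μ) * hcs
  have main : ∀ n, ∫ y, aeval (c * ℓ x + s * ℓ y) (hermite n) ∂μ =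
      c ^ n * aeval (ℓ x) (hermite n) ∧
      ∫ y, aeval (c * ℓ x + s * ℓ y) (hermite (n + 1)) ∂μ =
      c ^ (n + 1) * aeval (ℓ x) (hermite (n + 1)) := by
    intro n
    induction n with
    | zero =>
      refine ⟨by simp, ?_⟩
      rw [hrec]; simp
    | succ n ih =>
      refine ⟨ih.2, ?_⟩
      rw [hrec, ih.2, hermite_succ (n + 1), derivative_hermite_succ]
      simp only [map_mul, map_add, map_natCast, map_one, map_sub, aeval_X]
      rw [integral_const_mul, ih.1]
      ring
  simpa [mehler] using (main k).1

/-- The adjoint of the Mehler operator at the angle `θ` is the one at `-θ`, since the rotations of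
`E × E` preserve `μ ⊗ μ`. -/
lemma integral_mehler_mul (μ : Measure E) [IsGaussian μ] (hμ : ∫ x, x ∂μ = 0) {g h : E → ℝ}
    (hg : g.HasTemperateGrowth) (hh : h.HasTemperateGrowth) (θ : ℝ) :
    ∫ x, mehler μ θ g x * h x ∂μ = ∫ x, g x * mehler μ (-θ) h x ∂μ := by
  have hfst := (ContinuousLinearMap.fst ℝ E E).hasTemperateGrowth
  have hrot : ∀ θ, HasTemperateGrowth (fun z : E × E => (ContinuousLinearMap.rotation θ z).1) :=
    fun θ => ((ContinuousLinearMap.fst ℝ E E).comp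
      (ContinuousLinearMap.rotation θ)).hasTemperateGrowth
  have e1 : ∫ x, mehler μ θ g x * h x ∂μ =
      ∫ z, g (ContinuousLinearMap.rotation θ z).1 * h z.1 ∂(μ.prod μ) := by
    have hΨ : HasTemperateGrowth
        (fun z : E × E => g (ContinuousLinearMap.rotation θ z).1 * h z.1) :=
      (hg.comp (hrot θ)).fun_mul (hh.comp hfst)
    rw [integral_prod _ (hΨ.integrable _)]
    simp only [mehler, ← integral_mul_const, ContinuousLinearMap.rotation_apply]
  have hΦ : HasTemperateGrowth
      (fun z : E × E => g z.1 * h (ContinuousLinearMap.rotation (-θ) z).1) :=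
    (hg.comp hfst).fun_mul (hh.comp (hrot (-θ)))
  have e2 : ∫ x, g x * mehler μ (-θ) h x ∂μ =
      ∫ z, g z.1 * h (ContinuousLinearMap.rotation (-θ) z).1 ∂(μ.prod μ) := by
    rw [integral_prod _ (hΦ.integrable _)]
    simp only [mehler, ← integral_const_mul, ContinuousLinearMap.rotation_apply]
  rw [e1, e2]
  conv_rhs => rw [← IsGaussian.map_rotation_eq_self (μ := μ) (by simpa using hμ) θ]
  rw [integral_map (by fun_prop) hΦ.1.continuous.aestronglyMeasurable]
  congr 1; funext z
  congr 2
  simp only [ContinuousLinearMap.rotation_apply, Real.cos_neg, Real.sin_neg, neg_smul, smul_add,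
    smul_neg, smul_smul, neg_neg]
  have hcs := Real.sin_sq_add_cos_sq θ
  have : z.1 = (Real.sin θ ^ 2 + Real.cos θ ^ 2) • z.1 := by rw [hcs, one_smul]
  nth_rewrite 1 [this]
  module

/-- The angle whose cosine is `e⁻ᵗ`. -/
noncomputable def mehlerAngle (t : ℝ) : ℝ := Real.arccos (Real.exp (-t))

lemma measurable_mehlerAngle : Measurable mehlerAngle := by
  unfold mehlerAngle; fun_prop

lemma cos_mehlerAngle {t : ℝ} (ht : 0 ≤ t) : Real.cos (mehlerAngle t) = Real.exp (-t) :=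
  Real.cos_arccos (by linarith [Real.exp_pos (-t)]) (by simpa using ht)

/-- `∫ e^{-kt} dΓ_{r,1}(t) = (1 + k)^{-r}`: the Laplace transform of the gamma distribution. -/
lemma integral_cos_mehlerAngle_pow {r : ℝ} (hr : 0 < r) (k : ℕ) :
    ∫ t, Real.cos (mehlerAngle t) ^ k ∂(gammaMeasure r 1) = (1 + (k : ℝ)) ^ (-r) := by
  have hm : Measurable (gammaPDF r 1) := (measurable_gammaPDFReal r 1).ennreal_ofReal
  rw [gammaMeasure, integral_withDensity_eq_integral_toReal_smul hm (ae_of_all _ fun t => by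
    simp [gammaPDF])]
  have h1 : ∀ t, (gammaPDF r 1 t).toReal • Real.cos (mehlerAngle t) ^ k =
      (Set.Ici (0 : ℝ)).indicator (fun t => 1 / Real.Gamma r *
        (t ^ (r - 1) * Real.exp (-((1 + k) * t)))) t := by
    intro t
    by_cases ht : 0 ≤ t
    · rw [Set.indicator_of_mem (Set.mem_Ici.2 ht), cos_mehlerAngle ht, gammaPDF,
        ENNReal.toReal_ofReal (gammaPDFReal_nonneg hr one_pos t), gammaPDFReal, if_pos ht,
        Real.one_rpow, smul_eq_mul, ← Real.exp_nat_mul, mul_assoc, mul_assoc, ← Real.exp_add]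
      ring_nf
    · rw [Set.indicator_of_notMem (by simpa using ht), gammaPDF_of_neg (not_le.1 ht)]
      simp
  simp only [h1]
  rw [integral_indicator measurableSet_Ici, integral_Ici_eq_integral_Ioi, integral_const_mul,
    Real.integral_rpow_mul_exp_neg_mul_Ioi hr (by positivity)]
  have hG := (Real.Gamma_pos_of_pos hr).ne'
  rw [Real.rpow_neg (by positivity), one_div (1 + (k : ℝ)), Real.inv_rpow (by positivity)]
  field_simp

/-- The operator `(I - L)^{-r} = Γ(r)⁻¹ ∫₀^∞ t^{r-1} e^{-t} P_t dt`, where `P_t` is the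
Ornstein–Uhlenbeck semigroup: the average of the Mehler operators over a gamma distribution. -/
noncomputable def besselPotential (μ : Measure E) (r : ℝ) (g : E → ℝ) (x : E) : ℝ :=
  ∫ t, mehler μ (mehlerAngle t) g x ∂(gammaMeasure r 1)

lemma measurable_mehler_integrand {g : E → ℝ} (hg : Measurable g) :
    Measurable (fun z : (E × ℝ) × E =>
      g (Real.cos (mehlerAngle z.1.2) • z.1.1 + Real.sin (mehlerAngle z.1.2) • z.2)) := by
  have h : Measurable (fun z : (E × ℝ) × E => mehlerAngle z.1.2) :=
    measurable_mehlerAngle.comp (measurable_snd.comp measurable_fst)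
  exact hg.comp (((Real.measurable_cos.comp h).smul (measurable_fst.comp measurable_fst)).add
    ((Real.measurable_sin.comp h).smul measurable_snd))

lemma stronglyMeasurable_mehler (μ : Measure E) [IsProbabilityMeasure μ] {g : E → ℝ}
    (hg : Measurable g) :
    StronglyMeasurable (fun z : E × ℝ => mehler μ (mehlerAngle z.2) g z.1) :=
  (measurable_mehler_integrand hg).stronglyMeasurable.integral_prod_right

lemma stronglyMeasurable_besselPotential (μ : Measure E) [IsProbabilityMeasure μ] {g : E → ℝ}
    (hg : Measurable g) {r : ℝ} (hr : 0 < r) : StronglyMeasurable (besselPotential μ r g) :=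
  have := isProbabilityMeasure_gammaMeasure hr one_pos
  (stronglyMeasurable_mehler μ hg).integral_prod_right (ν := gammaMeasure r 1)

/-- Mehler operators preserve polynomial growth, uniformly in the angle. -/
lemma norm_mehler_le (μ : Measure E) [IsGaussian μ] {g : E → ℝ} (hg : g.HasTemperateGrowth) :
    ∃ (k : ℕ) (C : ℝ), ∀ θ x, ‖mehler μ θ g x‖ ≤ C * (1 + ‖x‖) ^ k := by
  obtain ⟨k, C, hC, h⟩ := hg.norm_le
  refine ⟨k, C * ∫ y, (1 + ‖y‖) ^ k ∂μ, fun θ x => ?_⟩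
  have hi : Integrable (fun y : E => (1 + ‖y‖) ^ k) μ :=
    memLp_one_iff_integrable.1 (IsGaussian.memLp_of_norm_le _ (by fun_prop) (k := k)
      (C := 1) (fun z => by rw [Real.norm_of_nonneg (by positivity), one_mul]) (by simp))
  calc ‖mehler μ θ g x‖ ≤ ∫ y, C * (1 + ‖x‖) ^ k * (1 + ‖y‖) ^ k ∂μ := by
        refine norm_integral_le_of_norm_le (hi.const_mul _) (ae_of_all _ fun y => ?_)
        refine (h _).trans ?_
        rw [mul_assoc, ← mul_pow]
        gcongr
        have h1 : ‖Real.cos θ • x‖ ≤ ‖x‖ := by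
          rw [norm_smul]
          exact mul_le_of_le_one_left (norm_nonneg _) (Real.abs_cos_le_one θ)
        have h2 : ‖Real.sin θ • y‖ ≤ ‖y‖ := by
          rw [norm_smul]
          exact mul_le_of_le_one_left (norm_nonneg _) (Real.abs_sin_le_one θ)
        nlinarith [norm_add_le (Real.cos θ • x) (Real.sin θ • y), norm_nonneg x, norm_nonneg y,
          mul_nonneg (norm_nonneg x) (norm_nonneg y)]
    _ = _ := by rw [integral_const_mul]; ring

lemma integral_besselPotential_mul_hermite (μ : Measure E) [IsGaussian μ] (hμ : ∫ x, x ∂μ = 0)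
    {ℓ : E →L[ℝ] ℝ} (hℓ : ∫ y, ℓ y ^ 2 ∂μ = 1) {g : E → ℝ} (hg : g.HasTemperateGrowth)
    {r : ℝ} (hr : 0 < r) (k : ℕ) :
    ∫ x, besselPotential μ r g x * aeval (ℓ x) (hermite k) ∂μ =
      (1 + (k : ℝ)) ^ (-r) * ∫ x, g x * aeval (ℓ x) (hermite k) ∂μ := by
  have := isProbabilityMeasure_gammaMeasure hr one_pos
  have hh := hasTemperateGrowth_aeval_dual ℓ (hermite k)
  obtain ⟨m, C, hb⟩ := norm_mehler_le μ hg
  obtain ⟨m', C', hC', hb'⟩ := hh.norm_le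
  have hC : 0 ≤ C := by simpa using (norm_nonneg _).trans (hb 0 0)
  have hint : Integrable (fun z : E × ℝ => mehler μ (mehlerAngle z.2) g z.1 *
      aeval (ℓ z.1) (hermite k)) (μ.prod (gammaMeasure r 1)) := by
    have hi : Integrable (fun x : E => C * C' * (1 + ‖x‖) ^ (m + m')) μ :=
      memLp_one_iff_integrable.1 (IsGaussian.memLp_of_norm_le _ (by fun_prop) (k := m + m')
        (C := C * C') (fun z => (Real.norm_of_nonneg (by positivity)).le) (by simp))
    refine (hi.comp_fst (gammaMeasure r 1)).mono' ?_ (ae_of_all _ fun z => ?_)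
    · exact ((stronglyMeasurable_mehler μ hg.1.continuous.measurable).mul
        (hh.1.continuous.stronglyMeasurable.comp_measurable measurable_fst)).aestronglyMeasurable
    · rw [norm_mul, pow_add]
      calc _ ≤ C * (1 + ‖z.1‖) ^ m * (C' * (1 + ‖z.1‖) ^ m') :=
            mul_le_mul (hb _ _) (hb' _) (norm_nonneg _) (by positivity)
        _ = _ := by ring
  have e1 : ∀ x, besselPotential μ r g x * aeval (ℓ x) (hermite k) =
      ∫ t, mehler μ (mehlerAngle t) g x * aeval (ℓ x) (hermite k) ∂(gammaMeasure r 1) := fun x => by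
    rw [besselPotential, integral_mul_const]
  simp only [e1]
  rw [integral_integral_swap hint]
  simp only [integral_mehler_mul μ hμ hg hh, mehler_hermite μ hμ hℓ, Real.cos_neg]
  rw [← integral_cos_mehlerAngle_pow hr k, ← integral_mul_const]
  congr 1; funext t
  rw [← integral_const_mul]
  congr 1; funext x; ring

lemma enorm_integral_rpow_le_lintegral {X : Type*} [MeasurableSpace X] (κ : Measure X)
    [IsProbabilityMeasure κ] {p : ℝ} (hp : 1 ≤ p) {u : X → ℝ} (hu : AEStronglyMeasurable u κ) :
    ‖∫ x, u x ∂κ‖ₑ ^ p ≤ ∫⁻ x, ‖u x‖ₑ ^ p ∂κ := by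
  have hp0 : 0 < p := by linarith
  have h1 : eLpNorm u 1 κ ≤ eLpNorm u (ENNReal.ofReal p) κ :=
    eLpNorm_le_eLpNorm_of_exponent_le (by simpa using hp) hu
  have h2 : ‖∫ x, u x ∂κ‖ₑ ≤ eLpNorm u (ENNReal.ofReal p) κ :=
    (enorm_integral_le_lintegral_enorm u).trans (by rwa [eLpNorm_one_eq_lintegral_enorm] at h1)
  refine (ENNReal.rpow_le_rpow h2 hp0.le).trans ?_
  rw [eLpNorm_eq_lintegral_rpow_enorm_toReal (by simpa using hp0) (by simp),
    ENNReal.toReal_ofReal hp0.le, one_div, ENNReal.rpow_inv_rpow hp0.ne']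

/-- `(I - L)^{-r}` is a contraction of `L^p(μ)`: by Jensen's inequality, since
`cos θ x + sin θ y` has law `μ` under `μ ⊗ μ`. -/
lemma eLpNorm_besselPotential_le (μ : Measure E) [IsGaussian μ] (hμ : ∫ x, x ∂μ = 0) {g : E → ℝ}
    (hg : Measurable g) {r : ℝ} (hr : 0 < r) {p : ℝ} (hp : 1 ≤ p) :
    eLpNorm (besselPotential μ r g) (ENNReal.ofReal p) μ ≤ eLpNorm g (ENNReal.ofReal p) μ := by
  have := isProbabilityMeasure_gammaMeasure hr one_pos
  have hp0 : 0 < p := by linarith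
  rw [eLpNorm_eq_lintegral_rpow_enorm_toReal (by simpa using hp0) (by simp),
    eLpNorm_eq_lintegral_rpow_enorm_toReal (by simpa using hp0) (by simp),
    ENNReal.toReal_ofReal hp0.le]
  refine ENNReal.rpow_le_rpow ?_ (by positivity)
  have hmeas := measurable_mehler_integrand hg
  have hrot : ∀ θ, ∫⁻ x, ∫⁻ y, ‖g (Real.cos θ • x + Real.sin θ • y)‖ₑ ^ p ∂μ ∂μ =
      ∫⁻ x, ‖g x‖ₑ ^ p ∂μ := by
    intro θ
    have hm : Measurable (fun z : E × E => ‖g z.1‖ₑ ^ p) :=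
      ((hg.comp measurable_fst).enorm).pow_const p
    have hm' : Measurable (fun z : E × E => ‖g (ContinuousLinearMap.rotation θ z).1‖ₑ ^ p) :=
      hm.comp (ContinuousLinearMap.rotation θ).continuous.measurable
    calc _ = ∫⁻ z, ‖g (ContinuousLinearMap.rotation θ z).1‖ₑ ^ p ∂(μ.prod μ) := by
          rw [lintegral_prod _ hm'.aemeasurable]; rfl
      _ = ∫⁻ z, ‖g z.1‖ₑ ^ p ∂(μ.prod μ) := by
          conv_rhs => rw [← IsGaussian.map_rotation_eq_self (μ := μ) (by simpa using hμ) θ]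
          rw [lintegral_map hm (ContinuousLinearMap.rotation θ).continuous.measurable]
      _ = _ := by rw [lintegral_prod _ hm.aemeasurable]; simp
  calc ∫⁻ x, ‖besselPotential μ r g x‖ₑ ^ p ∂μ
      ≤ ∫⁻ x, ∫⁻ t, ∫⁻ y, ‖g (Real.cos (mehlerAngle t) • x + Real.sin (mehlerAngle t) • y)‖ₑ ^ p
          ∂μ ∂(gammaMeasure r 1) ∂μ := by
        refine lintegral_mono fun x => ?_
        refine (enorm_integral_rpow_le_lintegral _ hp ((stronglyMeasurable_mehler μ hg).comp_measurable
          measurable_prodMk_left).aestronglyMeasurable).trans (lintegral_mono fun t => ?_)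
        exact enorm_integral_rpow_le_lintegral _ hp (hmeas.comp measurable_prodMk_left).aestronglyMeasurable
    _ = ∫⁻ t, ∫⁻ x, ∫⁻ y, ‖g (Real.cos (mehlerAngle t) • x + Real.sin (mehlerAngle t) • y)‖ₑ ^ p
          ∂μ ∂μ ∂(gammaMeasure r 1) := by
        rw [lintegral_lintegral_swap]
        exact (hmeas.enorm.pow_const p).lintegral_prod_right'.aemeasurable
    _ = ∫⁻ x, ‖g x‖ₑ ^ p ∂μ := by simp [hrot]

end Mehler

/-! ### The Gaussian Hilbert space spanned by the process -/

section FirstChaos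

open Function Polynomial

set_option linter.unusedSectionVars false

variable {Ω : Type*} [MeasurableSpace Ω] {P : Measure Ω}

/-- An `L²`-limit of centred Gaussian variables is a centred Gaussian variable. -/
lemma map_eq_gaussianReal_of_tendsto_eLpNorm [IsProbabilityMeasure P] {u : ℕ → Ω → ℝ} {ξ : Ω → ℝ}
    (hu : ∀ m, MemLp (u m) 2 P)
    (hg : ∀ m, ∃ v : NNReal, P.map (u m) = gaussianReal 0 v) (hξ : MemLp ξ 2 P)
    (h : Tendsto (fun m => eLpNorm (u m - ξ) 2 P) atTop (𝓝 0)) :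
    ∃ v : NNReal, P.map ξ = gaussianReal 0 v := by
  have hL : Tendsto (fun m => (hu m).toLp (u m)) atTop (𝓝 (hξ.toLp ξ)) :=
    (Lp.tendsto_Lp_iff_tendsto_eLpNorm'' u hu ξ hξ).2 h
  have hnorm := (hL.norm).pow 2
  choose v hv using hg
  have hsq : ∀ m, ‖(hu m).toLp (u m)‖ ^ 2 = (v m : ℝ) := by
    intro m
    have h1 : ‖(hu m).toLp (u m)‖ ^ 2 = ∫ ω, u m ω ^ 2 ∂P := by
      rw [← real_inner_self_eq_norm_sq, L2.inner_def]
      refine integral_congr_ae ?_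
      filter_upwards [(hu m).coeFn_toLp] with ω hω
      rw [hω]; simp [sq]
    have h2 : ∫ ω, u m ω ^ 2 ∂P = ∫ x, x ^ 2 ∂(P.map (u m)) := by
      rw [integral_map (hu m).1.aemeasurable (by fun_prop)]
    have h3 := variance_id_gaussianReal (μ := 0) (v := v m)
    rw [variance_eq_integral (by fun_prop)] at h3
    simp only [id_eq, integral_id_gaussianReal, sub_zero] at h3
    rw [h1, h2, hv m, h3]
  simp only [hsq] at hnorm
  obtain ⟨ns, hns, hae⟩ := (tendstoInMeasure_of_tendsto_eLpNorm (by simp)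
    (fun m => (hu m).1) hξ.1 h).exists_seq_tendsto_ae
  refine ⟨(‖hξ.toLp ξ‖ ^ 2).toNNReal, ?_⟩
  have hpm : IsProbabilityMeasure (P.map ξ) := Measure.isProbabilityMeasure_map hξ.1.aemeasurable
  refine Measure.ext_of_charFun (funext fun t => ?_)
  have key : ∀ w : Ω → ℝ, AEStronglyMeasurable w P →
      charFun (P.map w) t = ∫ ω, Complex.exp (t * w ω * Complex.I) ∂P := by
    intro w hw
    rw [charFun_apply_real, integral_map hw.aemeasurable (by fun_prop)]
  have l1 : Tendsto (fun j => charFun (P.map (u (ns j))) t) atTop (𝓝 (charFun (P.map ξ) t)) := by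
    simp only [key _ (hu _).1, key _ hξ.1]
    refine tendsto_integral_of_dominated_convergence (fun _ => 1) (fun j => ?_)
      (integrable_const _) (fun j => ae_of_all _ fun ω => ?_) ?_
    · have := (hu (ns j)).1.aemeasurable
      exact AEMeasurable.aestronglyMeasurable (by fun_prop)
    · rw [← Complex.ofReal_mul, Complex.norm_exp_ofReal_mul_I]
    · filter_upwards [hae] with ω hω
      have hc : Continuous fun x : ℝ => Complex.exp (t * x * Complex.I) := by fun_prop
      exact (hc.tendsto _).comp hω
  have l2 : Tendsto (fun j => charFun (P.map (u (ns j))) t) atTop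
      (𝓝 (charFun (gaussianReal 0 (‖hξ.toLp ξ‖ ^ 2).toNNReal) t)) := by
    simp only [hv, charFun_gaussianReal]
    have hc : Continuous fun x : ℝ => Complex.exp (t * ((0 : ℝ) : ℂ) * Complex.I - x * t ^ 2 / 2) := by
      fun_prop
    have := (hc.tendsto _).comp (hnorm.comp hns.tendsto_atTop)
    rw [Real.coe_toNNReal _ (sq_nonneg _)]
    exact this
  exact tendsto_nhds_unique l1 l2

variable {H T : ℝ} {B : ℝ → Ω → ℝ}

lemma measurable_sigmaB_of_mem_span {u : Ω → ℝ} (hu : u ∈ Submodule.span ℝ (B '' Set.Icc 0 T)) :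
    Measurable[sigmaB T B] u := by
  refine Submodule.span_induction (p := fun u _ => Measurable[sigmaB T B] u) ?_ ?_ ?_ ?_ hu
  · rintro _ ⟨t, ht, rfl⟩
    refine Measurable.mono ?_ (le_iSup₂ (f := fun t (_ : t ∈ Set.Icc (0 : ℝ) T) =>
      MeasurableSpace.comap (B t) inferInstance) t ht) le_rfl
    exact comap_measurable (B t)
  · exact measurable_const
  · intro x y _ _ hx hy
    exact hx.add hy
  · intro a x _ hx
    exact hx.const_mul a

lemma sigmaB_le (hB : IsFractionalBrownianMotion P H T B) : sigmaB T B ≤ ‹MeasurableSpace Ω› :=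
  iSup₂_le fun t ht => (hB.measurable t ht).comap_le

lemma hasGaussianLaw_of_mem_span (hB : IsFractionalBrownianMotion P H T B) {u : Ω → ℝ}
    (hu : u ∈ Submodule.span ℝ (B '' Set.Icc 0 T)) : HasGaussianLaw u P := by
  have himg : B '' Set.Icc 0 T = (fun t : Set.Icc (0 : ℝ) T => B t) '' Set.univ := by
    ext w; simp
  rw [himg] at hu
  obtain ⟨I, -, c, rfl⟩ := Submodule.mem_span_image_iff_exists_fun ℝ |>.1 hu
  have h := (hB.gaussian.hasGaussianLaw I).map_fun
    (∑ i : I, c i • ContinuousLinearMap.proj (R := ℝ) (φ := fun _ : I => ℝ) i)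
  have e : ∑ i, c i • B i = fun ω => (∑ i : I, c i • ContinuousLinearMap.proj (R := ℝ)
      (φ := fun _ : I => ℝ) i) (I.restrict fun x => B x ω) := by
    funext ω
    simp [Finset.sum_apply]
  rw [e]
  exact h

lemma integral_eq_zero_of_mem_span (hB : IsFractionalBrownianMotion P H T B) {u : Ω → ℝ}
    (hu : u ∈ Submodule.span ℝ (B '' Set.Icc 0 T)) : ∫ ω, u ω ∂P = 0 := by
  have : Integrable u P ∧ ∫ ω, u ω ∂P = 0 := by
    refine Submodule.span_induction (p := fun u _ => Integrable u P ∧ ∫ ω, u ω ∂P = 0)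
      ?_ ?_ ?_ ?_ hu
    · rintro _ ⟨t, ht, rfl⟩
      exact ⟨(hasGaussianLaw_of_mem_span hB (Submodule.subset_span ⟨t, ht, rfl⟩)).integrable,
        hB.mean_eq t ht⟩
    · exact ⟨integrable_zero _ _ _, by simp⟩
    · intro x y _ _ hx hy
      refine ⟨hx.1.add hy.1, ?_⟩
      simp only [Pi.add_apply]
      rw [integral_add hx.1 hy.1, hx.2, hy.2, add_zero]
    · intro a x _ hx
      refine ⟨hx.1.smul a, ?_⟩
      simp only [Pi.smul_apply]
      rw [integral_smul, hx.2, smul_zero]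
  exact this.2

lemma map_eq_gaussianReal_of_mem_firstChaos [IsProbabilityMeasure P]
    (hB : IsFractionalBrownianMotion P H T B)
    {ξ : Ω → ℝ} (hξ : ξ ∈ firstChaos P T B) : ∃ v : NNReal, P.map ξ = gaussianReal 0 v := by
  obtain ⟨h2, u, hu, hlim⟩ := hξ
  refine map_eq_gaussianReal_of_tendsto_eLpNorm
    (fun m => (hasGaussianLaw_of_mem_span hB (hu m)).memLp_two) (fun m => ?_) h2 hlim
  have := (hasGaussianLaw_of_mem_span hB (hu m)).map_eq_gaussianReal
  rw [integral_eq_zero_of_mem_span hB (hu m)] at this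
  exact ⟨_, this⟩

lemma add_const_mul_mem_firstChaos (hB : IsFractionalBrownianMotion P H T B) {u ξ : Ω → ℝ}
    (hu : u ∈ Submodule.span ℝ (B '' Set.Icc 0 T)) (hξ : ξ ∈ firstChaos P T B) (b : ℝ) :
    (fun ω => u ω + b * ξ ω) ∈ firstChaos P T B := by
  obtain ⟨h2, w, hw, hlim⟩ := hξ
  refine ⟨(hasGaussianLaw_of_mem_span hB hu).memLp_two.add (h2.const_mul b),
    fun m => u + b • w m, fun m => add_mem hu (Submodule.smul_mem _ _ (hw m)), ?_⟩
  have e : ∀ m, eLpNorm (u + b • w m - fun ω => u ω + b * ξ ω) 2 P =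
      ‖b‖ₑ * eLpNorm (w m - ξ) 2 P := fun m => by
    rw [← eLpNorm_const_smul]
    congr 1; funext ω
    simp only [Pi.sub_apply, Pi.add_apply, Pi.smul_apply, smul_eq_mul]; ring
  simp only [e]
  simpa using ENNReal.Tendsto.const_mul hlim (Or.inr (by simp))

variable {κ : Type*} [Fintype κ]

/-- The Euclidean random vector with the coordinates `y k`. -/
noncomputable def randomVector (y : κ → Ω → ℝ) (ω : Ω) : EuclideanSpace ℝ κ :=
  WithLp.toLp 2 fun k => y k ω

lemma measurable_randomVector {m : MeasurableSpace Ω} {y : κ → Ω → ℝ}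
    (hy : ∀ k, Measurable[m] (y k)) : Measurable[m] (randomVector y) :=
  (WithLp.measurable_toLp 2 _).comp (measurable_pi_lambda _ hy)

lemma dual_randomVector_mem_span {y : κ → Ω → ℝ}
    (hy : ∀ k, y k ∈ Submodule.span ℝ (B '' Set.Icc 0 T)) (ℓ : EuclideanSpace ℝ κ →L[ℝ] ℝ) :
    (fun ω => ℓ (randomVector y ω)) ∈ Submodule.span ℝ (B '' Set.Icc 0 T) := by
  classical
  have : (fun ω => ℓ (randomVector y ω)) =
      ∑ k, ℓ (EuclideanSpace.single k 1) • y k := by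
    funext ω
    have h1 : randomVector y ω = ∑ k, y k ω • EuclideanSpace.single k (1 : ℝ) := by
      ext j; simp [randomVector, Finset.sum_apply, Pi.single_apply]
    rw [h1, map_sum]
    simp [Finset.sum_apply, mul_comm]
  rw [this]
  exact Submodule.sum_mem _ fun k _ => Submodule.smul_mem _ _ (hy k)

/-- A Gaussian vector of the process together with an element of the first chaos is centred and
jointly Gaussian. -/
lemma isGaussian_map_randomVector_prod [IsProbabilityMeasure P]
    (hB : IsFractionalBrownianMotion P H T B) {y : κ → Ω → ℝ}
    (hy : ∀ k, y k ∈ Submodule.span ℝ (B '' Set.Icc 0 T)) {ξ : Ω → ℝ}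
    (hξ : ξ ∈ firstChaos P T B) :
    ∃ _ : IsGaussian (P.map fun ω => (randomVector y ω, ξ ω)),
      ∫ z, z ∂(P.map fun ω => (randomVector y ω, ξ ω)) = 0 := by
  have hY : Measurable (randomVector y) := measurable_randomVector fun k =>
    (measurable_sigmaB_of_mem_span (hy k)).mono (sigmaB_le hB) le_rfl
  have hpair : AEMeasurable (fun ω => (randomVector y ω, ξ ω)) P :=
    hY.aemeasurable.prodMk hξ.1.1.aemeasurable
  have hdual : ∀ L : EuclideanSpace ℝ κ × ℝ →L[ℝ] ℝ, ∃ v : NNReal,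
      (P.map fun ω => (randomVector y ω, ξ ω)).map L = gaussianReal 0 v := by
    intro L
    rw [AEMeasurable.map_map_of_aemeasurable (by fun_prop) hpair]
    have h := map_eq_gaussianReal_of_mem_firstChaos hB (add_const_mul_mem_firstChaos hB
      (dual_randomVector_mem_span hy (L.comp (.inl ℝ _ _))) hξ (L (0, 1)))
    convert h using 4 with v
    funext ω
    simp only [comp_apply, ContinuousLinearMap.comp_apply, ContinuousLinearMap.inl_apply]
    have : (randomVector y ω, ξ ω) = (randomVector y ω, 0) + ξ ω • ((0 : EuclideanSpace ℝ κ), (1 : ℝ)) := by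
      simp
    rw [this, map_add, map_smul, smul_eq_mul, mul_comm]
  have hG : IsGaussian (P.map fun ω => (randomVector y ω, ξ ω)) :=
    isGaussian_of_isGaussian_map fun L => by
      obtain ⟨v, hv⟩ := hdual L
      rw [hv]; infer_instance
  refine ⟨hG, SeparatingDual.eq_zero_of_forall_dual_eq_zero (R := ℝ) fun L => ?_⟩
  obtain ⟨v, hv⟩ := hdual L
  have h1 := integral_map (μ := P.map fun ω => (randomVector y ω, ξ ω)) (φ := L) (f := id)
    (by fun_prop) (by fun_prop)
  rw [hv] at h1
  simp only [id_eq, integral_id_gaussianReal] at h1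
  rw [← IsGaussian.integral_dual, ← h1]

lemma isGaussian_map_randomVector [IsProbabilityMeasure P]
    (hB : IsFractionalBrownianMotion P H T B) {y : κ → Ω → ℝ}
    (hy : ∀ k, y k ∈ Submodule.span ℝ (B '' Set.Icc 0 T)) :
    ∃ _ : IsGaussian (P.map (randomVector y)), ∫ z, z ∂(P.map (randomVector y)) = 0 := by
  have hY : Measurable (randomVector y) := measurable_randomVector fun k =>
    (measurable_sigmaB_of_mem_span (hy k)).mono (sigmaB_le hB) le_rfl
  have h0 : (0 : Ω → ℝ) ∈ firstChaos P T B :=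
    ⟨MemLp.zero, fun _ => 0, fun _ => zero_mem _, by simp⟩
  obtain ⟨hG, hz⟩ := isGaussian_map_randomVector_prod hB hy h0
  have hm : P.map (randomVector y) = (P.map fun ω => (randomVector y ω, (0 : Ω → ℝ) ω)).map
      (ContinuousLinearMap.fst ℝ (EuclideanSpace ℝ κ) ℝ) := by
    exact (Measure.map_map (ContinuousLinearMap.fst ℝ (EuclideanSpace ℝ κ) ℝ).continuous.measurable
      (hY.prodMk measurable_const)).symm
  rw [hm]
  refine ⟨inferInstance, ?_⟩
  rw [integral_map (by fun_prop) (by fun_prop)]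
  have := ContinuousLinearMap.integral_comp_comm (ContinuousLinearMap.fst ℝ (EuclideanSpace ℝ κ) ℝ)
    (IsGaussian.integrable_id (μ := P.map fun ω => (randomVector y ω, (0 : Ω → ℝ) ω)))
  simp only [id_eq] at this
  rw [this, hz, map_zero]

end FirstChaos

/-! ### Sobolev norms of smooth functionals of a Gaussian vector -/

section Bridge

open Function Polynomial

set_option linter.unusedSectionVars false

variable {E : Type*} [NormedAddCommGroup E] [NormedSpace ℝ E]
  [MeasurableSpace E] [BorelSpace E] [SecondCountableTopology E] [CompleteSpace E]
  {E' : Type*} [NormedAddCommGroup E'] [NormedSpace ℝ E']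
  [MeasurableSpace E'] [BorelSpace E'] [SecondCountableTopology E'] [CompleteSpace E']

/-- The operator `I - L`. -/
noncomputable def oneSubOU (μ : Measure E) [IsGaussian μ] (f : E → ℝ) (x : E) : ℝ :=
  f x - ornsteinUhlenbeck μ f x

lemma hasTemperateGrowth_iterate_oneSubOU (μ : Measure E) [IsGaussian μ] {f : E → ℝ}
    (hf : f.HasTemperateGrowth) (m : ℕ) : ((oneSubOU μ)^[m] f).HasTemperateGrowth := by
  induction m with
  | zero => exact hf
  | succ m ih =>
    rw [iterate_succ_apply']
    exact ih.fun_sub (hasTemperateGrowth_ornsteinUhlenbeck μ ih)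

lemma integral_iterate_oneSubOU_mul_hermite (μ : Measure E) [IsGaussian μ] (hμ : ∫ x, x ∂μ = 0)
    {ℓ : E →L[ℝ] ℝ} (hℓ : ∫ y, ℓ y ^ 2 ∂μ = 1) {f : E → ℝ} (hf : f.HasTemperateGrowth)
    (k m : ℕ) : ∫ x, (oneSubOU μ)^[m] f x * aeval (ℓ x) (hermite k) ∂μ =
      (1 + (k : ℝ)) ^ m * ∫ x, f x * aeval (ℓ x) (hermite k) ∂μ := by
  induction m with
  | zero => simp
  | succ m ih =>
    have hg := hasTemperateGrowth_iterate_oneSubOU μ hf m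
    have hh := hasTemperateGrowth_aeval_dual ℓ (hermite k)
    rw [iterate_succ_apply', pow_succ', mul_assoc, ← ih]
    simp only [oneSubOU, sub_mul]
    rw [integral_sub ((hg.fun_mul hh).integrable μ)
      (((hasTemperateGrowth_ornsteinUhlenbeck μ hg).fun_mul hh).integrable μ),
      integral_ornsteinUhlenbeck_mul_comm μ hμ hg hh]
    simp only [ornsteinUhlenbeck_hermite μ hℓ]
    have : ∀ x, (oneSubOU μ)^[m] f x * (-(k : ℝ) * aeval (ℓ x) (hermite k)) =
        -(k : ℝ) * ((oneSubOU μ)^[m] f x * aeval (ℓ x) (hermite k)) := fun x => by ring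
    simp only [this, integral_const_mul]
    ring

lemma ornsteinUhlenbeck_comp_clm {ν : Measure E'} [IsGaussian ν] {μ : Measure E} [IsGaussian μ]
    (π : E' →L[ℝ] E) (hπ : ν.map π = μ) {f : E → ℝ} (hf : f.HasTemperateGrowth) (z : E') :
    ornsteinUhlenbeck ν (fun z => f (π z)) z = ornsteinUhlenbeck μ f (π z) := by
  have h1 : fderiv ℝ (fun z => f (π z)) = fun z => (fderiv ℝ f (π z)).comp π := by
    funext z
    exact ((hf.differentiable (π z)).hasFDerivAt.comp z π.hasFDerivAt).fderiv
  have h2 : fderiv ℝ (fun z => (fderiv ℝ f (π z)).comp π) z =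
      ((ContinuousLinearMap.compL ℝ E' E ℝ).flip π).comp
        ((fderiv ℝ (fderiv ℝ f) (π z)).comp π) :=
    (((ContinuousLinearMap.compL ℝ E' E ℝ).flip π).hasFDerivAt.comp z
      ((hf.fderiv_right.differentiable (π z)).hasFDerivAt.comp z π.hasFDerivAt)).fderiv
  simp only [ornsteinUhlenbeck, h1]
  rw [h2, covTrace_apply, covTrace_apply, ← hπ, integral_map (by fun_prop)]
  · rfl
  · exact (integrable_apply_apply _ _).1

lemma iterate_oneSubOU_comp_clm {ν : Measure E'} [IsGaussian ν] {μ : Measure E} [IsGaussian μ]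
    (π : E' →L[ℝ] E) (hπ : ν.map π = μ) {f : E → ℝ} (hf : f.HasTemperateGrowth) (m : ℕ) :
    (oneSubOU ν)^[m] (fun z => f (π z)) = fun z => (oneSubOU μ)^[m] f (π z) := by
  induction m with
  | zero => rfl
  | succ m ih =>
    rw [iterate_succ_apply', ih, iterate_succ_apply']
    funext z
    simp only [oneSubOU]
    rw [ornsteinUhlenbeck_comp_clm π hπ (hasTemperateGrowth_iterate_oneSubOU μ hf m)]

lemma besselPotential_comp_clm {ν : Measure E'} {μ : Measure E}
    (π : E' →L[ℝ] E) (hπ : ν.map π = μ) {g : E → ℝ} (hg : Continuous g) (r : ℝ) (z : E') :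
    besselPotential ν r (fun z => g (π z)) z = besselPotential μ r g (π z) := by
  simp only [besselPotential, mehler, ← hπ]
  congr 1; funext t
  rw [integral_map (by fun_prop)]
  · simp
  · exact (by fun_prop : Continuous fun y => g (Real.cos (mehlerAngle t) • π z +
      Real.sin (mehlerAngle t) • y)).aestronglyMeasurable

variable {Ω : Type*} [MeasurableSpace Ω] {P : Measure Ω} [IsProbabilityMeasure P]
  {H T : ℝ} {B : ℝ → Ω → ℝ} {κ : Type*} [Fintype κ]

/-- For a smooth functional `F = f(Y)` of a Gaussian vector `Y` of the process,
`(I - L)^{s/2} F` is `(I - L)^{-(m - s/2)} (I - L)^m f`, evaluated at `Y`. -/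
lemma isBesselPower_besselPotential (hB : IsFractionalBrownianMotion P H T B) {y : κ → Ω → ℝ}
    (hy : ∀ k, y k ∈ Submodule.span ℝ (B '' Set.Icc 0 T))
    [IsGaussian (P.map (randomVector y))] {f : EuclideanSpace ℝ κ → ℝ} (hf : f.HasTemperateGrowth)
    {s : ℝ} {m : ℕ} (hm : s / 2 < m) :
    IsBesselPower P T B s (fun ω => f (randomVector y ω)) (fun ω =>
      besselPotential (P.map (randomVector y)) (m - s / 2)
        ((oneSubOU (P.map (randomVector y)))^[m] f) (randomVector y ω)) := by
  intro k ξ hξ hvar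
  obtain ⟨hν, hν0⟩ := isGaussian_map_randomVector_prod hB hy hξ
  set ν := P.map fun ω => (randomVector y ω, ξ ω) with hνdef
  have hY : Measurable (randomVector y) := measurable_randomVector fun k =>
    (measurable_sigmaB_of_mem_span (hy k)).mono (sigmaB_le hB) le_rfl
  have hpair : AEMeasurable (fun ω => (randomVector y ω, ξ ω)) P :=
    hY.aemeasurable.prodMk hξ.1.1.aemeasurable
  let π : EuclideanSpace ℝ κ × ℝ →L[ℝ] EuclideanSpace ℝ κ := ContinuousLinearMap.fst ℝ _ ℝ
  let ℓ : EuclideanSpace ℝ κ × ℝ →L[ℝ] ℝ := ContinuousLinearMap.snd ℝ _ ℝ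
  have hπ : ν.map π = P.map (randomVector y) := by
    rw [hνdef, AEMeasurable.map_map_of_aemeasurable (by fun_prop) hpair]; rfl
  have hℓ : ∫ z, ℓ z ^ 2 ∂ν = 1 := by
    rw [hνdef, integral_map hpair (by fun_prop)]; exact hvar
  have hfπ : HasTemperateGrowth (fun z => f (π z)) := hf.comp π.hasTemperateGrowth
  have hr : 0 < (m : ℝ) - s / 2 := by linarith
  have hit := hasTemperateGrowth_iterate_oneSubOU (P.map (randomVector y)) hf m
  have hh := hasTemperateGrowth_aeval_dual ℓ (hermite k)
  have e := integral_besselPotential_mul_hermite ν hν0 hℓ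
    (hasTemperateGrowth_iterate_oneSubOU ν hfπ m) hr k
  rw [integral_iterate_oneSubOU_mul_hermite ν hν0 hℓ hfπ, iterate_oneSubOU_comp_clm π hπ hf,
    ← mul_assoc, ← Real.rpow_natCast, ← Real.rpow_add (by positivity),
    show -((m : ℝ) - s / 2) + m = s / 2 by ring] at e
  simp only [besselPotential_comp_clm π hπ hit.1.continuous] at e
  rw [hνdef, integral_map hpair, integral_map hpair] at e
  · rw [show (∫ ω, f (randomVector y ω) * ((1 + (k : ℝ)) ^ (s / 2) *
        aeval (ξ ω) (hermite k)) ∂P) = (1 + (k : ℝ)) ^ (s / 2) *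
        ∫ ω, f (randomVector y ω) * aeval (ξ ω) (hermite k) ∂P by
      rw [← integral_const_mul]; congr 1; funext ω; ring]
    exact e
  · exact (hfπ.fun_mul hh).1.continuous.aestronglyMeasurable
  · refine StronglyMeasurable.aestronglyMeasurable ?_
    exact ((stronglyMeasurable_besselPotential _ hit.1.continuous.measurable hr).comp_measurable
      π.continuous.measurable).mul hh.1.continuous.stronglyMeasurable

lemma memWienerLp_besselPotential (hB : IsFractionalBrownianMotion P H T B) {y : κ → Ω → ℝ}
    (hy : ∀ k, y k ∈ Submodule.span ℝ (B '' Set.Icc 0 T))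
    [IsGaussian (P.map (randomVector y))] (h0 : ∫ z, z ∂(P.map (randomVector y)) = 0)
    {g : EuclideanSpace ℝ κ → ℝ} (hg : g.HasTemperateGrowth)
    {r p : ℝ} (hr : 0 < r) (hp : 1 < p) :
    MemWienerLp P T B p (fun ω => besselPotential (P.map (randomVector y)) r g
      (randomVector y ω)) ∧
    eLpNorm (fun ω => besselPotential (P.map (randomVector y)) r g (randomVector y ω))
      (ENNReal.ofReal p) P ≤ eLpNorm g (ENNReal.ofReal p) (P.map (randomVector y)) := by
  have hYB : Measurable[sigmaB T B] (randomVector y) := measurable_randomVector fun k =>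
    measurable_sigmaB_of_mem_span (hy k)
  have hY : Measurable (randomVector y) := hYB.mono (sigmaB_le hB) le_rfl
  have hsm := stronglyMeasurable_besselPotential (P.map (randomVector y)) hg.1.continuous.measurable
    hr
  have hle : eLpNorm (fun ω => besselPotential (P.map (randomVector y)) r g (randomVector y ω))
      (ENNReal.ofReal p) P ≤ eLpNorm g (ENNReal.ofReal p) (P.map (randomVector y)) := by
    have h := eLpNorm_besselPotential_le (P.map (randomVector y)) h0 hg.1.continuous.measurable
      hr hp.le
    rwa [eLpNorm_map_measure hsm.aestronglyMeasurable hY.aemeasurable] at h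
  refine ⟨⟨⟨(hsm.comp_measurable hY).aestronglyMeasurable, hle.trans_lt ?_⟩, ?_⟩, hle⟩
  · exact (hg.memLp _ (by simp)).2
  · exact StronglyMeasurable.aestronglyMeasurable (hsm.comp_measurable hYB)

/-- The Sobolev norm of a smooth functional `f(Y)` is bounded by an `L^p`-norm of `(I - L)^m f`. -/
theorem sobolevNorm_randomVector_le (hB : IsFractionalBrownianMotion P H T B) {y : κ → Ω → ℝ}
    (hy : ∀ k, y k ∈ Submodule.span ℝ (B '' Set.Icc 0 T))
    [IsGaussian (P.map (randomVector y))]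
    {f : EuclideanSpace ℝ κ → ℝ} (hf : f.HasTemperateGrowth) {s p : ℝ} (hp : 1 < p) {m : ℕ}
    (hm : s / 2 < m) :
    sobolevNorm P T B s p (fun ω => f (randomVector y ω)) ≤
      eLpNorm ((oneSubOU (P.map (randomVector y)))^[m] f) (ENNReal.ofReal p)
        (P.map (randomVector y)) := by
  obtain ⟨_, h0⟩ := isGaussian_map_randomVector hB hy
  have h := memWienerLp_besselPotential hB hy h0
    (hasTemperateGrowth_iterate_oneSubOU (P.map (randomVector y)) hf m)
    (r := m - s / 2) (by linarith) hp
  exact (iInf₂_le _ ⟨h.1, isBesselPower_besselPotential hB hy hf hm⟩).trans h.2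

theorem memDInfty_randomVector (hB : IsFractionalBrownianMotion P H T B) {y : κ → Ω → ℝ}
    (hy : ∀ k, y k ∈ Submodule.span ℝ (B '' Set.Icc 0 T))
    {f : EuclideanSpace ℝ κ → ℝ} (hf : f.HasTemperateGrowth) :
    MemDInfty P T B (fun ω => f (randomVector y ω)) := by
  intro s p hp
  obtain ⟨hG, h0⟩ := isGaussian_map_randomVector hB hy
  have hYB : Measurable[sigmaB T B] (randomVector y) := measurable_randomVector fun k =>
    measurable_sigmaB_of_mem_span (hy k)
  have hY : Measurable (randomVector y) := hYB.mono (sigmaB_le hB) le_rfl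
  obtain ⟨m, hm⟩ := exists_nat_gt (s / 2)
  refine ⟨⟨?_, ?_⟩, _, (memWienerLp_besselPotential hB hy h0
    (hasTemperateGrowth_iterate_oneSubOU (P.map (randomVector y)) hf m)
    (r := m - s / 2) (by linarith) hp).1, isBesselPower_besselPotential hB hy hf hm⟩
  · exact (hf.memLp (P.map (randomVector y)) (by simp)).comp_of_map hY.aemeasurable
  · exact StronglyMeasurable.aestronglyMeasurable
      (hf.1.continuous.stronglyMeasurable.comp_measurable hYB)

end Bridge

/-! ### Functions vanishing at the origin to a given order -/

section Vanish

open Function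

/-- `φ` is of temperate growth and `φ, φ', …, φ^{(k-1)}` vanish at `0`. -/
def VanishesToOrder : ℕ → (ℝ → ℝ) → Prop
  | 0, φ => φ.HasTemperateGrowth
  | k + 1, φ => φ.HasTemperateGrowth ∧ φ 0 = 0 ∧ VanishesToOrder k (deriv φ)

namespace VanishesToOrder

variable {k : ℕ} {φ : ℝ → ℝ}

lemma hasTemperateGrowth (h : VanishesToOrder k φ) : φ.HasTemperateGrowth := by
  cases k with
  | zero => exact h
  | succ k => exact h.1

lemma deriv (h : VanishesToOrder k φ) : VanishesToOrder (k - 1) (deriv φ) := by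
  cases k with
  | zero => exact hasTemperateGrowth_deriv h
  | succ k => exact h.2.2

lemma abs_le (h : VanishesToOrder k φ) :
    ∃ (m : ℕ) (C : ℝ), 0 ≤ C ∧ ∀ x, |φ x| ≤ C * |x| ^ k * (1 + |x|) ^ m := by
  induction k generalizing φ with
  | zero =>
    obtain ⟨m, C, hC, hb⟩ := HasTemperateGrowth.norm_le h
    exact ⟨m, C, hC, fun x => by simpa using hb x⟩
  | succ k ih =>
    obtain ⟨m, C, hC, hb⟩ := ih h.2.2
    refine ⟨m, C, hC, fun x => ?_⟩
    have hx : |φ x - φ 0| ≤ C * |x| ^ k * (1 + |x|) ^ m * |x - 0| := by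
      refine (convex_closedBall (0 : ℝ) |x|).norm_image_sub_le_of_norm_deriv_le
        (fun y _ => h.1.differentiable y) (fun y hy => ?_) (by simp) (by simp)
      have hy' : |y| ≤ |x| := by simpa using hy
      refine (hb y).trans ?_
      gcongr
    rw [h.2.1, sub_zero, sub_zero] at hx
    calc |φ x| ≤ _ := hx
      _ = _ := by ring

lemma id_one : VanishesToOrder 1 (fun x => x) := by
  refine ⟨HasTemperateGrowth.id', rfl, ?_⟩
  simp only [deriv_id'']
  exact HasTemperateGrowth.const 1

lemma of_eventuallyEq_zero (hφ : φ.HasTemperateGrowth) (h : φ =ᶠ[𝓝 0] 0) (k : ℕ) :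
    VanishesToOrder k φ := by
  induction k generalizing φ with
  | zero => exact hφ
  | succ k ih =>
    refine ⟨hφ, h.self_of_nhds, ih (hasTemperateGrowth_deriv hφ) ?_⟩
    have := h.deriv
    simpa using this

end VanishesToOrder

end Vanish

/-! ### Quadratic forms of Gaussian vectors -/

section QuadForm

open Function
open scoped InnerProductSpace

set_option linter.unusedSectionVars false

variable {E : Type*} [NormedAddCommGroup E] [InnerProductSpace ℝ E] [CompleteSpace E]

/-- The quadratic form `x ↦ ⟪A x, x⟫`. -/
noncomputable def quadForm (A : E →L[ℝ] E) (x : E) : ℝ := ⟪A x, x⟫_ℝ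

lemma hasTemperateGrowth_quadForm (A : E →L[ℝ] E) : HasTemperateGrowth (quadForm A) :=
  ((innerSL ℝ (E := E)).comp A).hasTemperateGrowth.clm_apply HasTemperateGrowth.id'

lemma abs_quadForm_le (A : E →L[ℝ] E) (x : E) : |quadForm A x| ≤ ‖A‖ * ‖x‖ ^ 2 := by
  calc |quadForm A x| ≤ ‖A x‖ * ‖x‖ := abs_real_inner_le_norm _ _
    _ ≤ ‖A‖ * ‖x‖ * ‖x‖ := by gcongr; exact A.le_opNorm x
    _ = _ := by ring

/-- The operator `A + A*`, so that `⟪(A + A*) x, ·⟫` is the derivative of `quadForm A` at `x`. -/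
noncomputable def symmPart (A : E →L[ℝ] E) : E →L[ℝ] E := A + ContinuousLinearMap.adjoint A

lemma norm_symmPart_le (A : E →L[ℝ] E) : ‖symmPart A‖ ≤ 2 * ‖A‖ := by
  refine (norm_add_le _ _).trans ?_
  rw [LinearIsometryEquiv.norm_map]; linarith

lemma inner_symmPart_comm (A : E →L[ℝ] E) (x y : E) :
    ⟪symmPart A x, y⟫_ℝ = ⟪x, symmPart A y⟫_ℝ := by
  simp only [symmPart, add_apply, inner_add_left, inner_add_right,
    ContinuousLinearMap.adjoint_inner_left, ContinuousLinearMap.adjoint_inner_right]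
  ring

lemma fderiv_quadForm (A : E →L[ℝ] E) :
    fderiv ℝ (quadForm A) = (innerSL ℝ (E := E)).comp (symmPart A) := by
  funext x
  have h := (A.hasFDerivAt (x := x)).inner ℝ (hasFDerivAt_id x)
  rw [show fderiv ℝ (quadForm A) x = _ from h.fderiv]
  ext y
  simp [symmPart, ContinuousLinearMap.adjoint_inner_left, real_inner_comm]

variable [MeasurableSpace E] [BorelSpace E] [SecondCountableTopology E]

lemma ornsteinUhlenbeck_quadForm (μ : Measure E) [IsGaussian μ] (A : E →L[ℝ] E) (x : E) :
    ornsteinUhlenbeck μ (quadForm A) x = 2 * ∫ y, quadForm A y ∂μ - 2 * quadForm A x := by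
  have h1 : ∀ y, ⟪symmPart A y, y⟫_ℝ = 2 * quadForm A y := fun y => by
    have h := real_inner_comm y (A y)
    simp only [symmPart, add_apply, inner_add_left, ContinuousLinearMap.adjoint_inner_left,
      quadForm]
    linarith
  have h2 : fderiv ℝ (fderiv ℝ (quadForm A)) x = (innerSL ℝ (E := E)).comp (symmPart A) := by
    rw [fderiv_quadForm]
    exact ContinuousLinearMap.fderiv _
  simp only [ornsteinUhlenbeck, h2]
  simp only [fderiv_quadForm, covTrace_apply, ContinuousLinearMap.comp_apply,
    innerSL_apply_apply, h1, integral_const_mul]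

lemma carreDuChamp_quadForm (μ : Measure E) [IsGaussian μ] {S : E →L[ℝ] E} {ε : ℝ}
    (hS : ∀ u v, ∫ y, ⟪u, y⟫_ℝ * ⟪v, y⟫_ℝ ∂μ = ε * ⟪S u, v⟫_ℝ) (A B : E →L[ℝ] E) (x : E) :
    carreDuChamp μ (quadForm A) (quadForm B) x =
      ε * quadForm (symmPart B ∘L S ∘L symmPart A) x := by
  rw [carreDuChamp_apply, fderiv_quadForm, fderiv_quadForm]
  simp only [ContinuousLinearMap.comp_apply, innerSL_apply_apply, hS, quadForm]
  rw [← inner_symmPart_comm]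

end QuadForm

/-! ### Graded families of functionals -/

section Families

open Function
open scoped InnerProductSpace

set_option linter.unusedSectionVars false

variable {I : Type*} {κ : I → Type*} [∀ i, Fintype (κ i)]

/-- A family of centred Gaussian measures `μ i` with the covariance operators `ε i • S i`, where
`ε i ∈ (0, 1]`, and the operator norms of `S i` and the second moments are bounded by `K`. -/
structure IsGaussianFamily (μ : ∀ i, Measure (EuclideanSpace ℝ (κ i))) (ε : I → ℝ)
    (S : ∀ i, EuclideanSpace ℝ (κ i) →L[ℝ] EuclideanSpace ℝ (κ i)) (K : ℝ) : Prop where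
  gaussian : ∀ i, IsGaussian (μ i)
  centred : ∀ i, ∫ x, x ∂(μ i) = 0
  pos : ∀ i, 0 < ε i
  le_one : ∀ i, ε i ≤ 1
  norm_le : ∀ i, ‖S i‖ ≤ K
  cov : ∀ i u v, ∫ y, ⟪u, y⟫_ℝ * ⟪v, y⟫_ℝ ∂(μ i) = ε i * ⟪S i u, v⟫_ℝ
  energy : ∀ i, ∫ x, ‖x‖ ^ 2 ∂(μ i) ≤ K

/-- The centred quadratic form `quadForm A - E[quadForm A]`. -/
noncomputable def centredQuadForm {ι : Type*} [Fintype ι] (μ : Measure (EuclideanSpace ℝ ι))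
    (A : EuclideanSpace ℝ ι →L[ℝ] EuclideanSpace ℝ ι) (x : EuclideanSpace ℝ ι) : ℝ :=
  quadForm A x - ∫ y, quadForm A y ∂μ

/-- The graded algebra of families of functionals generated by bounded constants and quadratic
forms (order `0`), smooth functions of centred quadratic forms (with the order of vanishing at
`0`), and the parameter `ε` (order `2`). A family of order `k` is of size `ε^{k/2}` in every
`L^p`. -/
inductive GradedFamily (μ : ∀ i, Measure (EuclideanSpace ℝ (κ i))) (ε : I → ℝ) :
    ℕ → (∀ i, EuclideanSpace ℝ (κ i) → ℝ) → Prop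
  | const (c : I → ℝ) (C : ℝ) (hc : ∀ i, |c i| ≤ C) : GradedFamily μ ε 0 (fun i _ => c i)
  | quad (A : ∀ i, EuclideanSpace ℝ (κ i) →L[ℝ] EuclideanSpace ℝ (κ i)) (C : ℝ)
      (hA : ∀ i, ‖A i‖ ≤ C) : GradedFamily μ ε 0 (fun i x => quadForm (A i) x)
  | comp (A : ∀ i, EuclideanSpace ℝ (κ i) →L[ℝ] EuclideanSpace ℝ (κ i)) (C : ℝ)
      (hA : ∀ i, ‖A i‖ ≤ C) (k : ℕ) (φ : ℝ → ℝ) (hφ : VanishesToOrder k φ) :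
      GradedFamily μ ε k (fun i x => φ (centredQuadForm (μ i) (A i) x))
  | scale (k : ℕ) (f : ∀ i, EuclideanSpace ℝ (κ i) → ℝ) (hf : GradedFamily μ ε k f) :
      GradedFamily μ ε (k + 2) (fun i x => ε i * f i x)
  | add (k : ℕ) (f g : ∀ i, EuclideanSpace ℝ (κ i) → ℝ) (hf : GradedFamily μ ε k f)
      (hg : GradedFamily μ ε k g) : GradedFamily μ ε k (fun i x => f i x + g i x)
  | mul (j k : ℕ) (f g : ∀ i, EuclideanSpace ℝ (κ i) → ℝ) (hf : GradedFamily μ ε j f)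
      (hg : GradedFamily μ ε k g) : GradedFamily μ ε (j + k) (fun i x => f i x * g i x)
  | weaken (j k : ℕ) (f : ∀ i, EuclideanSpace ℝ (κ i) → ℝ) (hf : GradedFamily μ ε k f)
      (hjk : j ≤ k) : GradedFamily μ ε j f

lemma hasTemperateGrowth_centredQuadForm {ι : Type*} [Fintype ι]
    (μ : Measure (EuclideanSpace ℝ ι)) (A : EuclideanSpace ℝ ι →L[ℝ] EuclideanSpace ℝ ι) :
    HasTemperateGrowth (centredQuadForm μ A) :=
  (hasTemperateGrowth_quadForm A).fun_sub (.const _)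

lemma carreDuChamp_centredQuadForm {ι : Type*} [Fintype ι] (μ : Measure (EuclideanSpace ℝ ι))
    [IsGaussian μ] (A : EuclideanSpace ℝ ι →L[ℝ] EuclideanSpace ℝ ι)
    (g : EuclideanSpace ℝ ι → ℝ) (x : EuclideanSpace ℝ ι) :
    carreDuChamp μ (centredQuadForm μ A) g x = carreDuChamp μ (quadForm A) g x := by
  have : fderiv ℝ (centredQuadForm μ A) = fderiv ℝ (quadForm A) := by
    funext x; exact fderiv_sub_const _
  simp only [carreDuChamp, this]

lemma ornsteinUhlenbeck_centredQuadForm {ι : Type*} [Fintype ι] (μ : Measure (EuclideanSpace ℝ ι))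
    [IsGaussian μ] (A : EuclideanSpace ℝ ι →L[ℝ] EuclideanSpace ℝ ι) (x : EuclideanSpace ℝ ι) :
    ornsteinUhlenbeck μ (centredQuadForm μ A) x = -2 * centredQuadForm μ A x := by
  have : fderiv ℝ (centredQuadForm μ A) = fderiv ℝ (quadForm A) := by
    funext x; exact fderiv_sub_const _
  have h := ornsteinUhlenbeck_quadForm μ A x
  simp only [ornsteinUhlenbeck, this] at h ⊢
  rw [h, centredQuadForm]; ring

variable {μ : ∀ i, Measure (EuclideanSpace ℝ (κ i))} {ε : I → ℝ}
  {S : ∀ i, EuclideanSpace ℝ (κ i) →L[ℝ] EuclideanSpace ℝ (κ i)} {K : ℝ}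

namespace GradedFamily

lemma hasTemperateGrowth {k : ℕ} {f : ∀ i, EuclideanSpace ℝ (κ i) → ℝ}
    (hf : GradedFamily μ ε k f) (i : I) : (f i).HasTemperateGrowth := by
  induction hf with
  | const c C hc => exact .const _
  | quad A C hA => exact hasTemperateGrowth_quadForm _
  | comp A C hA k φ hφ =>
    exact hφ.hasTemperateGrowth.comp (hasTemperateGrowth_centredQuadForm (μ i) (A i))
  | scale k f hf ih => exact (HasTemperateGrowth.const _).fun_mul ih
  | add k f g hf hg ihf ihg => exact ihf.fun_add ihg
  | mul j k f g hf hg ihf ihg => exact ihf.fun_mul ihg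
  | weaken j k f hf hjk ih => exact ih

lemma zero (k : ℕ) : GradedFamily μ ε k (fun _ _ => 0) :=
  comp (fun _ => 0) 0 (by simp) k (fun _ => 0)
    (.of_eventuallyEq_zero (.const 0) (Eventually.of_forall fun _ => rfl) k)

lemma const_mul {k : ℕ} {f : ∀ i, EuclideanSpace ℝ (κ i) → ℝ} (hf : GradedFamily μ ε k f)
    (c : ℝ) : GradedFamily μ ε k (fun i x => c * f i x) := by
  have := mul 0 k _ f (const (μ := μ) (ε := ε) (fun _ => c) |c| fun _ => le_rfl) hf
  rwa [zero_add] at this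

lemma sub {k : ℕ} {f g : ∀ i, EuclideanSpace ℝ (κ i) → ℝ} (hf : GradedFamily μ ε k f)
    (hg : GradedFamily μ ε k g) : GradedFamily μ ε k (fun i x => f i x - g i x) := by
  have := add k f _ hf (hg.const_mul (-1))
  simpa [sub_eq_add_neg] using this

lemma centred (A : ∀ i, EuclideanSpace ℝ (κ i) →L[ℝ] EuclideanSpace ℝ (κ i)) (C : ℝ)
    (hA : ∀ i, ‖A i‖ ≤ C) : GradedFamily μ ε 1 (fun i x => centredQuadForm (μ i) (A i) x) :=
  comp A C hA 1 _ .id_one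

variable (hμ : IsGaussianFamily μ ε S K) [∀ i, IsGaussian (μ i)]
include hμ

lemma carreDuChamp_quadForm_quadForm
    (A B : ∀ i, EuclideanSpace ℝ (κ i) →L[ℝ] EuclideanSpace ℝ (κ i)) (C D : ℝ)
    (hA : ∀ i, ‖A i‖ ≤ C) (hB : ∀ i, ‖B i‖ ≤ D) :
    GradedFamily μ ε 2 (fun i x => carreDuChamp (μ i) (quadForm (A i)) (quadForm (B i)) x) := by
  have h : GradedFamily μ ε 2 (fun i x => ε i *
      quadForm (symmPart (B i) ∘L S i ∘L symmPart (A i)) x) := by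
    refine scale 0 _ (quad _ (2 * D * (K * (2 * C))) fun i => ?_)
    have h1 := (norm_symmPart_le (B i)).trans (mul_le_mul_of_nonneg_left (hB i) zero_le_two)
    have h2 := (norm_symmPart_le (A i)).trans (mul_le_mul_of_nonneg_left (hA i) zero_le_two)
    have h3 := hμ.norm_le i
    refine (ContinuousLinearMap.opNorm_comp_le _ _).trans ?_
    refine mul_le_mul h1 ((ContinuousLinearMap.opNorm_comp_le _ _).trans
      (mul_le_mul h3 h2 (norm_nonneg _) ((norm_nonneg _).trans h3))) (norm_nonneg _)
      ((norm_nonneg _).trans h1)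
  simpa only [← carreDuChamp_quadForm _ (hμ.cov _)] using h

/-- The carré du champ with a quadratic form raises the order by one. -/
lemma carreDuChamp_quadForm {k : ℕ} {g : ∀ i, EuclideanSpace ℝ (κ i) → ℝ}
    (hg : GradedFamily μ ε k g) (A : ∀ i, EuclideanSpace ℝ (κ i) →L[ℝ] EuclideanSpace ℝ (κ i))
    (C : ℝ) (hA : ∀ i, ‖A i‖ ≤ C) :
    GradedFamily μ ε (k + 1) (fun i x => carreDuChamp (μ i) (g i) (quadForm (A i)) x) := by
  induction hg with
  | const c C hc =>
    simp only [carreDuChamp_const_left]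
    exact zero _
  | quad B D hB =>
    exact weaken _ 2 _ (carreDuChamp_quadForm_quadForm hμ B A D C hB hA) (by norm_num)
  | comp B D hB k φ hφ =>
    have h := mul _ _ _ _ (comp (μ := μ) (ε := ε) B D hB _ _ hφ.deriv)
      (carreDuChamp_quadForm_quadForm hμ B A D C hB hA)
    refine weaken _ _ _ ?_ (show k + 1 ≤ k - 1 + 2 by omega)
    simpa only [carreDuChamp_comp_left _ _ hφ.hasTemperateGrowth
      (hasTemperateGrowth_centredQuadForm _ _), carreDuChamp_centredQuadForm] using h
  | scale k f hf ih =>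
    simpa only [carreDuChamp_const_mul_left _ _ (hf.hasTemperateGrowth _)] using scale _ _ ih
  | add k f g hf hg ihf ihg =>
    simpa only [carreDuChamp_add_left _ _ (hf.hasTemperateGrowth _) (hg.hasTemperateGrowth _)]
      using add _ _ _ ihf ihg
  | mul j k f g hf hg ihf ihg =>
    have h := add _ _ _ (mul _ _ _ _ hf ihg)
      (weaken (j + (k + 1)) _ _ (mul _ _ _ _ hg ihf) (by omega))
    rw [← add_assoc] at h
    simpa only [carreDuChamp_mul_left _ _ (hf.hasTemperateGrowth _) (hg.hasTemperateGrowth _)]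
      using h
  | weaken j k f hf hjk ih => exact weaken _ _ _ ih (by omega)

/-- The carré du champ is compatible with the grading. -/
lemma carreDuChamp {j k : ℕ} {f g : ∀ i, EuclideanSpace ℝ (κ i) → ℝ}
    (hf : GradedFamily μ ε j f) (hg : GradedFamily μ ε k g) :
    GradedFamily μ ε (j + k) (fun i x => carreDuChamp (μ i) (f i) (g i) x) := by
  induction hf with
  | const c C hc =>
    simp only [carreDuChamp_const_left]
    exact zero _
  | quad B D hB =>
    simp only [carreDuChamp_comm _ (quadForm _)]
    exact weaken _ _ _ (carreDuChamp_quadForm hμ hg B D hB) (by omega)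
  | comp B D hB j φ hφ =>
    have h := mul _ _ _ _ (comp (μ := μ) (ε := ε) B D hB _ _ hφ.deriv)
      (carreDuChamp_quadForm hμ hg B D hB)
    refine weaken _ _ _ ?_ (show j + k ≤ j - 1 + (k + 1) by omega)
    simpa only [carreDuChamp_comp_left _ _ hφ.hasTemperateGrowth
      (hasTemperateGrowth_centredQuadForm _ _), carreDuChamp_centredQuadForm,
      carreDuChamp_comm _ (quadForm _)] using h
  | scale j f hf ih =>
    have h := scale _ _ ih
    rw [show j + k + 2 = j + 2 + k by ring] at h
    simpa only [carreDuChamp_const_mul_left _ _ (hf.hasTemperateGrowth _)] using h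
  | add j f f' hf hf' ihf ihg =>
    simpa only [carreDuChamp_add_left _ _ (hf.hasTemperateGrowth _) (hf'.hasTemperateGrowth _)]
      using add _ _ _ ihf ihg
  | mul j j' f f' hf hf' ihf ihg =>
    have h := add _ _ _ (mul _ _ _ _ hf ihg)
      (weaken (j + (j' + k)) _ _ (mul _ _ _ _ hf' ihf) (by omega))
    rw [← add_assoc] at h
    simpa only [carreDuChamp_mul_left _ _ (hf.hasTemperateGrowth _) (hf'.hasTemperateGrowth _)]
      using h
  | weaken j j' f hf hjk ih => exact weaken _ _ _ ih (by omega)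

lemma abs_integral_quadForm_le (i : I)
    (A : EuclideanSpace ℝ (κ i) →L[ℝ] EuclideanSpace ℝ (κ i)) :
    |∫ x, quadForm A x ∂(μ i)| ≤ ‖A‖ * K := by
  have h2 : Integrable (fun y : EuclideanSpace ℝ (κ i) => ‖y‖ ^ 2) (μ i) :=
    (IsGaussian.memLp_id (μ i) 2 (by simp)).integrable_norm_pow (by simp)
  calc |∫ x, quadForm A x ∂(μ i)| ≤ ∫ x, ‖A‖ * ‖x‖ ^ 2 ∂(μ i) := by
        rw [← Real.norm_eq_abs]
        exact norm_integral_le_of_norm_le (h2.const_mul _)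
          (ae_of_all _ fun x => abs_quadForm_le A x)
    _ = ‖A‖ * ∫ x, ‖x‖ ^ 2 ∂(μ i) := integral_const_mul _ _
    _ ≤ _ := mul_le_mul_of_nonneg_left (hμ.energy i) (norm_nonneg _)

/-- The Ornstein–Uhlenbeck operator preserves the grading. -/
lemma ornsteinUhlenbeck {k : ℕ} {f : ∀ i, EuclideanSpace ℝ (κ i) → ℝ}
    (hf : GradedFamily μ ε k f) :
    GradedFamily μ ε k (fun i x => ornsteinUhlenbeck (μ i) (f i) x) := by
  induction hf with
  | const c C hc =>
    simp only [ornsteinUhlenbeck_const]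
    exact zero _
  | quad A C hA =>
    simp only [ornsteinUhlenbeck_quadForm]
    refine sub (const _ (2 * (C * |K|)) fun i => ?_) (const_mul (quad A C hA) 2)
    rw [abs_mul, abs_two]
    have h1 := abs_integral_quadForm_le hμ i (A i)
    have h2 : ‖A i‖ * K ≤ C * |K| := by
      have := hA i
      have h3 := le_abs_self K
      have h4 := abs_nonneg K
      have h5 := norm_nonneg (A i)
      nlinarith
    linarith
  | comp A C hA k φ hφ =>
    have h1 := weaken k _ _ (mul _ _ _ _ (comp (μ := μ) (ε := ε) A C hA _ _ hφ.deriv)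
      (const_mul (centred A C hA) (-2))) (by omega)
    have h2 := weaken k _ _ (mul _ _ _ _ (comp (μ := μ) (ε := ε) A C hA _ _ hφ.deriv.deriv)
      (carreDuChamp_quadForm_quadForm hμ A A C C hA hA)) (by omega)
    have h := add _ _ _ h1 h2
    have e : ∀ i x, _root_.carreDuChamp (μ i) (centredQuadForm (μ i) (A i))
        (centredQuadForm (μ i) (A i)) x =
        _root_.carreDuChamp (μ i) (quadForm (A i)) (quadForm (A i)) x := fun i x => by
      rw [carreDuChamp_centredQuadForm, carreDuChamp_comm, carreDuChamp_centredQuadForm]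
    simpa only [ornsteinUhlenbeck_comp _ hφ.hasTemperateGrowth
      (hasTemperateGrowth_centredQuadForm _ _), ornsteinUhlenbeck_centredQuadForm, e] using h
  | scale k f hf ih =>
    simpa only [ornsteinUhlenbeck_const_mul _ (hf.hasTemperateGrowth _)] using scale _ _ ih
  | add k f g hf hg ihf ihg =>
    simpa only [ornsteinUhlenbeck_add _ (hf.hasTemperateGrowth _) (hg.hasTemperateGrowth _)]
      using add _ _ _ ihf ihg
  | mul j k f g hf hg ihf ihg =>
    have h1 := mul _ _ _ _ hg ihf
    rw [add_comm k j] at h1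
    have h := add _ _ _ (add _ _ _ (mul _ _ _ _ hf ihg) h1)
      (const_mul (carreDuChamp hμ hf hg) 2)
    simpa only [ornsteinUhlenbeck_mul _ (hf.hasTemperateGrowth _) (hg.hasTemperateGrowth _)]
      using h
  | weaken j k f hf hjk ih => exact weaken _ _ _ ih hjk

lemma iterate_oneSubOU {k : ℕ} {f : ∀ i, EuclideanSpace ℝ (κ i) → ℝ}
    (hf : GradedFamily μ ε k f) (m : ℕ) :
    GradedFamily μ ε k (fun i x => (oneSubOU (μ i))^[m] (f i) x) := by
  induction m with
  | zero => exact hf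
  | succ m ih =>
    simp only [iterate_succ_apply']
    exact sub ih (ornsteinUhlenbeck hμ ih)

end GradedFamily

end Families

/-! ### Moment bounds for graded families -/

section Moments

open Function
open scoped InnerProductSpace

set_option linter.unusedSectionVars false

variable {I : Type*} {κ : I → Type*} [∀ i, Fintype (κ i)]
  {μ : ∀ i, Measure (EuclideanSpace ℝ (κ i))} {ε : I → ℝ}
  {S : ∀ i, EuclideanSpace ℝ (κ i) →L[ℝ] EuclideanSpace ℝ (κ i)} {K : ℝ}

lemma hasTemperateGrowth_pow_real (q : ℕ) : HasTemperateGrowth (fun u : ℝ => u ^ q) := by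
  fun_prop

lemma deriv_pow_succ (q : ℕ) :
    deriv (fun u : ℝ => u ^ (q + 1)) = fun u => ((q : ℝ) + 1) * u ^ q := by
  funext u; simp

lemma deriv_deriv_pow_succ (q : ℕ) :
    deriv (deriv fun u : ℝ => u ^ (q + 1)) = fun u => ((q : ℝ) + 1) * (q * u ^ (q - 1)) := by
  funext u; rw [deriv_pow_succ]; simp

lemma quadForm_id {E : Type*} [NormedAddCommGroup E] [InnerProductSpace ℝ E] (x : E) :
    quadForm (ContinuousLinearMap.id ℝ E) x = ‖x‖ ^ 2 := by
  simp [quadForm]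

namespace IsGaussianFamily

lemma bound_nonneg (hμ : IsGaussianFamily μ ε S K) (i : I) : 0 ≤ K :=
  (norm_nonneg _).trans (hμ.norm_le i)

variable [∀ i, IsGaussian (μ i)]

lemma carreDuChamp_quadForm_self_le (hμ : IsGaussianFamily μ ε S K) (i : I)
    (A : EuclideanSpace ℝ (κ i) →L[ℝ] EuclideanSpace ℝ (κ i)) {C : ℝ} (hA : ‖A‖ ≤ C)
    (x : EuclideanSpace ℝ (κ i)) :
    carreDuChamp (μ i) (quadForm A) (quadForm A) x ≤ ε i * (4 * C ^ 2 * K * ‖x‖ ^ 2) := by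
  rw [_root_.carreDuChamp_quadForm _ (hμ.cov i)]
  have h1 := norm_symmPart_le A
  have h2 : ‖symmPart A ∘L S i ∘L symmPart A‖ ≤ (2 * C) * (K * (2 * C)) := by
    have h3 : ‖symmPart A‖ ≤ 2 * C := h1.trans (by linarith)
    refine (ContinuousLinearMap.opNorm_comp_le _ _).trans ?_
    refine mul_le_mul h3 ((ContinuousLinearMap.opNorm_comp_le _ _).trans
      (mul_le_mul (hμ.norm_le i) h3 (norm_nonneg _) (hμ.bound_nonneg i))) (norm_nonneg _)
      ((norm_nonneg _).trans h3)
  refine mul_le_mul_of_nonneg_left ?_ (hμ.pos i).le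
  refine (le_abs_self _).trans ((abs_quadForm_le _ x).trans ?_)
  calc _ ≤ (2 * C) * (K * (2 * C)) * ‖x‖ ^ 2 := by gcongr
    _ = _ := by ring

lemma integrable_norm_pow (i : I) (q : ℕ) :
    Integrable (fun x : EuclideanSpace ℝ (κ i) => (‖x‖ ^ 2) ^ q) (μ i) :=
  (HasTemperateGrowth.pow (f := fun x : EuclideanSpace ℝ (κ i) => ‖x‖ ^ 2)
    (Function.hasTemperateGrowth_norm_sq _) q).integrable _

/-- The moments of the norm are bounded: a recursion from `E[L(‖x‖^{2q})] = 0`. -/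
lemma exists_integral_norm_pow_le (hμ : IsGaussianFamily μ ε S K) (q : ℕ) :
    ∃ C, 0 ≤ C ∧ ∀ i, ∫ x, (‖x‖ ^ 2) ^ q ∂(μ i) ≤ C := by
  induction q with
  | zero => exact ⟨1, zero_le_one, fun i => by simp⟩
  | succ q ih =>
    obtain ⟨C, hC0, hC⟩ := ih
    refine ⟨|(K + 2 * q * K) * C|, abs_nonneg _, fun i => ?_⟩
    have hK := hμ.bound_nonneg i
    have hU := hasTemperateGrowth_quadForm (ContinuousLinearMap.id ℝ (EuclideanSpace ℝ (κ i)))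
    have h0 := integral_ornsteinUhlenbeck (μ i) (hμ.centred i)
      ((hasTemperateGrowth_pow_real (q + 1)).comp hU)
    have e : ∀ x, ornsteinUhlenbeck (μ i) ((fun u : ℝ => u ^ (q + 1)) ∘
        quadForm (ContinuousLinearMap.id ℝ (EuclideanSpace ℝ (κ i)))) x ≤
        ((q : ℝ) + 1) * ((2 * K + 4 * q * K) * (‖x‖ ^ 2) ^ q - 2 * (‖x‖ ^ 2) ^ (q + 1)) := by
      intro x
      have h1 := ornsteinUhlenbeck_comp (μ i) (hasTemperateGrowth_pow_real (q + 1)) hU x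
      rw [ornsteinUhlenbeck_quadForm, deriv_deriv_pow_succ, deriv_pow_succ] at h1
      have h2 := hμ.carreDuChamp_quadForm_self_le i _ ContinuousLinearMap.norm_id_le x
      have h3 := hμ.energy i
      refine h1.trans_le ?_
      simp only [quadForm_id]
      have h4 : ε i * (4 * 1 ^ 2 * K * ‖x‖ ^ 2) ≤ 4 * K * ‖x‖ ^ 2 := by
        have := hμ.le_one i
        have h5 : 0 ≤ 4 * 1 ^ 2 * K * ‖x‖ ^ 2 := by positivity
        nlinarith
      have h5 : (q : ℝ) * (‖x‖ ^ 2) ^ (q - 1) * carreDuChamp (μ i)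
          (quadForm (ContinuousLinearMap.id ℝ _)) (quadForm (ContinuousLinearMap.id ℝ _)) x ≤
          4 * q * K * (‖x‖ ^ 2) ^ q := by
        rcases Nat.eq_zero_or_pos q with rfl | hq
        · simp
        · obtain ⟨p, rfl⟩ := Nat.exists_eq_succ_of_ne_zero hq.ne'
          simp only [Nat.succ_eq_add_one, Nat.add_sub_cancel]
          calc _ ≤ ((p + 1 : ℕ) : ℝ) * (‖x‖ ^ 2) ^ p * (4 * K * ‖x‖ ^ 2) :=
                mul_le_mul_of_nonneg_left (h2.trans h4) (by positivity)
            _ = _ := by ring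
      have h6 : (‖x‖ ^ 2) ^ q * (2 * ∫ y, ‖y‖ ^ 2 ∂(μ i)) ≤ (‖x‖ ^ 2) ^ q * (2 * K) := by
        gcongr
      have h7 : (0 : ℝ) ≤ (q : ℝ) + 1 := by positivity
      have h8 := mul_le_mul_of_nonneg_left (add_le_add h5 h6) h7
      calc _ = ((q : ℝ) + 1) * ((q : ℝ) * (‖x‖ ^ 2) ^ (q - 1) * carreDuChamp (μ i)
          (quadForm (ContinuousLinearMap.id ℝ _)) (quadForm (ContinuousLinearMap.id ℝ _)) x +
          (‖x‖ ^ 2) ^ q * (2 * ∫ y, ‖y‖ ^ 2 ∂(μ i))) -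
          ((q : ℝ) + 1) * (2 * (‖x‖ ^ 2) ^ (q + 1)) := by ring
        _ ≤ _ := sub_le_sub_right h8 _
        _ = _ := by ring
    have i1 := integrable_norm_pow (μ := μ) i q
    have i2 := integrable_norm_pow (μ := μ) i (q + 1)
    have h1 := integral_mono ((hasTemperateGrowth_ornsteinUhlenbeck (μ i)
      ((hasTemperateGrowth_pow_real (q + 1)).comp hU)).integrable (μ i))
      (((i1.const_mul (2 * K + 4 * q * K)).sub (i2.const_mul 2)).const_mul ((q : ℝ) + 1)) e
    rw [h0] at h1
    simp only [Pi.sub_apply] at h1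
    rw [integral_const_mul, integral_sub (i1.const_mul _) (i2.const_mul _), integral_const_mul,
      integral_const_mul] at h1
    have h2 := nonneg_of_mul_nonneg_right h1 (by positivity)
    have h3 : (2 * K + 4 * q * K) * ∫ x, (‖x‖ ^ 2) ^ q ∂(μ i) ≤ (2 * K + 4 * q * K) * C :=
      mul_le_mul_of_nonneg_left (hC i) (by positivity)
    refine le_trans ?_ (le_abs_self _)
    linarith

/-- The even moments of centred quadratic forms are of order `ε^q`: this follows from
`E[L(F^{2q})] = 0`, as `L F = -2 F` and `Γ(F, F)` is of order `ε`. -/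
lemma exists_integral_centredQuadForm_pow_le (hμ : IsGaussianFamily μ ε S K)
    (A : ∀ i, EuclideanSpace ℝ (κ i) →L[ℝ] EuclideanSpace ℝ (κ i)) (C : ℝ)
    (hA : ∀ i, ‖A i‖ ≤ C) (q : ℕ) :
    ∃ D, 0 ≤ D ∧ ∀ i, ∫ x, centredQuadForm (μ i) (A i) x ^ (2 * q) ∂(μ i) ≤ D * ε i ^ q := by
  cases q with
  | zero => exact ⟨1, zero_le_one, fun i => by simp⟩
  | succ p =>
    obtain ⟨M, hM0, hM⟩ := hμ.exists_integral_norm_pow_le (p + 1)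
    refine ⟨|((2 * p + 1) * (4 * C ^ 2 * K)) ^ (p + 1)| * M, by positivity, fun i => ?_⟩
    have hK := hμ.bound_nonneg i
    set F := centredQuadForm (μ i) (A i) with hFdef
    have hF : HasTemperateGrowth F := hasTemperateGrowth_centredQuadForm _ _
    set b : ℝ := (2 * p + 1) * (4 * C ^ 2 * K) * ε i with hb
    have hb0 : 0 ≤ b := by have := (hμ.pos i).le; positivity
    have h0 := integral_ornsteinUhlenbeck (μ i) (hμ.centred i)
      ((hasTemperateGrowth_pow_real (2 * p + 1 + 1)).comp hF)
    have e : ∀ x, ornsteinUhlenbeck (μ i) ((fun u : ℝ => u ^ (2 * p + 1 + 1)) ∘ F) x ≤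
        ((2 * p + 1 : ℕ) + 1 : ℝ) *
          (b ^ (p + 1) * (‖x‖ ^ 2) ^ (p + 1) - F x ^ (2 * (p + 1))) := by
      intro x
      have h1 := ornsteinUhlenbeck_comp (μ i) (hasTemperateGrowth_pow_real (2 * p + 1 + 1)) hF x
      rw [hFdef, ornsteinUhlenbeck_centredQuadForm, carreDuChamp_centredQuadForm,
        carreDuChamp_comm, carreDuChamp_centredQuadForm, deriv_deriv_pow_succ, deriv_pow_succ,
        ← hFdef] at h1
      have h2 := hμ.carreDuChamp_quadForm_self_le i (A i) (hA i) x
      refine h1.trans_le ?_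
      simp only [Nat.add_sub_cancel]
      have hsq : 0 ≤ F x ^ 2 := sq_nonneg _
      have h3 : (2 * p + 1 : ℝ) * F x ^ (2 * p) * carreDuChamp (μ i) (quadForm (A i))
          (quadForm (A i)) x ≤ (F x ^ 2) ^ p * (b * ‖x‖ ^ 2) := by
        calc _ ≤ (2 * p + 1 : ℝ) * F x ^ (2 * p) * (ε i * (4 * C ^ 2 * K * ‖x‖ ^ 2)) :=
              mul_le_mul_of_nonneg_left h2 (by rw [pow_mul]; positivity)
          _ = _ := by rw [hb, pow_mul]; ring
      -- Young's inequality `a ^ p * c ≤ a ^ (p + 1) + c ^ (p + 1)`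
      have h4 : (F x ^ 2) ^ p * (b * ‖x‖ ^ 2) ≤
          (F x ^ 2) ^ (p + 1) + (b * ‖x‖ ^ 2) ^ (p + 1) := by
        have hc : 0 ≤ b * ‖x‖ ^ 2 := by positivity
        have p1 : 0 ≤ (F x ^ 2) ^ (p + 1) := by positivity
        have p2 : 0 ≤ (b * ‖x‖ ^ 2) ^ (p + 1) := by positivity
        rcases le_total (b * ‖x‖ ^ 2) (F x ^ 2) with h | h
        · have : (F x ^ 2) ^ p * (b * ‖x‖ ^ 2) ≤ (F x ^ 2) ^ p * F x ^ 2 := by gcongr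
          rw [← pow_succ] at this; linarith
        · have : (F x ^ 2) ^ p * (b * ‖x‖ ^ 2) ≤ (b * ‖x‖ ^ 2) ^ p * (b * ‖x‖ ^ 2) := by gcongr
          rw [← pow_succ] at this; linarith
      have h5 : (0 : ℝ) ≤ ((2 * p + 1 : ℕ) + 1 : ℝ) := by positivity
      have h6 := mul_le_mul_of_nonneg_left (h3.trans h4) h5
      have e1 : F x ^ (2 * (p + 1)) = (F x ^ 2) ^ (p + 1) := pow_mul _ _ _
      have e2 : F x ^ (2 * p + 1) * F x = (F x ^ 2) ^ (p + 1) := by rw [← pow_mul]; ring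
      rw [e1, ← mul_pow]
      calc _ = ((2 * p + 1 : ℕ) + 1 : ℝ) * ((2 * p + 1 : ℝ) * F x ^ (2 * p) *
            carreDuChamp (μ i) (quadForm (A i)) (quadForm (A i)) x) -
            2 * (((2 * p + 1 : ℕ) + 1 : ℝ) * (F x ^ (2 * p + 1) * F x)) := by push_cast; ring
        _ ≤ ((2 * p + 1 : ℕ) + 1 : ℝ) * ((F x ^ 2) ^ (p + 1) + (b * ‖x‖ ^ 2) ^ (p + 1)) -
            2 * (((2 * p + 1 : ℕ) + 1 : ℝ) * (F x ^ (2 * p + 1) * F x)) := sub_le_sub_right h6 _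
        _ = _ := by rw [e2, mul_pow]; ring
    have i1 := integrable_norm_pow (μ := μ) i (p + 1)
    have i2 : Integrable (fun x => F x ^ (2 * (p + 1))) (μ i) :=
      ((hasTemperateGrowth_pow_real (2 * (p + 1))).comp hF).integrable _
    have h1 := integral_mono ((hasTemperateGrowth_ornsteinUhlenbeck (μ i)
      ((hasTemperateGrowth_pow_real (2 * p + 1 + 1)).comp hF)).integrable (μ i))
      (((i1.const_mul (b ^ (p + 1))).sub i2).const_mul ((2 * p + 1 : ℕ) + 1 : ℝ)) e
    rw [h0] at h1
    simp only [Pi.sub_apply] at h1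
    rw [integral_const_mul, integral_sub (i1.const_mul _) i2, integral_const_mul] at h1
    have h2 := nonneg_of_mul_nonneg_right h1 (by positivity)
    have h3 : b ^ (p + 1) * ∫ x, (‖x‖ ^ 2) ^ (p + 1) ∂(μ i) ≤ b ^ (p + 1) * M :=
      mul_le_mul_of_nonneg_left (hM i) (by positivity)
    have h4 : b ^ (p + 1) = |((2 * p + 1) * (4 * C ^ 2 * K)) ^ (p + 1)| * ε i ^ (p + 1) := by
      rw [hb, mul_pow, abs_of_nonneg (by positivity)]
    calc _ ≤ b ^ (p + 1) * M := by linarith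
      _ = _ := by rw [h4]; ring

end IsGaussianFamily

namespace GradedFamily

variable [∀ i, IsGaussian (μ i)]

lemma integrable_pow {k : ℕ} {f : ∀ i, EuclideanSpace ℝ (κ i) → ℝ} (hf : GradedFamily μ ε k f)
    (i : I) (q : ℕ) : Integrable (fun x => f i x ^ q) (μ i) :=
  ((hasTemperateGrowth_pow_real q).comp (hf.hasTemperateGrowth i)).integrable _

/-- A graded family of order `k` has moments `E[f^{2q}] = O(ε^{k q})`. -/
theorem exists_integral_pow_le (hμ : IsGaussianFamily μ ε S K) {k : ℕ}
    {f : ∀ i, EuclideanSpace ℝ (κ i) → ℝ} (hf : GradedFamily μ ε k f) (q : ℕ) :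
    ∃ C, 0 ≤ C ∧ ∀ i, ∫ x, f i x ^ (2 * q) ∂(μ i) ≤ C * ε i ^ (k * q) := by
  induction hf generalizing q with
  | const c C hc =>
    refine ⟨(C ^ 2) ^ q, by positivity, fun i => ?_⟩
    have h1 : c i ^ 2 ≤ C ^ 2 := sq_le_sq' (by linarith [neg_le_of_abs_le (hc i)])
      (le_of_abs_le (hc i))
    simp only [integral_const, probReal_univ, one_smul, zero_mul, pow_zero, mul_one, pow_mul]
    gcongr
  | quad A C hA =>
    obtain ⟨M, hM0, hM⟩ := hμ.exists_integral_norm_pow_le (2 * q)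
    refine ⟨(C ^ 2) ^ q * M, by positivity, fun i => ?_⟩
    have i1 := IsGaussianFamily.integrable_norm_pow (μ := μ) i (2 * q)
    calc ∫ x, quadForm (A i) x ^ (2 * q) ∂(μ i)
        ≤ ∫ x, (C ^ 2) ^ q * (‖x‖ ^ 2) ^ (2 * q) ∂(μ i) := by
          refine integral_mono (integrable_pow (quad (ε := ε) A C hA) i (2 * q))
            (i1.const_mul _) fun x => ?_
          have h1 : |quadForm (A i) x| ≤ C * ‖x‖ ^ 2 :=
            (abs_quadForm_le _ _).trans (by gcongr; exact hA i)
          have h2 : quadForm (A i) x ^ 2 ≤ (C * ‖x‖ ^ 2) ^ 2 :=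
            sq_le_sq' (by linarith [neg_le_of_abs_le h1]) (le_of_abs_le h1)
          calc quadForm (A i) x ^ (2 * q) = (quadForm (A i) x ^ 2) ^ q := pow_mul _ _ _
            _ ≤ ((C * ‖x‖ ^ 2) ^ 2) ^ q := by gcongr
            _ = _ := by ring
      _ = (C ^ 2) ^ q * ∫ x, (‖x‖ ^ 2) ^ (2 * q) ∂(μ i) := integral_const_mul _ _
      _ ≤ (C ^ 2) ^ q * M := by gcongr; exact hM i
      _ = _ := by simp
  | comp A C hA k φ hφ =>
    obtain ⟨m, D, hD, hb⟩ := hφ.abs_le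
    obtain ⟨D₁, hD₁, h₁⟩ := hμ.exists_integral_centredQuadForm_pow_le A C hA (k * q)
    obtain ⟨D₂, hD₂, h₂⟩ := hμ.exists_integral_centredQuadForm_pow_le A C hA (k * q + m * q)
    refine ⟨D ^ (2 * q) * 2 ^ (2 * (m * q)) * (D₁ + D₂), by positivity, fun i => ?_⟩
    set F := centredQuadForm (μ i) (A i) with hFdef
    have hF : HasTemperateGrowth F := hasTemperateGrowth_centredQuadForm _ _
    have hi : ∀ n, Integrable (fun x => F x ^ n) (μ i) := fun n =>
      ((hasTemperateGrowth_pow_real n).comp hF).integrable _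
    have hpt : ∀ x, φ (F x) ^ (2 * q) ≤ D ^ (2 * q) * 2 ^ (2 * (m * q)) *
        (F x ^ (2 * (k * q)) + F x ^ (2 * (k * q + m * q))) := by
      intro x
      have h1 : (1 + |F x|) ^ (2 * (m * q)) ≤ 2 ^ (2 * (m * q)) * (1 + |F x| ^ (2 * (m * q))) := by
        have h0 := abs_nonneg (F x)
        have hp : 0 ≤ |F x| ^ (2 * (m * q)) := by positivity
        rcases le_total |F x| 1 with h | h
        · calc (1 + |F x|) ^ (2 * (m * q)) ≤ 2 ^ (2 * (m * q)) := by gcongr; linarith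
            _ ≤ _ := le_mul_of_one_le_right (by positivity) (by linarith)
        · calc (1 + |F x|) ^ (2 * (m * q)) ≤ (2 * |F x|) ^ (2 * (m * q)) := by gcongr; linarith
            _ = 2 ^ (2 * (m * q)) * |F x| ^ (2 * (m * q)) := mul_pow _ _ _
            _ ≤ _ := by gcongr; linarith
      have habs : ∀ n, |F x| ^ (2 * n) = F x ^ (2 * n) := fun n => by
        rw [pow_mul, sq_abs, ← pow_mul]
      calc φ (F x) ^ (2 * q) = |φ (F x)| ^ (2 * q) := by rw [pow_mul, ← sq_abs, ← pow_mul]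
        _ ≤ (D * |F x| ^ k * (1 + |F x|) ^ m) ^ (2 * q) := by gcongr; exact hb _
        _ = D ^ (2 * q) * |F x| ^ (2 * (k * q)) * (1 + |F x|) ^ (2 * (m * q)) := by
            rw [mul_pow, mul_pow, ← pow_mul, ← pow_mul]; ring_nf
        _ ≤ D ^ (2 * q) * |F x| ^ (2 * (k * q)) *
            (2 ^ (2 * (m * q)) * (1 + |F x| ^ (2 * (m * q)))) := by gcongr
        _ = _ := by rw [habs, habs]; ring
    have hle : ε i ^ (k * q + m * q) ≤ ε i ^ (k * q) :=
      pow_le_pow_of_le_one (hμ.pos i).le (hμ.le_one i) (by omega)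
    calc ∫ x, φ (F x) ^ (2 * q) ∂(μ i)
        ≤ ∫ x, D ^ (2 * q) * 2 ^ (2 * (m * q)) *
          (F x ^ (2 * (k * q)) + F x ^ (2 * (k * q + m * q))) ∂(μ i) :=
          integral_mono (integrable_pow (comp (ε := ε) A C hA k φ hφ) i (2 * q))
            (((hi _).add (hi _)).const_mul _) hpt
      _ = D ^ (2 * q) * 2 ^ (2 * (m * q)) * (∫ x, F x ^ (2 * (k * q)) ∂(μ i) +
          ∫ x, F x ^ (2 * (k * q + m * q)) ∂(μ i)) := by
          rw [integral_const_mul, integral_add (hi _) (hi _)]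
      _ ≤ D ^ (2 * q) * 2 ^ (2 * (m * q)) * (D₁ * ε i ^ (k * q) + D₂ * ε i ^ (k * q)) := by
          gcongr
          · exact h₁ i
          · exact (h₂ i).trans (by gcongr)
      _ = _ := by ring
  | scale k f hf ih =>
    obtain ⟨C, hC, h⟩ := ih q
    refine ⟨C, hC, fun i => ?_⟩
    have := (hμ.pos i).le
    simp only [mul_pow, integral_const_mul]
    calc _ ≤ ε i ^ (2 * q) * (C * ε i ^ (k * q)) := by gcongr; exact h i
      _ = _ := by rw [add_mul, pow_add]; ring
  | add k f g hf hg ihf ihg =>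
    obtain ⟨C, hC, h⟩ := ihf q
    obtain ⟨D, hD, h'⟩ := ihg q
    refine ⟨2 ^ q * (2 ^ (q - 1) * (C + D)), by positivity, fun i => ?_⟩
    have i1 := hf.integrable_pow i (2 * q)
    have i2 := hg.integrable_pow i (2 * q)
    calc ∫ x, (f i x + g i x) ^ (2 * q) ∂(μ i)
        ≤ ∫ x, 2 ^ q * (2 ^ (q - 1) * (f i x ^ (2 * q) + g i x ^ (2 * q))) ∂(μ i) := by
          refine integral_mono ((add k f g hf hg).integrable_pow i (2 * q))
            (((i1.add i2).const_mul _).const_mul _) fun x => ?_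
          calc (f i x + g i x) ^ (2 * q) = ((f i x + g i x) ^ 2) ^ q := pow_mul _ _ _
            _ ≤ (2 * (f i x ^ 2 + g i x ^ 2)) ^ q := by
                gcongr; nlinarith [sq_nonneg (f i x - g i x)]
            _ = 2 ^ q * (f i x ^ 2 + g i x ^ 2) ^ q := mul_pow _ _ _
            _ ≤ 2 ^ q * (2 ^ (q - 1) * ((f i x ^ 2) ^ q + (g i x ^ 2) ^ q)) := by
                gcongr; exact add_pow_le (sq_nonneg _) (sq_nonneg _) q
            _ = _ := by rw [← pow_mul, ← pow_mul]
      _ = 2 ^ q * (2 ^ (q - 1) * (∫ x, f i x ^ (2 * q) ∂(μ i) +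
          ∫ x, g i x ^ (2 * q) ∂(μ i))) := by
          rw [integral_const_mul, integral_const_mul, integral_add i1 i2]
      _ ≤ 2 ^ q * (2 ^ (q - 1) * (C * ε i ^ (k * q) + D * ε i ^ (k * q))) := by
          gcongr
          · exact h i
          · exact h' i
      _ = _ := by ring
  | mul j k f g hf hg ihf ihg =>
    obtain ⟨C, hC, h⟩ := ihf (2 * q)
    obtain ⟨D, hD, h'⟩ := ihg (2 * q)
    refine ⟨(C + D) / 2, by positivity, fun i => ?_⟩
    have i1 := hf.integrable_pow i (2 * (2 * q))
    have i2 := hg.integrable_pow i (2 * (2 * q))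
    have hε := hμ.pos i
    have hα : 0 < ε i ^ (j * q) := by positivity
    have hβ : 0 < ε i ^ (k * q) := by positivity
    set α := ε i ^ (j * q) with hαdef
    set β := ε i ^ (k * q) with hβdef
    have e1 : ε i ^ (j * (2 * q)) = α ^ 2 := by rw [hαdef, ← pow_mul]; ring_nf
    have e2 : ε i ^ (k * (2 * q)) = β ^ 2 := by rw [hβdef, ← pow_mul]; ring_nf
    have hf4 := h i
    have hg4 := h' i
    rw [e1] at hf4
    rw [e2] at hg4
    calc ∫ x, (f i x * g i x) ^ (2 * q) ∂(μ i)
        ≤ ∫ x, (β / (2 * α) * f i x ^ (2 * (2 * q)) + α / (2 * β) * g i x ^ (2 * (2 * q))) ∂(μ i) := by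
          refine integral_mono ((mul j k f g hf hg).integrable_pow i (2 * q))
            ((i1.const_mul _).add (i2.const_mul _)) fun x => ?_
          -- the weighted arithmetic-geometric mean inequality
          have e : β / (2 * α) * f i x ^ (2 * (2 * q)) + α / (2 * β) * g i x ^ (2 * (2 * q)) -
              (f i x * g i x) ^ (2 * q) =
              (β * f i x ^ (2 * q) - α * g i x ^ (2 * q)) ^ 2 / (2 * α * β) := by
            rw [mul_pow, mul_comm 2 (2 * q), pow_mul, pow_mul (g i x) (2 * q) 2]
            field_simp
            ring
          have : 0 ≤ (β * f i x ^ (2 * q) - α * g i x ^ (2 * q)) ^ 2 / (2 * α * β) := by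
            positivity
          linarith
      _ = β / (2 * α) * ∫ x, f i x ^ (2 * (2 * q)) ∂(μ i) +
          α / (2 * β) * ∫ x, g i x ^ (2 * (2 * q)) ∂(μ i) := by
          rw [integral_add (i1.const_mul _) (i2.const_mul _), integral_const_mul,
            integral_const_mul]
      _ ≤ β / (2 * α) * (C * α ^ 2) + α / (2 * β) * (D * β ^ 2) := by gcongr
      _ = (C + D) / 2 * (α * β) := by field_simp
      _ = _ := by rw [add_mul, pow_add]
  | weaken j k f hf hjk ih =>
    obtain ⟨C, hC, h⟩ := ih q
    refine ⟨C, hC, fun i => (h i).trans ?_⟩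
    have := pow_le_pow_of_le_one (hμ.pos i).le (hμ.le_one i) (Nat.mul_le_mul_right q hjk)
    gcongr

/-- A graded family of order `k` has `L^p`-norms `O(ε^{k/2})`. -/
theorem exists_eLpNorm_le (hμ : IsGaussianFamily μ ε S K) {k : ℕ}
    {f : ∀ i, EuclideanSpace ℝ (κ i) → ℝ} (hf : GradedFamily μ ε k f) (p : ℝ) :
    ∃ C, 0 ≤ C ∧ ∀ i, eLpNorm (f i) (ENNReal.ofReal p) (μ i) ≤
      ENNReal.ofReal (C * ε i ^ ((k : ℝ) / 2)) := by
  obtain ⟨q, hq⟩ := exists_nat_gt (max p 1)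
  have hp : p ≤ (2 * q : ℕ) := by
    push_cast; have := le_max_left p 1; linarith [le_max_right p 1]
  have hq0 : 0 < q := by
    have : (0 : ℝ) < q := lt_of_lt_of_le (by positivity) hq.le
    exact_mod_cast this
  obtain ⟨C, hC, h⟩ := hf.exists_integral_pow_le hμ q
  refine ⟨C ^ (1 / (2 * q : ℝ)), by positivity, fun i => ?_⟩
  have hfi := hf.hasTemperateGrowth i
  have hε := hμ.pos i
  have h1 : eLpNorm (f i) (ENNReal.ofReal p) (μ i) ≤ eLpNorm (f i) ((2 * q : ℕ) : ℝ≥0∞) (μ i) := by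
    refine eLpNorm_le_eLpNorm_of_exponent_le ?_ hfi.1.continuous.aestronglyMeasurable
    rw [← ENNReal.ofReal_natCast]
    exact ENNReal.ofReal_le_ofReal hp
  refine h1.trans ?_
  have hm := hfi.memLp (μ i) (p := ((2 * q : ℕ) : ℝ≥0∞)) (ENNReal.natCast_ne_top _)
  rw [hm.eLpNorm_eq_integral_rpow_norm (by simp; omega) (ENNReal.natCast_ne_top _)]
  refine ENNReal.ofReal_le_ofReal ?_
  have e : ∫ x, ‖f i x‖ ^ ((2 * q : ℕ) : ℝ≥0∞).toReal ∂(μ i) = ∫ x, f i x ^ (2 * q) ∂(μ i) := by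
    congr 1; funext x
    rw [ENNReal.toReal_natCast, Real.rpow_natCast, Real.norm_eq_abs, pow_mul, sq_abs, ← pow_mul]
  rw [e, ENNReal.toReal_natCast]
  have hnn : 0 ≤ ∫ x, f i x ^ (2 * q) ∂(μ i) :=
    integral_nonneg fun x => by simp only [pow_mul]; positivity
  calc (∫ x, f i x ^ (2 * q) ∂(μ i)) ^ (((2 * q : ℕ) : ℝ)⁻¹)
      ≤ (C * ε i ^ (k * q)) ^ (((2 * q : ℕ) : ℝ)⁻¹) := by gcongr; exact h i
    _ = _ := by
        have hq' : (q : ℝ) ≠ 0 := by positivity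
        rw [Real.mul_rpow hC (by positivity), ← Real.rpow_natCast, ← Real.rpow_mul hε.le]
        push_cast
        congr 2
        · rw [one_div]
        · field_simp

end GradedFamily

end Moments

/-! ### Covariances of the second differences -/

section PowerDifferences

lemma fwdDiff_iter_succ_apply (m : ℕ) (f : ℝ → ℝ) (x : ℝ) :
    (fwdDiff (1 : ℝ))^[m + 1] f x = (fwdDiff (1 : ℝ))^[m] f (x + 1) - (fwdDiff (1 : ℝ))^[m] f x := by
  rw [Function.iterate_succ_apply']; rfl

lemma hasDerivAt_fwdDiff_iter_rpow (a : ℝ) (m : ℕ) {x : ℝ} (hx : 0 < x) :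
    HasDerivAt ((fwdDiff (1 : ℝ))^[m] fun y : ℝ => y ^ a)
      (a * (fwdDiff (1 : ℝ))^[m] (fun y : ℝ => y ^ (a - 1)) x) x := by
  induction m generalizing x with
  | zero => simpa using Real.hasDerivAt_rpow_const (p := a) (Or.inl hx.ne')
  | succ m ih =>
    have h1 := (ih (x := x + 1) (by linarith)).comp_add_const x 1
    have h2 := h1.sub (ih hx)
    rw [fwdDiff_iter_succ_apply, mul_sub]
    refine h2.congr_of_eventuallyEq (Eventually.of_forall fun y => ?_)
    exact fwdDiff_iter_succ_apply m _ y

/-- The `m`-th difference of `x ^ a` is of the size of the `m`-th derivative, by the mean value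
theorem and induction on `m`. -/
lemma exists_abs_fwdDiff_iter_rpow_le (m : ℕ) (a : ℝ) (ha : a ≤ m) :
    ∃ C, 0 ≤ C ∧ ∀ x : ℝ, 0 < x →
      |(fwdDiff (1 : ℝ))^[m] (fun y : ℝ => y ^ a) x| ≤ C * x ^ (a - m) := by
  induction m generalizing a with
  | zero =>
    refine ⟨1, zero_le_one, fun x hx => ?_⟩
    simp [abs_of_nonneg (Real.rpow_nonneg hx.le a)]
  | succ m ih =>
    push_cast at ha
    obtain ⟨C, hC, h⟩ := ih (a - 1) (by linarith)
    refine ⟨|a| * C, by positivity, fun x hx => ?_⟩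
    have hb : ∀ y ∈ Set.Ici x, ‖a * (fwdDiff (1 : ℝ))^[m] (fun y : ℝ => y ^ (a - 1)) y‖ ≤
        |a| * C * x ^ (a - (m + 1 : ℕ)) := by
      intro y hy
      have hy0 : 0 < y := hx.trans_le hy
      rw [norm_mul, Real.norm_eq_abs, mul_assoc]
      refine mul_le_mul_of_nonneg_left ((h y hy0).trans
        (mul_le_mul_of_nonneg_left ?_ hC)) (abs_nonneg _)
      have e : a - 1 - m = a - (m + 1 : ℕ) := by push_cast; ring
      rw [e]
      exact Real.rpow_le_rpow_of_nonpos hx hy (by push_cast; linarith)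
    have := (convex_Ici x).norm_image_sub_le_of_norm_hasDerivWithin_le
      (f := (fwdDiff (1 : ℝ))^[m] fun y : ℝ => y ^ a)
      (fun y hy => (hasDerivAt_fwdDiff_iter_rpow a m (hx.trans_le hy)).hasDerivWithinAt) hb
      (x := x) (y := x + 1) Set.self_mem_Ici (Set.mem_Ici.2 (by linarith))
    rw [fwdDiff_iter_succ_apply, ← Real.norm_eq_abs]
    simpa using this

/-- The covariances of the second differences of a fractional Brownian motion at integer times. -/
noncomputable def secondDiffCov (H : ℝ) (k : ℤ) : ℝ :=
  -(|(k : ℝ) - 2| ^ (2 * H) - 4 * |(k : ℝ) - 1| ^ (2 * H) + 6 * |(k : ℝ)| ^ (2 * H)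
    - 4 * |(k : ℝ) + 1| ^ (2 * H) + |(k : ℝ) + 2| ^ (2 * H)) / 2

lemma secondDiffCov_neg (H : ℝ) (k : ℤ) : secondDiffCov H (-k) = secondDiffCov H k := by
  have h1 : |(-k : ℝ) - 2| = |(k : ℝ) + 2| := by rw [← abs_neg]; ring_nf
  have h2 : |(-k : ℝ) - 1| = |(k : ℝ) + 1| := by rw [← abs_neg]; ring_nf
  have h3 : |(-k : ℝ) + 2| = |(k : ℝ) - 2| := by rw [← abs_neg]; ring_nf
  have h4 : |(-k : ℝ) + 1| = |(k : ℝ) - 1| := by rw [← abs_neg]; ring_nf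
  simp only [secondDiffCov, Int.cast_neg, h1, h2, h3, h4, abs_neg]
  ring

lemma secondDiffCov_zero {H : ℝ} (hH : 0 < H) : secondDiffCov H 0 = 4 - 2 ^ (2 * H) := by
  have : (0 : ℝ) ^ (2 * H) = 0 := Real.zero_rpow (by linarith)
  simp [secondDiffCov, this]
  ring

lemma secondDiffCov_zero_pos {H : ℝ} (hH : H ∈ Set.Ioo (0 : ℝ) 1) : 0 < secondDiffCov H 0 := by
  rw [secondDiffCov_zero hH.1]
  have : (2 : ℝ) ^ (2 * H) < 2 ^ (2 : ℝ) :=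
    Real.rpow_lt_rpow_of_exponent_lt one_lt_two (by linarith [hH.2])
  norm_num at this
  linarith

lemma secondDiffCov_natCast_add_three (H : ℝ) (k : ℕ) :
    secondDiffCov H ((k : ℤ) + 3) =
      -((fwdDiff (1 : ℝ))^[4] (fun y : ℝ => y ^ (2 * H)) ((k : ℝ) + 1)) / 2 := by
  simp only [fwdDiff_iter_succ_apply, Function.iterate_zero, id, secondDiffCov]
  have hk : (0 : ℝ) ≤ k := k.cast_nonneg
  push_cast
  rw [abs_of_nonneg (by linarith), abs_of_nonneg (by linarith), abs_of_nonneg (by linarith),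
    abs_of_nonneg (by linarith), abs_of_nonneg (by linarith)]
  ring_nf

/-- The covariances decay as fourth differences of `k ^ (2H)`, that is, faster than `k⁻²`. -/
lemma summable_abs_secondDiffCov {H : ℝ} (hH : H < 1) :
    Summable fun k : ℤ => |secondDiffCov H k| := by
  have hnat : Summable fun k : ℕ => |secondDiffCov H (k : ℤ)| := by
    rw [← summable_nat_add_iff 3]
    obtain ⟨C, hC, h⟩ := exists_abs_fwdDiff_iter_rpow_le 4 (2 * H) (by push_cast; linarith)
    have hs : Summable fun k : ℕ => C * (1 / ((k + 1 : ℕ) : ℝ) ^ 2) :=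
      ((summable_nat_add_iff 1).2 (Real.summable_one_div_nat_pow.2 one_lt_two)).mul_left C
    refine Summable.of_nonneg_of_le (fun _ => abs_nonneg _) (fun k => ?_) hs
    have hk : (0 : ℝ) ≤ k := k.cast_nonneg
    have h1 := h (k + 1) (by linarith)
    have h2 : ((k : ℝ) + 1) ^ (2 * H - (4 : ℕ)) ≤ ((k : ℝ) + 1) ^ (-2 : ℝ) :=
      Real.rpow_le_rpow_of_exponent_le (by linarith) (by push_cast; linarith)
    have h3 : ((k : ℝ) + 1) ^ (-2 : ℝ) = 1 / ((k + 1 : ℕ) : ℝ) ^ 2 := by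
      rw [Real.rpow_neg (by linarith)]; norm_num
    rw [h3] at h2
    rw [show ((k + 3 : ℕ) : ℤ) = (k : ℤ) + 3 by push_cast; rfl, secondDiffCov_natCast_add_three,
      abs_div, abs_neg, abs_two]
    have h4 := mul_le_mul_of_nonneg_left h2 hC
    exact (half_le_self (abs_nonneg _)).trans (h1.trans h4)
  refine Summable.of_nat_of_neg hnat ?_
  simpa only [secondDiffCov_neg] using hnat

/-- Schur's test: the covariance matrices of the second differences at integer times are bounded
operators on `ℓ²`, by the summability of the covariances. -/
lemma sum_mul_sum_secondDiffCov_le {H : ℝ} (hH : H < 1) (s : Finset ℕ) (v : ℕ → ℝ) :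
    ∑ i ∈ s, ∑ j ∈ s, v i * v j * secondDiffCov H ((i : ℤ) - j) ≤
      (∑' k : ℤ, |secondDiffCov H k|) * ∑ i ∈ s, v i ^ 2 := by
  have hrow : ∀ i : ℕ, ∑ j ∈ s, |secondDiffCov H ((i : ℤ) - j)| ≤ ∑' k : ℤ, |secondDiffCov H k| := by
    intro i
    have hinj : Set.InjOn (fun j : ℕ => (i : ℤ) - j) s := fun a _ b _ h => by
      simpa using h
    rw [← Finset.sum_image (f := fun k => |secondDiffCov H k|) hinj]
    exact (summable_abs_secondDiffCov hH).sum_le_tsum _ fun _ _ => abs_nonneg _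
  have hterm : ∀ i j : ℕ, v i * v j * secondDiffCov H ((i : ℤ) - j) ≤
      (v i ^ 2 * |secondDiffCov H ((i : ℤ) - j)| + v j ^ 2 * |secondDiffCov H ((j : ℤ) - i)|) / 2 := by
    intro i j
    rw [← secondDiffCov_neg H ((j : ℤ) - i), neg_sub]
    have h1 := le_abs_self (v i * v j * secondDiffCov H ((i : ℤ) - j))
    rw [abs_mul] at h1
    have h2 : |v i * v j| ≤ (v i ^ 2 + v j ^ 2) / 2 := by
      rw [abs_le]; constructor <;> nlinarith [sq_nonneg (v i + v j), sq_nonneg (v i - v j)]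
    have h3 := mul_le_mul_of_nonneg_right h2 (abs_nonneg (secondDiffCov H ((i : ℤ) - j)))
    linarith
  calc _ ≤ ∑ i ∈ s, ∑ j ∈ s, (v i ^ 2 * |secondDiffCov H ((i : ℤ) - j)| +
        v j ^ 2 * |secondDiffCov H ((j : ℤ) - i)|) / 2 :=
        Finset.sum_le_sum fun i _ => Finset.sum_le_sum fun j _ => hterm i j
    _ = (∑ i ∈ s, ∑ j ∈ s, v i ^ 2 * |secondDiffCov H ((i : ℤ) - j)| +
        ∑ i ∈ s, ∑ j ∈ s, v j ^ 2 * |secondDiffCov H ((j : ℤ) - i)|) / 2 := by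
        simp only [← Finset.sum_div, Finset.sum_add_distrib]
    _ = ∑ i ∈ s, v i ^ 2 * ∑ j ∈ s, |secondDiffCov H ((i : ℤ) - j)| := by
        rw [Finset.sum_comm (s := s) (t := s)
          (f := fun i j : ℕ => v j ^ 2 * |secondDiffCov H ((j : ℤ) - i)|)]
        simp only [Finset.mul_sum]
        ring
    _ ≤ ∑ i ∈ s, v i ^ 2 * ∑' k : ℤ, |secondDiffCov H k| :=
        Finset.sum_le_sum fun i _ => mul_le_mul_of_nonneg_left (hrow i) (sq_nonneg _)
    _ = _ := by rw [← Finset.sum_mul, mul_comm]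

end PowerDifferences

section SecondDifferences

set_option linter.unusedSectionVars false

variable {Ω : Type*} [MeasurableSpace Ω] {P : Measure Ω} {H T : ℝ} {B : ℝ → Ω → ℝ}

lemma gridPoint_mem_Icc (hT : 0 ≤ T) {n j : ℕ} (hj : j ≤ n) :
    (j : ℝ) * T / n ∈ Set.Icc 0 T := by
  rcases Nat.eq_zero_or_pos n with rfl | hn
  · simp [hT]
  have hn' : (0 : ℝ) < n := by exact_mod_cast hn
  refine ⟨by positivity, ?_⟩
  rw [div_le_iff₀ hn', mul_comm]
  exact mul_le_mul_of_nonneg_left (by exact_mod_cast hj) hT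

/-- A second difference as a linear combination of values on the grid. -/
lemma secondDiff_succ_eq_sum (T : ℝ) (B : ℝ → Ω → ℝ) (n j : ℕ) :
    secondDiff T B n (j + 1) = fun ω => ∑ a : Fin 3, (![1, -2, 1] : Fin 3 → ℝ) a *
      B (((j + a : ℕ) : ℝ) * T / n) ω := by
  funext ω
  simp only [secondDiff, Fin.sum_univ_three]
  simp
  ring_nf

lemma secondDiff_mem_span (hT : 0 ≤ T) {n j : ℕ} (hj : j ∈ Finset.Ico 1 n) :
    secondDiff T B n j ∈ Submodule.span ℝ (B '' Set.Icc 0 T) := by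
  rw [Finset.mem_Ico] at hj
  obtain ⟨j, rfl⟩ := Nat.exists_eq_add_of_le' hj.1
  have : secondDiff T B n (j + 1) = ∑ a : Fin 3, (![1, -2, 1] : Fin 3 → ℝ) a •
      B (((j + a : ℕ) : ℝ) * T / n) := by
    rw [secondDiff_succ_eq_sum]; funext ω; simp
  rw [this]
  refine Submodule.sum_mem _ fun a _ => Submodule.smul_mem _ _ (Submodule.subset_span ⟨_, ?_, rfl⟩)
  exact gridPoint_mem_Icc hT (by omega)

lemma integral_secondDiff_mul [IsProbabilityMeasure P] (hT : 0 < T)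
    (hB : IsFractionalBrownianMotion P H T B) {n i j : ℕ} (hi : i ∈ Finset.Ico 1 n)
    (hj : j ∈ Finset.Ico 1 n) :
    ∫ ω, secondDiff T B n i ω * secondDiff T B n j ω ∂P =
      (T / n) ^ (2 * H) * secondDiffCov H ((i : ℤ) - j) := by
  rw [Finset.mem_Ico] at hi hj
  obtain ⟨i, rfl⟩ := Nat.exists_eq_add_of_le' hi.1
  obtain ⟨j, rfl⟩ := Nat.exists_eq_add_of_le' hj.1
  have hn : (0 : ℝ) < n := by
    have : 0 < n := by omega
    exact_mod_cast this
  have hmem : ∀ k : ℕ, k ≤ n → MemLp (B ((k : ℝ) * T / n)) 2 P := fun k hk =>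
    (hasGaussianLaw_of_mem_span hB (Submodule.subset_span
      ⟨_, gridPoint_mem_Icc hT.le hk, rfl⟩)).memLp_two
  have hcov : ∀ a b : Fin 3, ∫ ω, B (((i + a : ℕ) : ℝ) * T / n) ω *
      B (((j + b : ℕ) : ℝ) * T / n) ω ∂P = ((((i + a : ℕ) : ℝ) * T / n) ^ (2 * H) +
        (((j + b : ℕ) : ℝ) * T / n) ^ (2 * H) -
        (T / n) ^ (2 * H) * |((i + a : ℕ) : ℝ) - (j + b : ℕ)| ^ (2 * H)) / 2 := by
    intro a b
    rw [hB.cov_eq _ (gridPoint_mem_Icc hT.le (by omega)) _ (gridPoint_mem_Icc hT.le (by omega)),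
      ← Real.mul_rpow (by positivity) (abs_nonneg _)]
    congr 3
    have h0 : |T / n| = T / n := abs_of_nonneg (by positivity)
    conv_rhs => rw [← h0, ← abs_mul]
    congr 1; ring
  have hint : ∀ a b : Fin 3, Integrable (fun ω => B (((i + a : ℕ) : ℝ) * T / n) ω *
      B (((j + b : ℕ) : ℝ) * T / n) ω) P := fun a b =>
    (hmem _ (by omega)).integrable_mul (hmem _ (by omega))
  have hexp : ∀ ω, secondDiff T B n (i + 1) ω * secondDiff T B n (j + 1) ω =
      ∑ a : Fin 3, ∑ b : Fin 3, (![1, -2, 1] : Fin 3 → ℝ) a * (![1, -2, 1] : Fin 3 → ℝ) b *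
        (B (((i + a : ℕ) : ℝ) * T / n) ω * B (((j + b : ℕ) : ℝ) * T / n) ω) := by
    intro ω
    rw [secondDiff_succ_eq_sum, secondDiff_succ_eq_sum]
    simp only [Finset.sum_mul_sum]
    exact Finset.sum_congr rfl fun a _ => Finset.sum_congr rfl fun b _ => by ring
  simp only [hexp]
  rw [integral_finsetSum _ fun a _ => integrable_finsetSum _ fun b _ => (hint a b).const_mul _,
    Finset.sum_congr rfl fun a _ => integral_finsetSum _ fun b _ => (hint a b).const_mul _]
  simp only [integral_const_mul, hcov, Fin.sum_univ_three, secondDiffCov]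
  simp
  have e1 : (i : ℝ) + 1 - j = i - j + 1 := by ring
  have e2 : (i : ℝ) + 2 - j = i - j + 2 := by ring
  have e3 : (i : ℝ) - (j + 1) = i - j - 1 := by ring
  have e4 : (i : ℝ) - (j + 2) = i - j - 2 := by ring
  have e5 : (i : ℝ) + 1 - (j + 2) = i - j - 1 := by ring
  have e6 : (i : ℝ) + 2 - (j + 1) = i - j + 1 := by ring
  simp only [e1, e2, e3, e4, e5, e6]
  ring

lemma memLp_secondDiff [IsProbabilityMeasure P] (hT : 0 < T)
    (hB : IsFractionalBrownianMotion P H T B) {n j : ℕ} (hj : j ∈ Finset.Ico 1 n) :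
    MemLp (secondDiff T B n j) 2 P :=
  (hasGaussianLaw_of_mem_span hB (secondDiff_mem_span hT.le hj)).memLp_two

lemma integral_quadVar [IsProbabilityMeasure P] (hT : 0 < T)
    (hB : IsFractionalBrownianMotion P H T B) (n : ℕ) :
    ∫ ω, quadVar T B n ω ∂P = ((n - 1 : ℕ) : ℝ) * ((T / n) ^ (2 * H) * secondDiffCov H 0) := by
  unfold quadVar
  rw [integral_finsetSum _ fun j hj => (memLp_secondDiff hT hB hj).integrable_sq,
    Finset.sum_congr rfl fun j hj => show _ = (T / n) ^ (2 * H) * secondDiffCov H 0 by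
      have := integral_secondDiff_mul hT hB hj hj
      rw [sub_self] at this
      simpa only [pow_two] using this]
  simp

lemma integral_sq_sum_secondDiff_le [IsProbabilityMeasure P] (hT : 0 < T) (hH : H < 1)
    (hB : IsFractionalBrownianMotion P H T B) (n : ℕ) (v : ℕ → ℝ) :
    ∫ ω, (∑ j ∈ Finset.Ico 1 n, v j * secondDiff T B n j ω) ^ 2 ∂P ≤
      (T / n) ^ (2 * H) * (∑' k : ℤ, |secondDiffCov H k|) * ∑ j ∈ Finset.Ico 1 n, v j ^ 2 := by
  have hexp : ∀ ω, (∑ j ∈ Finset.Ico 1 n, v j * secondDiff T B n j ω) ^ 2 =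
      ∑ i ∈ Finset.Ico 1 n, ∑ j ∈ Finset.Ico 1 n, v i * v j *
        (secondDiff T B n i ω * secondDiff T B n j ω) := fun ω => by
    rw [pow_two, Finset.sum_mul_sum]
    exact Finset.sum_congr rfl fun a _ => Finset.sum_congr rfl fun b _ => by ring
  have hint : ∀ i ∈ Finset.Ico 1 n, ∀ j ∈ Finset.Ico 1 n, Integrable (fun ω => v i * v j *
      (secondDiff T B n i ω * secondDiff T B n j ω)) P := fun i hi j hj =>
    ((memLp_secondDiff hT hB hi).integrable_mul (memLp_secondDiff hT hB hj)).const_mul _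
  simp only [hexp]
  rw [integral_finsetSum _ fun i hi => integrable_finsetSum _ fun j hj => hint i hi j hj]
  calc _ = ∑ i ∈ Finset.Ico 1 n, ∑ j ∈ Finset.Ico 1 n, (T / n) ^ (2 * H) *
        (v i * v j * secondDiffCov H ((i : ℤ) - j)) := by
        refine Finset.sum_congr rfl fun i hi => ?_
        rw [integral_finsetSum _ fun j hj => hint i hi j hj]
        refine Finset.sum_congr rfl fun j hj => ?_
        rw [integral_const_mul, integral_secondDiff_mul hT hB hi hj]; ring
    _ = (T / n) ^ (2 * H) * ∑ i ∈ Finset.Ico 1 n, ∑ j ∈ Finset.Ico 1 n,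
        v i * v j * secondDiffCov H ((i : ℤ) - j) := by simp only [← Finset.mul_sum]
    _ ≤ _ := by
        rw [mul_assoc]
        refine mul_le_mul_of_nonneg_left (sum_mul_sum_secondDiffCov_le hH _ v) ?_
        have : (0 : ℝ) ≤ n := n.cast_nonneg
        positivity

end SecondDifferences

/-! ### The Gaussian vectors of normalized second differences -/

section CoordinateProjection

open scoped InnerProductSpace

variable {ι : Type*} [Fintype ι]

/-- The orthogonal projection onto the coordinates in `s`. -/
noncomputable def coordProj (s : Set ι) : EuclideanSpace ℝ ι →L[ℝ] EuclideanSpace ℝ ι :=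
  LinearMap.mkContinuous
    { toFun := fun x => WithLp.toLp 2 (s.indicator x)
      map_add' := fun x y => by ext k; by_cases hk : k ∈ s <;> simp [hk]
      map_smul' := fun c x => by ext k; by_cases hk : k ∈ s <;> simp [hk] } 1 fun x => by
    rw [one_mul, EuclideanSpace.norm_eq, EuclideanSpace.norm_eq]
    refine Real.sqrt_le_sqrt (Finset.sum_le_sum fun k _ => ?_)
    by_cases hk : k ∈ s <;> simp [hk, sq_nonneg]

lemma norm_coordProj_le (s : Set ι) : ‖coordProj s‖ ≤ 1 :=
  LinearMap.mkContinuous_norm_le _ zero_le_one _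

lemma quadForm_coordProj (s : Set ι) (x : EuclideanSpace ℝ ι) :
    quadForm (coordProj s) x = ∑ k, s.indicator (fun k => x k ^ 2) k := by
  simp only [quadForm, coordProj, PiLp.inner_apply]
  refine Finset.sum_congr rfl fun k _ => ?_
  by_cases hk : k ∈ s <;> simp [hk, pow_two]

end CoordinateProjection

section CovarianceOperator

open scoped InnerProductSpace

lemma norm_smul_covarianceOperator_le {E : Type*} [NormedAddCommGroup E] [InnerProductSpace ℝ E]
    [CompleteSpace E] [MeasurableSpace E] [BorelSpace E] [SecondCountableTopology E]
    (μ : Measure E) [IsGaussian μ] {ε K : ℝ} (hε : 0 < ε) (hK : 0 < K)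
    (h : ∀ v, ∫ y, ⟪v, y⟫_ℝ ^ 2 ∂μ ≤ ε * K * ‖v‖ ^ 2) :
    ‖ε⁻¹ • covarianceOperator μ‖ ≤ K := by
  have h2 : MemLp id 2 μ := IsGaussian.memLp_two_id
  have hL : ∀ v, MemLp (fun y => ⟪v, y⟫_ℝ) 2 μ := fun v => h2.const_inner v
  refine ContinuousLinearMap.opNorm_le_bound _ hK.le fun u => ?_
  set w := (ε⁻¹ • covarianceOperator μ) u
  have h3 : ‖w‖ ^ 2 = ε⁻¹ * ∫ y, ⟪u, y⟫_ℝ * ⟪w, y⟫_ℝ ∂μ := by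
    have h4 : ⟪w, w⟫_ℝ = ⟪(ε⁻¹ • covarianceOperator μ) u, w⟫_ℝ := rfl
    rw [← covarianceOperator_inner h2, ← real_inner_self_eq_norm_sq, h4, smul_apply,
      real_inner_smul_left]
  -- the arithmetic-geometric mean inequality with weight `K` replaces Cauchy–Schwarz
  have h4 : ∫ y, ⟪u, y⟫_ℝ * ⟪w, y⟫_ℝ ∂μ ≤
      K / 2 * ∫ y, ⟪u, y⟫_ℝ ^ 2 ∂μ + (2 * K)⁻¹ * ∫ y, ⟪w, y⟫_ℝ ^ 2 ∂μ := by
    rw [← integral_const_mul, ← integral_const_mul,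
      ← integral_add ((hL u).integrable_sq.const_mul _) ((hL w).integrable_sq.const_mul _)]
    refine integral_mono ((hL u).integrable_mul (hL w))
      (((hL u).integrable_sq.const_mul _).add ((hL w).integrable_sq.const_mul _)) fun y => ?_
    have h5 : 0 ≤ (2 * K)⁻¹ * (K * ⟪u, y⟫_ℝ - ⟪w, y⟫_ℝ) ^ 2 := by positivity
    have h6 : (2 * K)⁻¹ * (K * ⟪u, y⟫_ℝ - ⟪w, y⟫_ℝ) ^ 2 = K / 2 * ⟪u, y⟫_ℝ ^ 2 +
        (2 * K)⁻¹ * ⟪w, y⟫_ℝ ^ 2 - ⟪u, y⟫_ℝ * ⟪w, y⟫_ℝ := by field_simp; ring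
    change ⟪u, y⟫_ℝ * ⟪w, y⟫_ℝ ≤ K / 2 * ⟪u, y⟫_ℝ ^ 2 + (2 * K)⁻¹ * ⟪w, y⟫_ℝ ^ 2
    linarith
  have h5 : ‖w‖ ^ 2 ≤ (K * ‖u‖) ^ 2 / 2 + ‖w‖ ^ 2 / 2 := by
    calc ‖w‖ ^ 2 ≤ ε⁻¹ * (K / 2 * (ε * K * ‖u‖ ^ 2) + (2 * K)⁻¹ * (ε * K * ‖w‖ ^ 2)) := by
          refine h3.trans_le (mul_le_mul_of_nonneg_left (h4.trans ?_) (by positivity))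
          gcongr
          · exact h u
          · exact h w
      _ = _ := by field_simp
  exact le_of_sq_le_sq (by linarith) (by positivity)

end CovarianceOperator

section DiffVector

set_option linter.unusedSectionVars false

open scoped InnerProductSpace

variable {Ω : Type*} [MeasurableSpace Ω] {P : Measure Ω} [IsProbabilityMeasure P]
  {H T : ℝ} {B : ℝ → Ω → ℝ}

/-- The second differences on the grids with `n` and with `2n` steps, divided by the square roots of
the expected quadratic variations. The squared norms of the two blocks are `V_n / E[V_n]` and
`V_{2n} / E[V_{2n}]`. -/
noncomputable def diffVector (P : Measure Ω) (T : ℝ) (B : ℝ → Ω → ℝ) (n : ℕ) :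
    Finset.Ico 1 n ⊕ Finset.Ico 1 (2 * n) → Ω → ℝ :=
  Sum.elim (fun j => (√(∫ ω, quadVar T B n ω ∂P))⁻¹ • secondDiff T B n j)
    (fun j => (√(∫ ω, quadVar T B (2 * n) ω ∂P))⁻¹ • secondDiff T B (2 * n) j)

lemma diffVector_mem_span (hT : 0 ≤ T) (n : ℕ) (k : Finset.Ico 1 n ⊕ Finset.Ico 1 (2 * n)) :
    diffVector P T B n k ∈ Submodule.span ℝ (B '' Set.Icc 0 T) := by
  rcases k with k | k
  · exact Submodule.smul_mem _ _ (secondDiff_mem_span hT k.2)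
  · exact Submodule.smul_mem _ _ (secondDiff_mem_span hT k.2)

lemma measurable_diffVector (hT : 0 ≤ T) (hB : IsFractionalBrownianMotion P H T B) (n : ℕ) :
    Measurable (randomVector (diffVector P T B n)) :=
  measurable_randomVector fun k =>
    (measurable_sigmaB_of_mem_span (diffVector_mem_span hT n k)).mono (sigmaB_le hB) le_rfl

lemma integral_quadVar_pos (hH : H ∈ Set.Ioo (0 : ℝ) 1) (hT : 0 < T)
    (hB : IsFractionalBrownianMotion P H T B) {n : ℕ} (hn : 2 ≤ n) :
    0 < ∫ ω, quadVar T B n ω ∂P := by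
  rw [integral_quadVar hT hB]
  have h1 := secondDiffCov_zero_pos hH
  have h2 : (0 : ℝ) < n := by exact_mod_cast (by omega : 0 < n)
  have h3 : (0 : ℝ) < (n - 1 : ℕ) := by exact_mod_cast (by omega : 0 < n - 1)
  positivity

lemma quadForm_coordProj_inl (hH : H ∈ Set.Ioo (0 : ℝ) 1) (hT : 0 < T)
    (hB : IsFractionalBrownianMotion P H T B) {n : ℕ} (hn : 2 ≤ n) (ω : Ω) :
    quadForm (coordProj (Set.range Sum.inl)) (randomVector (diffVector P T B n) ω) =
      quadVar T B n ω / ∫ ω, quadVar T B n ω ∂P := by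
  have h := (integral_quadVar_pos hH hT hB hn).le
  have e : quadVar T B n ω = ∑ j : Finset.Ico 1 n, secondDiff T B n j ω ^ 2 :=
    (Finset.sum_coe_sort (Finset.Ico 1 n) fun j => secondDiff T B n j ω ^ 2).symm
  rw [quadForm_coordProj, Fintype.sum_sum_type, e, Finset.sum_div]
  simp [randomVector, diffVector, mul_pow, Real.sq_sqrt h, div_eq_inv_mul]

lemma quadForm_coordProj_inr (hH : H ∈ Set.Ioo (0 : ℝ) 1) (hT : 0 < T)
    (hB : IsFractionalBrownianMotion P H T B) {n : ℕ} (hn : 2 ≤ n) (ω : Ω) :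
    quadForm (coordProj (Set.range Sum.inr)) (randomVector (diffVector P T B n) ω) =
      quadVar T B (2 * n) ω / ∫ ω, quadVar T B (2 * n) ω ∂P := by
  have h := (integral_quadVar_pos hH hT hB (n := 2 * n) (by omega)).le
  have e : quadVar T B (2 * n) ω = ∑ j : Finset.Ico 1 (2 * n), secondDiff T B (2 * n) j ω ^ 2 :=
    (Finset.sum_coe_sort (Finset.Ico 1 (2 * n)) fun j => secondDiff T B (2 * n) j ω ^ 2).symm
  rw [quadForm_coordProj, Fintype.sum_sum_type, e, Finset.sum_div]
  simp [randomVector, diffVector, mul_pow, Real.sq_sqrt h, div_eq_inv_mul]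

lemma centredQuadForm_coordProj_inl (hH : H ∈ Set.Ioo (0 : ℝ) 1) (hT : 0 < T)
    (hB : IsFractionalBrownianMotion P H T B) {n : ℕ} (hn : 2 ≤ n) (ω : Ω) :
    centredQuadForm (P.map (randomVector (diffVector P T B n))) (coordProj (Set.range Sum.inl))
      (randomVector (diffVector P T B n) ω) = normQuadVar P T B n ω := by
  have h := (integral_quadVar_pos hH hT hB hn).ne'
  rw [centredQuadForm, integral_map (measurable_diffVector hT.le hB n).aemeasurable
    (hasTemperateGrowth_quadForm _).1.continuous.aestronglyMeasurable]
  simp only [quadForm_coordProj_inl hH hT hB hn, integral_div, div_self h, normQuadVar]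

lemma centredQuadForm_coordProj_inr (hH : H ∈ Set.Ioo (0 : ℝ) 1) (hT : 0 < T)
    (hB : IsFractionalBrownianMotion P H T B) {n : ℕ} (hn : 2 ≤ n) (ω : Ω) :
    centredQuadForm (P.map (randomVector (diffVector P T B n))) (coordProj (Set.range Sum.inr))
      (randomVector (diffVector P T B n) ω) = normQuadVar P T B (2 * n) ω := by
  have h := (integral_quadVar_pos hH hT hB (n := 2 * n) (by omega)).ne'
  rw [centredQuadForm, integral_map (measurable_diffVector hT.le hB n).aemeasurable
    (hasTemperateGrowth_quadForm _).1.continuous.aestronglyMeasurable]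
  simp only [quadForm_coordProj_inr hH hT hB hn, integral_div, div_self h, normQuadVar]

lemma integral_sq_sum_normalized_le (hH : H ∈ Set.Ioo (0 : ℝ) 1) (hT : 0 < T)
    (hB : IsFractionalBrownianMotion P H T B) {n : ℕ} (hn : 2 ≤ n) (v : ℕ → ℝ) :
    ∫ ω, (∑ j ∈ Finset.Ico 1 n, v j * ((√(∫ ω, quadVar T B n ω ∂P))⁻¹ *
        secondDiff T B n j ω)) ^ 2 ∂P ≤
      (n : ℝ)⁻¹ * (2 * (∑' k : ℤ, |secondDiffCov H k|) / secondDiffCov H 0) *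
        ∑ j ∈ Finset.Ico 1 n, v j ^ 2 := by
  have hE := integral_quadVar_pos hH hT hB hn
  have h0 := secondDiffCov_zero_pos hH
  have hn0 : (0 : ℝ) < n := by exact_mod_cast (by omega : 0 < n)
  have hn1 : (n : ℝ) ≤ 2 * (n - 1 : ℕ) := by exact_mod_cast (by omega : n ≤ 2 * (n - 1))
  have h1 := integral_sq_sum_secondDiff_le hT hH.2 hB n v
  have e : ∀ ω, (∑ j ∈ Finset.Ico 1 n, v j * ((√(∫ ω, quadVar T B n ω ∂P))⁻¹ *
        secondDiff T B n j ω)) ^ 2 = (∫ ω, quadVar T B n ω ∂P)⁻¹ *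
        (∑ j ∈ Finset.Ico 1 n, v j * secondDiff T B n j ω) ^ 2 := fun ω => by
    simp only [mul_left_comm (v _), ← Finset.mul_sum, mul_pow, inv_pow, Real.sq_sqrt hE.le]
  simp only [e, integral_const_mul]
  set ρ := ∑' k : ℤ, |secondDiffCov H k|
  have hρ : 0 ≤ ρ := tsum_nonneg fun _ => abs_nonneg _
  set σ := ∑ j ∈ Finset.Ico 1 n, v j ^ 2
  have hσ : 0 ≤ σ := Finset.sum_nonneg fun _ _ => sq_nonneg _
  have hδ : 0 < (T / n) ^ (2 * H) := by positivity
  calc _ ≤ (∫ ω, quadVar T B n ω ∂P)⁻¹ * ((T / n) ^ (2 * H) * ρ * σ) :=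
        mul_le_mul_of_nonneg_left h1 (inv_nonneg.2 hE.le)
    _ = (ρ * σ / secondDiffCov H 0) * (((n - 1 : ℕ) : ℝ))⁻¹ := by
        rw [integral_quadVar hT hB]; field_simp
    _ ≤ (ρ * σ / secondDiffCov H 0) * (2 * (n : ℝ)⁻¹) := by
        refine mul_le_mul_of_nonneg_left ?_ (by positivity)
        rw [← div_eq_mul_inv, le_div_iff₀ hn0, inv_mul_le_iff₀ (by linarith)]
        linarith
    _ = _ := by ring

/-- The covariance of the normalized second differences is of size `1 / n`, by Schur's test for
each of the two blocks. -/
lemma integral_inner_randomVector_sq_le (hH : H ∈ Set.Ioo (0 : ℝ) 1) (hT : 0 < T)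
    (hB : IsFractionalBrownianMotion P H T B) {n : ℕ} (hn : 2 ≤ n)
    (v : EuclideanSpace ℝ (Finset.Ico 1 n ⊕ Finset.Ico 1 (2 * n))) :
    ∫ ω, ⟪v, randomVector (diffVector P T B n) ω⟫_ℝ ^ 2 ∂P ≤
      (n : ℝ)⁻¹ * (4 * (∑' k : ℤ, |secondDiffCov H k|) / secondDiffCov H 0) * ‖v‖ ^ 2 := by
  let a : ℕ → ℝ := fun j => if hj : j ∈ Finset.Ico 1 n then v (.inl ⟨j, hj⟩) else 0
  let b : ℕ → ℝ := fun j => if hj : j ∈ Finset.Ico 1 (2 * n) then v (.inr ⟨j, hj⟩) else 0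
  let X : Ω → ℝ := fun ω => ∑ j ∈ Finset.Ico 1 n, a j *
    ((√(∫ ω, quadVar T B n ω ∂P))⁻¹ * secondDiff T B n j ω)
  let Y : Ω → ℝ := fun ω => ∑ j ∈ Finset.Ico 1 (2 * n), b j *
    ((√(∫ ω, quadVar T B (2 * n) ω ∂P))⁻¹ * secondDiff T B (2 * n) j ω)
  have ha : ∀ j : Finset.Ico 1 n, v (.inl j) = a j := fun j => by
    simp only [a, dif_pos j.2]
  have hb : ∀ j : Finset.Ico 1 (2 * n), v (.inr j) = b j := fun j => by
    simp only [b, dif_pos j.2]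
  have hXY : ∀ ω, ⟪v, randomVector (diffVector P T B n) ω⟫_ℝ = X ω + Y ω := fun ω => by
    rw [PiLp.inner_apply, Fintype.sum_sum_type]
    refine congrArg₂ _ ((Fintype.sum_congr _ _ fun j => ?_).trans (Finset.sum_coe_sort _ _))
      ((Fintype.sum_congr _ _ fun j => ?_).trans (Finset.sum_coe_sort _ _))
    · rw [← ha]; simp [randomVector, diffVector, mul_comm]
    · rw [← hb]; simp [randomVector, diffVector, mul_comm]
  have hv : ‖v‖ ^ 2 = ∑ j ∈ Finset.Ico 1 n, a j ^ 2 + ∑ j ∈ Finset.Ico 1 (2 * n), b j ^ 2 := by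
    rw [EuclideanSpace.norm_sq_eq, Fintype.sum_sum_type]
    simp only [Real.norm_eq_abs, sq_abs, ha, hb]
    exact congrArg₂ _ (Finset.sum_coe_sort (Finset.Ico 1 n) fun j => a j ^ 2)
      (Finset.sum_coe_sort (Finset.Ico 1 (2 * n)) fun j => b j ^ 2)
  have hX : MemLp X 2 P := memLp_finsetSum _ fun j hj =>
    ((memLp_secondDiff hT hB hj).const_mul _).const_mul _
  have hY : MemLp Y 2 P := memLp_finsetSum _ fun j hj =>
    ((memLp_secondDiff hT hB hj).const_mul _).const_mul _
  have h1 : ∫ ω, X ω ^ 2 ∂P ≤ _ := integral_sq_sum_normalized_le hH hT hB hn a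
  have h2 : ∫ ω, Y ω ^ 2 ∂P ≤ _ := integral_sq_sum_normalized_le hH hT hB (n := 2 * n) (by omega) b
  have h3 : ∫ ω, (X ω + Y ω) ^ 2 ∂P ≤ 2 * ∫ ω, X ω ^ 2 ∂P + 2 * ∫ ω, Y ω ^ 2 ∂P := by
    rw [← integral_const_mul, ← integral_const_mul,
      ← integral_add (hX.integrable_sq.const_mul _) (hY.integrable_sq.const_mul _)]
    refine integral_mono (hX.add hY).integrable_sq
      ((hX.integrable_sq.const_mul _).add (hY.integrable_sq.const_mul _)) fun ω => ?_
    change (X ω + Y ω) ^ 2 ≤ 2 * X ω ^ 2 + 2 * Y ω ^ 2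
    linarith [add_sq_le (a := X ω) (b := Y ω)]
  simp only [hXY]
  have h0 := secondDiffCov_zero_pos hH
  have hn0 : (0 : ℝ) < n := by exact_mod_cast (by omega : 0 < n)
  have hρ : 0 ≤ ∑' k : ℤ, |secondDiffCov H k| := tsum_nonneg fun _ => abs_nonneg _
  have hσ : 0 ≤ ∑ j ∈ Finset.Ico 1 (2 * n), b j ^ 2 := Finset.sum_nonneg fun _ _ => sq_nonneg _
  have h4 : ((2 * n : ℕ) : ℝ)⁻¹ ≤ (n : ℝ)⁻¹ :=
    inv_anti₀ hn0 (by push_cast; linarith)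
  have h5 : ∫ ω, Y ω ^ 2 ∂P ≤ (n : ℝ)⁻¹ * (2 * (∑' k : ℤ, |secondDiffCov H k|) /
      secondDiffCov H 0) * ∑ j ∈ Finset.Ico 1 (2 * n), b j ^ 2 := by
    refine h2.trans ?_
    gcongr
  calc _ ≤ _ := h3
    _ ≤ 2 * _ + 2 * _ := add_le_add (mul_le_mul_of_nonneg_left h1 zero_le_two)
        (mul_le_mul_of_nonneg_left h5 zero_le_two)
    _ = _ := by rw [hv]; ring

/-- The normalized second differences form a Gaussian family with parameter `1 / n`, `n ≥ 2`. -/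
lemma exists_isGaussianFamily_diffVector (hH : H ∈ Set.Ioo (0 : ℝ) 1) (hT : 0 < T)
    (hB : IsFractionalBrownianMotion P H T B) :
    ∃ S K, IsGaussianFamily (fun i : ℕ => P.map (randomVector (diffVector P T B (i + 2))))
      (fun i => ((i + 2 : ℕ) : ℝ)⁻¹) S K := by
  have hG := fun i : ℕ => isGaussian_map_randomVector hB
    (diffVector_mem_span (P := P) (B := B) hT.le (i + 2))
  have inst : ∀ i : ℕ, IsGaussian (P.map (randomVector (diffVector P T B (i + 2)))) :=
    fun i => (hG i).1
  let K : ℝ := max 2 (4 * (∑' k : ℤ, |secondDiffCov H k|) / secondDiffCov H 0)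
  have hpos : ∀ i : ℕ, (0 : ℝ) < ((i + 2 : ℕ) : ℝ)⁻¹ := fun i => by positivity
  refine ⟨fun i => (((i + 2 : ℕ) : ℝ)⁻¹)⁻¹ •
    covarianceOperator (P.map (randomVector (diffVector P T B (i + 2)))), K,
    ⟨inst, fun i => (hG i).2, hpos, fun i => ?_, fun i => ?_, fun i u v => ?_, fun i => ?_⟩⟩
  · exact inv_le_one_of_one_le₀ (by exact_mod_cast (by omega : 1 ≤ i + 2))
  · refine norm_smul_covarianceOperator_le _ (hpos i) (by positivity) fun v => ?_
    rw [integral_map (measurable_diffVector hT.le hB _).aemeasurable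
      (by fun_prop)]
    refine (integral_inner_randomVector_sq_le hH hT hB (by omega) v).trans ?_
    gcongr
    exact le_max_right _ _
  · rw [smul_apply, real_inner_smul_left, covarianceOperator_inner IsGaussian.memLp_two_id,
      mul_inv_cancel_left₀ (hpos i).ne']
  · have hm := (measurable_diffVector hT.le hB (i + 2)).aemeasurable (μ := P)
    have hq : ∀ x : EuclideanSpace ℝ (Finset.Ico 1 (i + 2) ⊕ Finset.Ico 1 (2 * (i + 2))),
        ‖x‖ ^ 2 = quadForm (coordProj (Set.range Sum.inl)) x +
          quadForm (coordProj (Set.range Sum.inr)) x := fun x => by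
      rw [quadForm_coordProj, quadForm_coordProj, EuclideanSpace.norm_sq_eq,
        Fintype.sum_sum_type, Fintype.sum_sum_type, Fintype.sum_sum_type]
      simp
    have hint : ∀ n : ℕ, Integrable (quadVar T B n) P := fun n =>
      integrable_finsetSum _ fun j hj => (memLp_secondDiff hT hB hj).integrable_sq
    have h1 := (integral_quadVar_pos hH hT hB (n := i + 2) (by omega)).ne'
    have h2 := (integral_quadVar_pos hH hT hB (n := 2 * (i + 2)) (by omega)).ne'
    rw [integral_map hm (by fun_prop)]
    simp only [hq, quadForm_coordProj_inl hH hT hB (show 2 ≤ i + 2 by omega),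
      quadForm_coordProj_inr hH hT hB (show 2 ≤ i + 2 by omega)]
    rw [integral_add ((hint _).div_const _) ((hint _).div_const _), integral_div, integral_div,
      div_self h1, div_self h2]
    refine le_trans ?_ (le_max_left _ _)
    norm_num

end DiffVector

/-! ### Cutoff functions and the logarithm -/

section Cutoff

open Function
open scoped ContDiff

variable (χ : ContDiffBump (0 : ℝ))

lemma hasTemperateGrowth_bump : HasTemperateGrowth (fun x => χ x) :=
  χ.hasCompactSupport.hasTemperateGrowth χ.contDiff

lemma vanishesToOrder_one_sub_bump (k : ℕ) : VanishesToOrder k (fun x => 1 - χ x) := by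
  refine .of_eventuallyEq_zero ((HasTemperateGrowth.const 1).fun_sub (hasTemperateGrowth_bump χ))
    ?_ k
  filter_upwards [χ.eventuallyEq_one] with x hx
  simp [hx]

lemma hasTemperateGrowth_bump_mul_log (hχ : χ.rOut < 1) :
    HasTemperateGrowth (fun x => χ x * Real.log (1 + x)) := by
  refine HasCompactSupport.hasTemperateGrowth χ.hasCompactSupport.mul_right ?_
  refine (contMDiff_of_tsupport fun x hx => ContDiffAt.contMDiffAt ?_).contDiff
  have hx' := tsupport_mul_subset_left hx
  rw [χ.tsupport_eq, Metric.mem_closedBall, dist_zero_right, Real.norm_eq_abs] at hx'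
  have h1 := (abs_le.1 hx').1
  exact χ.contDiff.contDiffAt.mul
    ((contDiffAt_const.add contDiffAt_id).log (by simp only [id]; linarith))

/-- The third-order remainder of the truncated logarithm. -/
lemma vanishesToOrder_bump_mul_log_sub (hχ : χ.rOut < 1) :
    VanishesToOrder 3 (fun x => χ x * Real.log (1 + x) - (x - x ^ 2 / 2)) := by
  set φ : ℝ → ℝ := fun x => χ x * Real.log (1 + x) - (x - x ^ 2 / 2) with hφ
  have hg : φ.HasTemperateGrowth := by
    have h1 := hasTemperateGrowth_bump_mul_log χ hχ
    have h2 : HasTemperateGrowth (fun x : ℝ => x - x ^ 2 / 2) := by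
      simp only [div_eq_mul_inv]; fun_prop
    exact h1.fun_sub h2
  have e0 : φ =ᶠ[𝓝 0] fun x => Real.log (1 + x) - (x - x ^ 2 / 2) := by
    filter_upwards [χ.eventuallyEq_one] with x hx
    simp [hφ, hx]
  have e1 : deriv φ =ᶠ[𝓝 0] fun x => (1 + x)⁻¹ - (1 - x) := by
    have hpos : ∀ᶠ x : ℝ in 𝓝 0, 0 < 1 + x := by
      filter_upwards [lt_mem_nhds (show (-1 : ℝ) < 0 by norm_num)] with x hx
      linarith
    filter_upwards [e0.deriv, hpos] with x hx hx'
    rw [hx]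
    have h1 : HasDerivAt (fun x : ℝ => Real.log (1 + x)) (1 + x)⁻¹ x := by
      simpa using ((hasDerivAt_id x).const_add 1).log hx'.ne'
    have h2 : HasDerivAt (fun x : ℝ => x - x ^ 2 / 2) (1 - x) x := by
      refine ((hasDerivAt_id x).sub ((hasDerivAt_pow 2 x).div_const 2)).congr_deriv ?_
      norm_num
    exact (h1.sub h2).deriv
  have e2 : deriv (deriv φ) 0 = 0 := by
    rw [e1.deriv_eq]
    have h1 : HasDerivAt (fun x : ℝ => (1 + x)⁻¹) (-1) 0 := by
      refine (((hasDerivAt_id (0 : ℝ)).const_add 1).inv (by simp)).congr_deriv ?_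
      simp
    have h2 : HasDerivAt (fun x : ℝ => 1 - x) (-1) 0 := (hasDerivAt_id (0 : ℝ)).const_sub 1
    exact (h1.sub h2).deriv.trans (by norm_num)
  exact ⟨hg, by simp [e0.self_of_nhds], hasTemperateGrowth_deriv hg, by simp [e1.self_of_nhds],
    hasTemperateGrowth_deriv (hasTemperateGrowth_deriv hg), e2,
    hasTemperateGrowth_deriv (hasTemperateGrowth_deriv (hasTemperateGrowth_deriv hg))⟩

lemma abs_log_one_add_le {x : ℝ} (hx : |x| ≤ 1 / 2) : |Real.log (1 + x)| ≤ 2 * |x| := by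
  have h := abs_le.1 hx
  have hpos : 0 < 1 + x := by linarith
  have h1 := Real.log_le_sub_one_of_pos hpos
  have h2 := Real.one_sub_inv_le_log_of_pos hpos
  have h3 : -(2 * |x|) ≤ 1 - (1 + x)⁻¹ := by
    have e : 1 - (1 + x)⁻¹ = x / (1 + x) := by field_simp; ring
    rw [e, le_div_iff₀ hpos]
    rcases abs_cases x with ⟨hx', _⟩ | ⟨hx', _⟩ <;> rw [hx'] <;> nlinarith
  rw [abs_le]
  constructor
  · linarith
  · linarith [le_abs_self x, abs_nonneg x]

end Cutoff

/-! ### The estimator as a function of the normalized quadratic variations -/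

section Estimator

set_option linter.unusedSectionVars false

/-- The correction from `E[V_{2n}] / E[V_n] = 2^{1 - 2H} (2n - 1) / (2n - 2)`. -/
noncomputable def gridCorrection (n : ℕ) : ℝ := Real.log ((2 * n - 1) / (2 * n - 2))

lemma gridCorrection_bounds {n : ℕ} (hn : 2 ≤ n) :
    0 ≤ gridCorrection n ∧ gridCorrection n ≤ (n : ℝ)⁻¹ ∧
      |1 / 2 - n * gridCorrection n| ≤ (n : ℝ)⁻¹ := by
  have hn' : (2 : ℝ) ≤ n := by exact_mod_cast hn
  have hpos : (0 : ℝ) < (2 * n - 1) / (2 * n - 2) := div_pos (by linarith) (by linarith)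
  have h1 : gridCorrection n ≤ (2 * (n : ℝ) - 2)⁻¹ := by
    refine (Real.log_le_sub_one_of_pos hpos).trans_eq ?_
    have : (n : ℝ) - 1 ≠ 0 := by linarith
    rw [show 2 * (n : ℝ) - 2 = 2 * (n - 1) by ring]
    field_simp; ring
  have h2 : (2 * (n : ℝ) - 1)⁻¹ ≤ gridCorrection n := by
    refine le_trans (le_of_eq ?_) (Real.one_sub_inv_le_log_of_pos hpos)
    have : (2 * (n : ℝ) - 1) ≠ 0 := by linarith
    rw [inv_div]; field_simp; ring
  have h3 : (2 * (n : ℝ) - 2)⁻¹ ≤ (n : ℝ)⁻¹ := inv_anti₀ (by linarith) (by linarith)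
  have h4 : 0 < (2 * (n : ℝ) - 1)⁻¹ := inv_pos.2 (by linarith)
  refine ⟨h4.le.trans h2, h1.trans h3, ?_⟩
  have h5 : (n : ℝ) * gridCorrection n ≤ n * (2 * (n : ℝ) - 2)⁻¹ := by gcongr
  have h6 : (n : ℝ) * (2 * (n : ℝ) - 1)⁻¹ ≤ n * gridCorrection n := by gcongr
  have h7 : n * (2 * (n : ℝ) - 2)⁻¹ = 1 / 2 + (2 * (n : ℝ) - 2)⁻¹ := by
    have : (n : ℝ) - 1 ≠ 0 := by linarith
    rw [show 2 * (n : ℝ) - 2 = 2 * (n - 1) by ring]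
    field_simp; ring
  have h8 : 1 / 2 ≤ (n : ℝ) * (2 * (n : ℝ) - 1)⁻¹ := by
    rw [← div_eq_mul_inv, le_div_iff₀ (by linarith)]; linarith
  rw [abs_le]
  constructor <;> linarith [h4]

variable {Ω : Type*} [MeasurableSpace Ω] {P : Measure Ω} [IsProbabilityMeasure P]
  {H T : ℝ} {B : ℝ → Ω → ℝ}

lemma log_integral_quadVar (hH : H ∈ Set.Ioo (0 : ℝ) 1) (hT : 0 < T)
    (hB : IsFractionalBrownianMotion P H T B) {n : ℕ} (hn : 2 ≤ n) :
    Real.log (∫ ω, quadVar T B n ω ∂P) =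
      Real.log (n - 1) + 2 * H * (Real.log T - Real.log n) + Real.log (secondDiffCov H 0) := by
  have hn' : (2 : ℝ) ≤ n := by exact_mod_cast hn
  have h0 := secondDiffCov_zero_pos hH
  rw [integral_quadVar hT hB, Nat.cast_sub (by omega), Nat.cast_one,
    Real.log_mul (by linarith) (by positivity), Real.log_mul (by positivity) h0.ne',
    Real.log_rpow (by positivity), Real.log_div hT.ne' (by positivity)]
  ring

lemma log_quadVar_div (hH : H ∈ Set.Ioo (0 : ℝ) 1) (hT : 0 < T)
    (hB : IsFractionalBrownianMotion P H T B) {n : ℕ} (hn : 2 ≤ n) {ω : Ω}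
    (h1 : 0 < 1 + normQuadVar P T B n ω) (h2 : 0 < 1 + normQuadVar P T B (2 * n) ω) :
    Real.log (quadVar T B (2 * n) ω / quadVar T B n ω) =
      Real.log (1 + normQuadVar P T B (2 * n) ω) - Real.log (1 + normQuadVar P T B n ω) +
        Real.log 2 + gridCorrection n - 2 * H * Real.log 2 := by
  have hE : ∀ m : ℕ, 2 ≤ m → quadVar T B m ω =
      (1 + normQuadVar P T B m ω) * ∫ ω, quadVar T B m ω ∂P := fun m hm => by
    have := (integral_quadVar_pos hH hT hB hm).ne'
    rw [normQuadVar]; field_simp; ring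
  have p1 := (integral_quadVar_pos hH hT hB hn).ne'
  have p2 := (integral_quadVar_pos hH hT hB (n := 2 * n) (by omega)).ne'
  have hn' : (2 : ℝ) ≤ n := by exact_mod_cast hn
  rw [hE n hn, hE (2 * n) (by omega), Real.log_div (mul_ne_zero h2.ne' p2) (mul_ne_zero h1.ne' p1),
    Real.log_mul h2.ne' p2, Real.log_mul h1.ne' p1, log_integral_quadVar hH hT hB hn,
    log_integral_quadVar hH hT hB (n := 2 * n) (by omega), gridCorrection,
    Real.log_div (by linarith) (by linarith), show (2 * (n : ℝ) - 2) = 2 * (n - 1) by ring,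
    Real.log_mul two_ne_zero (by linarith)]
  push_cast
  rw [Real.log_mul two_ne_zero (by linarith)]
  ring

/-- Where both normalized quadratic variations are small, the estimator is not clamped. -/
lemma hurstEstimator_sub (hH : H ∈ Set.Ioo (0 : ℝ) 1) (hT : 0 < T)
    (hB : IsFractionalBrownianMotion P H T B) {n : ℕ} (hn : 2 ≤ n) {ω : Ω} {δ : ℝ}
    (hδ : δ ≤ 1 / 2) (hδH : 4 * δ + gridCorrection n ≤ min H (1 - H))
    (h1 : |normQuadVar P T B n ω| ≤ δ) (h2 : |normQuadVar P T B (2 * n) ω| ≤ δ) :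
    2 * Real.log 2 * (hurstEstimator T B n ω - H) =
      -(Real.log (1 + normQuadVar P T B (2 * n) ω) - Real.log (1 + normQuadVar P T B n ω) +
        gridCorrection n) := by
  have l1 := abs_le.1 (abs_log_one_add_le (h1.trans hδ))
  have l2 := abs_le.1 (abs_log_one_add_le (h2.trans hδ))
  have hlog : 1 ≤ 2 * Real.log 2 := by linarith [Real.log_two_gt_d9]
  have hlog0 : 2 * Real.log 2 ≠ 0 := by linarith
  have hc := (gridCorrection_bounds hn).1
  have hm1 := min_le_left H (1 - H)
  have hm2 := min_le_right H (1 - H)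
  set x := Real.log (1 + normQuadVar P T B (2 * n) ω) - Real.log (1 + normQuadVar P T B n ω) +
    gridCorrection n with hx
  have hu : 1 / 2 - 1 / (2 * Real.log 2) *
      Real.log (quadVar T B (2 * n) ω / quadVar T B n ω) = H - x / (2 * Real.log 2) := by
    rw [log_quadVar_div hH hT hB hn (by linarith [(abs_le.1 h1).1]) (by linarith [(abs_le.1 h2).1])]
    have : Real.log 2 ≠ 0 := by linarith
    rw [hx]; field_simp; ring
  have hx1 : |x / (2 * Real.log 2)| ≤ min H (1 - H) := by
    rw [abs_div, abs_of_pos (show 0 < 2 * Real.log 2 by linarith)]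
    refine (div_le_self (abs_nonneg _) hlog).trans (le_trans ?_ hδH)
    rw [abs_le]
    constructor <;> linarith
  have hx2 := abs_le.1 hx1
  rw [hurstEstimator, hu, min_eq_left (by linarith), max_eq_right (by linarith)]
  field_simp; ring

end Estimator

/-! ### The stochastic expansion -/

section Expansion

open Function

set_option linter.unusedSectionVars false

lemma iterate_oneSubOU_const_mul {E : Type*} [NormedAddCommGroup E] [NormedSpace ℝ E]
    [MeasurableSpace E] [BorelSpace E] [SecondCountableTopology E] [CompleteSpace E]
    (μ : Measure E) [IsGaussian μ] (c : ℝ) {f : E → ℝ} (hf : f.HasTemperateGrowth) (m : ℕ) :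
    (oneSubOU μ)^[m] (fun x => c * f x) = fun x => c * (oneSubOU μ)^[m] f x := by
  induction m with
  | zero => rfl
  | succ m ih =>
    rw [iterate_succ_apply', ih, iterate_succ_apply']
    funext x
    rw [oneSubOU, ornsteinUhlenbeck_const_mul _ (hasTemperateGrowth_iterate_oneSubOU μ hf m),
      oneSubOU]
    ring

variable {Ω : Type*} [MeasurableSpace Ω] {P : Measure Ω} [IsProbabilityMeasure P]
  {H T : ℝ} {B : ℝ → Ω → ℝ}

/-- The grading controls all Sobolev norms. -/
lemma sobolevBigO_of_gradedFamily (hT : 0 < T) (hB : IsFractionalBrownianMotion P H T B)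
    {S : ∀ i : ℕ, EuclideanSpace ℝ (Finset.Ico 1 (i + 2) ⊕ Finset.Ico 1 (2 * (i + 2))) →L[ℝ]
      EuclideanSpace ℝ (Finset.Ico 1 (i + 2) ⊕ Finset.Ico 1 (2 * (i + 2)))} {K : ℝ}
    (hμ : IsGaussianFamily (fun i : ℕ => P.map (randomVector (diffVector P T B (i + 2))))
      (fun i => ((i + 2 : ℕ) : ℝ)⁻¹) S K) {k : ℕ}
    {g : ∀ i : ℕ, EuclideanSpace ℝ (Finset.Ico 1 (i + 2) ⊕ Finset.Ico 1 (2 * (i + 2))) → ℝ}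
    (hg : GradedFamily (fun i : ℕ => P.map (randomVector (diffVector P T B (i + 2))))
      (fun i => ((i + 2 : ℕ) : ℝ)⁻¹) k g) {X : ℕ → Ω → ℝ} {a : ℕ}
    (hX : ∀ᶠ i : ℕ in atTop, X (i + 2) = fun ω =>
      ((i + 2 : ℕ) : ℝ) ^ a * g i (randomVector (diffVector P T B (i + 2)) ω))
    {s p ν : ℝ} (hp : 1 < p) (hν : a - (k : ℝ) / 2 ≤ ν) : SobolevBigO P T B s p X ν := by
  have inst := hμ.gaussian
  obtain ⟨m, hm⟩ := exists_nat_gt (s / 2)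
  obtain ⟨C, hC, h⟩ := (hg.iterate_oneSubOU hμ m).exists_eLpNorm_le hμ p
  refine ⟨C, ?_⟩
  rw [← map_add_atTop_eq_nat 2, eventually_map]
  filter_upwards [hX] with i hi
  have hn : (1 : ℝ) ≤ ((i + 2 : ℕ) : ℝ) := by exact_mod_cast (by omega : 1 ≤ i + 2)
  have hgi := hg.hasTemperateGrowth i
  rw [hi]
  calc _ ≤ eLpNorm ((oneSubOU (P.map (randomVector (diffVector P T B (i + 2)))))^[m]
        (fun x => ((i + 2 : ℕ) : ℝ) ^ a * g i x)) (ENNReal.ofReal p) _ :=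
        sobolevNorm_randomVector_le hB (diffVector_mem_span hT.le _)
          (f := fun x => ((i + 2 : ℕ) : ℝ) ^ a * g i x)
          ((HasTemperateGrowth.const _).fun_mul hgi) hp hm
    _ = ENNReal.ofReal (((i + 2 : ℕ) : ℝ) ^ a) *
        eLpNorm ((oneSubOU (P.map (randomVector (diffVector P T B (i + 2)))))^[m] (g i))
          (ENNReal.ofReal p) (P.map (randomVector (diffVector P T B (i + 2)))) := by
        rw [iterate_oneSubOU_const_mul _ _ hgi]
        refine (eLpNorm_const_smul (((i + 2 : ℕ) : ℝ) ^ a) _ _ _).trans ?_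
        rw [Real.enorm_eq_ofReal (by positivity)]
    _ ≤ ENNReal.ofReal (((i + 2 : ℕ) : ℝ) ^ a) *
        ENNReal.ofReal (C * (((i + 2 : ℕ) : ℝ)⁻¹) ^ ((k : ℝ) / 2)) := by gcongr; exact h i
    _ = ENNReal.ofReal (C * ((i + 2 : ℕ) : ℝ) ^ ((a : ℝ) - (k : ℝ) / 2)) := by
        rw [← ENNReal.ofReal_mul (by positivity), Real.rpow_sub (by linarith), Real.rpow_natCast,
          Real.inv_rpow (by linarith)]
        congr 1; ring
    _ ≤ _ := by
        refine ENNReal.ofReal_le_ofReal (mul_le_mul_of_nonneg_left ?_ hC)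
        exact Real.rpow_le_rpow_of_exponent_le hn hν

/-- On the support of the cutoffs the estimator is a smooth function of the normalized quadratic
variations; elsewhere both sides vanish. -/
lemma truncatedError_eq (hH : H ∈ Set.Ioo (0 : ℝ) 1) (hT : 0 < T)
    (hB : IsFractionalBrownianMotion P H T B) (χ : ContDiffBump (0 : ℝ)) {n : ℕ} (hn : 2 ≤ n)
    (hδ : χ.rOut ≤ 1 / 2) (hδH : 4 * χ.rOut + gridCorrection n ≤ min H (1 - H))
    {ψ : ℕ → Ω → ℝ} {ω : Ω}
    (hψ : ψ n ω = χ (normQuadVar P T B n ω) * χ (normQuadVar P T B (2 * n) ω)) :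
    truncatedError H T B ψ n ω = -(√(n : ℝ) * (χ (normQuadVar P T B n ω) *
      (χ (normQuadVar P T B (2 * n) ω) * Real.log (1 + normQuadVar P T B (2 * n) ω)) -
      χ (normQuadVar P T B n ω) * Real.log (1 + normQuadVar P T B n ω) *
        χ (normQuadVar P T B (2 * n) ω) +
      gridCorrection n * (χ (normQuadVar P T B n ω) * χ (normQuadVar P T B (2 * n) ω)))) := by
  have hzero : ∀ x : ℝ, ¬ |x| ≤ χ.rOut → χ x = 0 := fun x hx =>
    χ.zero_of_le_dist (by rw [dist_zero_right, Real.norm_eq_abs]; exact (not_le.1 hx).le)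
  rw [truncatedError, hψ]
  by_cases h1 : |normQuadVar P T B n ω| ≤ χ.rOut
  · by_cases h2 : |normQuadVar P T B (2 * n) ω| ≤ χ.rOut
    · linear_combination (√(n : ℝ) * (χ (normQuadVar P T B n ω) *
        χ (normQuadVar P T B (2 * n) ω))) * hurstEstimator_sub hH hT hB hn hδ hδH h1 h2
    · simp [hzero _ h2]
  · simp [hzero _ h1]

end Expansion

theorem proposition2108101817 {Ω : Type*} [MeasurableSpace Ω] (P : Measure Ω)
    [IsProbabilityMeasure P] (H T : ℝ) (hH : H ∈ Set.Ioo (0 : ℝ) 1) (hT : 0 < T)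
    (B : ℝ → Ω → ℝ) (hB : IsFractionalBrownianMotion P H T B) :
    ∃ ψ : ℕ → Ω → ℝ,
      -- (i) the truncation functionals
      (∀ n ω, ψ n ω ∈ Set.Icc (0 : ℝ) 1) ∧
      (∀ n, MemDInfty P T B (ψ n)) ∧
      (∀ s p L : ℝ, 1 < p → 0 < L →
        SobolevBigO P T B s p (fun n ω => ψ n ω - 1) (-L)) ∧
      -- (ii) the stochastic expansion of the truncated error of the estimator
      (∃ N R : ℕ → Ω → ℝ,
        (∀ n : ℕ, 2 ≤ n → ∀ ω,
          truncatedError H T B ψ n ω = mainTerm P T B n ω + (n : ℝ) ^ (-(1 / 2) : ℝ) * N n ω) ∧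
        (∀ n : ℕ, 2 ≤ n → ∀ ω,
          N n ω = (n : ℝ) * (1 / 2 * normQuadVar P T B (2 * n) ω ^ 2
            - 1 / 2 * normQuadVar P T B n ω ^ 2) - 1 / 2 + R n ω) ∧
        IsBigOM P T B R (-(1 / 2))) ∧
      (∀ n : ℕ, 2 ≤ n → MemDInfty P T B (truncatedError H T B ψ n)) := by
  obtain ⟨S, K, hμ⟩ := exists_isGaussianFamily_diffVector hH hT hB
  -- the cutoff is supported where the clamping of the estimator is inactive
  have hh : 0 < min H (1 - H) := lt_min hH.1 (by linarith [hH.2])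
  have hδ : 0 < min (1 / 2) (min H (1 - H) / 8) / 2 := by positivity
  let χ : ContDiffBump (0 : ℝ) :=
    ⟨min (1 / 2) (min H (1 - H) / 8) / 2 / 2, min (1 / 2) (min H (1 - H) / 8) / 2, by linarith,
      by linarith⟩
  have hχ1 : χ.rOut ≤ 1 / 2 := by
    have := min_le_left (1 / 2) (min H (1 - H) / 8)
    change min (1 / 2) (min H (1 - H) / 8) / 2 ≤ 1 / 2
    linarith
  have hχ2 : 4 * χ.rOut ≤ min H (1 - H) / 2 := by
    have := min_le_right (1 / 2) (min H (1 - H) / 8)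
    change 4 * (min (1 / 2) (min H (1 - H) / 8) / 2) ≤ min H (1 - H) / 2
    linarith
  obtain ⟨n₁, hn₁⟩ := exists_nat_gt (2 / min H (1 - H))
  obtain ⟨n₀, hn₀, hc⟩ : ∃ n₀ : ℕ, 2 ≤ n₀ ∧ ∀ n, n₀ ≤ n →
      4 * χ.rOut + gridCorrection n ≤ min H (1 - H) := by
    refine ⟨max 2 n₁, le_max_left _ _, fun n hn => ?_⟩
    have h1 := (gridCorrection_bounds ((le_max_left _ _).trans hn)).2.1
    have h2 : (n₁ : ℝ) ≤ n := by exact_mod_cast (le_max_right _ _).trans hn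
    have h3 : (n : ℝ)⁻¹ ≤ min H (1 - H) / 2 := by
      rw [← inv_div]
      exact inv_anti₀ (by positivity) (hn₁.le.trans h2)
    linarith
  let f : ∀ n : ℕ, EuclideanSpace ℝ (Finset.Ico 1 n ⊕ Finset.Ico 1 (2 * n)) → ℝ := fun n =>
    centredQuadForm (P.map (randomVector (diffVector P T B n))) (coordProj (Set.range Sum.inl))
  let g : ∀ n : ℕ, EuclideanSpace ℝ (Finset.Ico 1 n ⊕ Finset.Ico 1 (2 * n)) → ℝ := fun n =>
    centredQuadForm (P.map (randomVector (diffVector P T B n))) (coordProj (Set.range Sum.inr))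
  have hf : ∀ n, (f n).HasTemperateGrowth := fun n => hasTemperateGrowth_centredQuadForm _ _
  have hg : ∀ n, (g n).HasTemperateGrowth := fun n => hasTemperateGrowth_centredQuadForm _ _
  have ef : ∀ n, 2 ≤ n → ∀ ω, normQuadVar P T B n ω = f n (randomVector (diffVector P T B n) ω) :=
    fun n hn ω => (centredQuadForm_coordProj_inl hH hT hB hn ω).symm
  have eg : ∀ n, 2 ≤ n → ∀ ω, normQuadVar P T B (2 * n) ω =
      g n (randomVector (diffVector P T B n) ω) :=
    fun n hn ω => (centredQuadForm_coordProj_inr hH hT hB hn ω).symm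
  have hmem : ∀ n (F : EuclideanSpace ℝ (Finset.Ico 1 n ⊕ Finset.Ico 1 (2 * n)) → ℝ),
      F.HasTemperateGrowth → MemDInfty P T B fun ω => F (randomVector (diffVector P T B n) ω) :=
    fun n F hF => memDInfty_randomVector hB (diffVector_mem_span hT.le n) hF
  -- the truncation and the truncated error as smooth functionals
  let ψ : ℕ → Ω → ℝ := fun n ω =>
    if n₀ ≤ n then χ (normQuadVar P T B n ω) * χ (normQuadVar P T B (2 * n) ω) else 0
  have hψ : ∀ n, n₀ ≤ n → ∀ ω, ψ n ω =
      χ (normQuadVar P T B n ω) * χ (normQuadVar P T B (2 * n) ω) := fun n hn ω => if_pos hn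
  have hψ0 : ∀ n, ¬ n₀ ≤ n → ψ n = fun _ => 0 := fun n hn => funext fun ω => if_neg hn
  have tχ := hasTemperateGrowth_bump χ
  have tℓ := hasTemperateGrowth_bump_mul_log χ (by linarith)
  have hZ : ∀ n, ∃ F : EuclideanSpace ℝ (Finset.Ico 1 n ⊕ Finset.Ico 1 (2 * n)) → ℝ,
      F.HasTemperateGrowth ∧
        truncatedError H T B ψ n = fun ω => F (randomVector (diffVector P T B n) ω) := by
    intro n
    by_cases hn : n₀ ≤ n
    · refine ⟨fun x => -(√(n : ℝ) * (χ (f n x) * (χ (g n x) * Real.log (1 + g n x)) -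
        χ (f n x) * Real.log (1 + f n x) * χ (g n x) +
        gridCorrection n * (χ (f n x) * χ (g n x)))), ?_, funext fun ω => ?_⟩
      · have t1 := tχ.comp (hf n)
        have t2 := tχ.comp (hg n)
        have t3 := tℓ.comp (hf n)
        have t4 := tℓ.comp (hg n)
        exact ((Function.HasTemperateGrowth.const _).fun_mul (((t1.fun_mul t4).fun_sub
          (t3.fun_mul t2)).fun_add ((Function.HasTemperateGrowth.const _).fun_mul
            (t1.fun_mul t2)))).fun_neg
      · rw [truncatedError_eq hH hT hB χ (hn₀.trans hn) hχ1 (hc n hn) (hψ n hn ω),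
          ef n (hn₀.trans hn), eg n (hn₀.trans hn)]
    · refine ⟨fun _ => 0, .const 0, funext fun ω => ?_⟩
      simp [truncatedError, hψ0 n hn]
  let R : ℕ → Ω → ℝ := fun n ω => if 2 ≤ n then
    √(n : ℝ) * (truncatedError H T B ψ n ω - mainTerm P T B n ω) -
      n * (1 / 2 * normQuadVar P T B (2 * n) ω ^ 2 - 1 / 2 * normQuadVar P T B n ω ^ 2) + 1 / 2
    else 0
  have hR : ∀ n, 2 ≤ n → ∀ ω, R n ω =
      √(n : ℝ) * (truncatedError H T B ψ n ω - mainTerm P T B n ω) -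
      n * (1 / 2 * normQuadVar P T B (2 * n) ω ^ 2 - 1 / 2 * normQuadVar P T B n ω ^ 2) + 1 / 2 :=
    fun n hn ω => if_pos hn
  -- the building blocks of the expansion, with their orders
  have inst := hμ.gaussian
  have gf : ∀ (k : ℕ) (φ : ℝ → ℝ), VanishesToOrder k φ → GradedFamily
      (fun i : ℕ => P.map (randomVector (diffVector P T B (i + 2))))
      (fun i => ((i + 2 : ℕ) : ℝ)⁻¹) k (fun i x => φ (f (i + 2) x)) := fun k φ hφ =>
    .comp (fun i => coordProj (Set.range Sum.inl)) 1 (fun i => norm_coordProj_le _) k φ hφ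
  have gg : ∀ (k : ℕ) (φ : ℝ → ℝ), VanishesToOrder k φ → GradedFamily
      (fun i : ℕ => P.map (randomVector (diffVector P T B (i + 2))))
      (fun i => ((i + 2 : ℕ) : ℝ)⁻¹) k (fun i x => φ (g (i + 2) x)) := fun k φ hφ =>
    .comp (fun i => coordProj (Set.range Sum.inr)) 1 (fun i => norm_coordProj_le _) k φ hφ
  have gη : ∀ k : ℕ, GradedFamily
      (fun i : ℕ => P.map (randomVector (diffVector P T B (i + 2))))
      (fun i => ((i + 2 : ℕ) : ℝ)⁻¹) k
      (fun i x => (1 - χ (f (i + 2) x)) + χ (f (i + 2) x) * (1 - χ (g (i + 2) x))) := fun k => by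
    have h := GradedFamily.mul 0 k _ _ (gf 0 (fun x => χ x) tχ)
      (gg k _ (vanishesToOrder_one_sub_bump χ k))
    rw [zero_add] at h
    exact .add _ _ _ (gf k _ (vanishesToOrder_one_sub_bump χ k)) h
  have hinv : ∀ i : ℕ, ((i + 2 : ℕ) : ℝ) * ((i + 2 : ℕ) : ℝ)⁻¹ = 1 := fun i =>
    mul_inv_cancel₀ (by positivity)
  have gρ : GradedFamily
      (fun i : ℕ => P.map (randomVector (diffVector P T B (i + 2))))
      (fun i => ((i + 2 : ℕ) : ℝ)⁻¹) 3 (fun i x =>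
        (χ (f (i + 2) x) * Real.log (1 + f (i + 2) x) - (f (i + 2) x - f (i + 2) x ^ 2 / 2)) -
        (χ (g (i + 2) x) * Real.log (1 + g (i + 2) x) - (g (i + 2) x - g (i + 2) x ^ 2 / 2)) +
        ((1 - χ (f (i + 2) x)) * (χ (g (i + 2) x) * Real.log (1 + g (i + 2) x)) -
          (1 - χ (g (i + 2) x)) * (χ (f (i + 2) x) * Real.log (1 + f (i + 2) x))) +
        (((i + 2 : ℕ) : ℝ)⁻¹ * (((i + 2 : ℕ) : ℝ)⁻¹ *
          (((i + 2 : ℕ) : ℝ) * (1 / 2 - ((i + 2 : ℕ) : ℝ) * gridCorrection (i + 2)))) +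
        gridCorrection (i + 2) *
          ((1 - χ (f (i + 2) x)) + χ (f (i + 2) x) * (1 - χ (g (i + 2) x))))) := by
    have r := vanishesToOrder_bump_mul_log_sub χ (by linarith)
    have η := vanishesToOrder_one_sub_bump χ 3
    refine .add _ _ _ (.add _ _ _ (.sub (gf 3 _ r) (gg 3 _ r))
      (.sub (.mul 3 0 _ _ (gf 3 _ η) (gg 0 _ tℓ)) (.mul 3 0 _ _ (gg 3 _ η) (gf 0 _ tℓ)))) ?_
    refine .add _ _ _ ?_ ?_
    · refine .weaken 3 4 _ (.scale 2 _ (.scale 0 _ (.const _ 1 fun i => ?_))) (by norm_num)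
      have h := (gridCorrection_bounds (n := i + 2) (by omega)).2.2
      have h2 : (0 : ℝ) ≤ ((i + 2 : ℕ) : ℝ) := by positivity
      rw [abs_mul, abs_of_nonneg h2]
      exact (mul_le_mul_of_nonneg_left h h2).trans_eq (hinv i)
    · have h := GradedFamily.mul 0 3 _ _ (.const (fun i => gridCorrection (i + 2)) 1 fun i => ?_)
        (gη 3)
      · simpa only [zero_add] using h
      · obtain ⟨h1, h2, -⟩ := gridCorrection_bounds (n := i + 2) (by omega)
        rw [abs_of_nonneg h1]
        exact h2.trans (hμ.le_one i)
  have hev : ∀ᶠ i : ℕ in atTop, n₀ ≤ i + 2 :=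
    (eventually_ge_atTop n₀).mono fun i hi => by omega
  refine ⟨ψ, fun n ω => ?_, fun n => ?_, fun s p L hp hL => ?_,
    ⟨fun n ω => √(n : ℝ) * (truncatedError H T B ψ n ω - mainTerm P T B n ω), R,
      fun n hn ω => ?_, fun n hn ω => ?_, fun n => ?_, fun s p hp => ?_⟩, fun n hn => ?_⟩
  · by_cases hn : n₀ ≤ n
    · rw [hψ n hn]
      exact ⟨mul_nonneg χ.nonneg χ.nonneg, mul_le_one₀ χ.le_one χ.nonneg χ.le_one⟩
    · rw [hψ0 n hn]; simp
  · by_cases hn : n₀ ≤ n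
    · have : ψ n = fun ω => (fun x => χ (f n x) * χ (g n x))
          (randomVector (diffVector P T B n) ω) := funext fun ω => by
        rw [hψ n hn, ef n (hn₀.trans hn), eg n (hn₀.trans hn)]
      rw [this]
      exact hmem n _ ((tχ.comp (hf n)).fun_mul (tχ.comp (hg n)))
    · rw [hψ0 n hn]
      exact hmem n (fun _ => 0) (.const 0)
  · obtain ⟨k, hk⟩ := exists_nat_gt (2 * L)
    refine sobolevBigO_of_gradedFamily hT hB hμ ((gη k).const_mul (-1)) (a := 0) ?_ hp
      (by push_cast; linarith)
    filter_upwards [hev] with i hi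
    funext ω
    rw [hψ _ hi, ef _ (by omega), eg _ (by omega)]
    ring
  · have hn' : (0 : ℝ) < n := by exact_mod_cast (by omega : 0 < n)
    have : (n : ℝ) ^ (-(1 / 2) : ℝ) * √(n : ℝ) = 1 := by
      rw [Real.sqrt_eq_rpow, ← Real.rpow_add hn']; norm_num
    rw [← mul_assoc, this]; ring
  · rw [hR n hn]; ring
  · by_cases hn : 2 ≤ n
    · obtain ⟨F, hF, e⟩ := hZ n
      have : R n = fun ω => (fun x => √(n : ℝ) * (F x - -(√(n : ℝ) * (g n x - f n x))) -
          n * (1 / 2 * g n x ^ 2 - 1 / 2 * f n x ^ 2) + 1 / 2)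
          (randomVector (diffVector P T B n) ω) := funext fun ω => by
        rw [hR n hn, e, mainTerm, ef n hn, eg n hn]
      rw [this]
      have h1 := hf n
      have h2 := hg n
      exact hmem n (fun x => √(n : ℝ) * (F x - -(√(n : ℝ) * (g n x - f n x))) -
          n * (1 / 2 * g n x ^ 2 - 1 / 2 * f n x ^ 2) + 1 / 2) (by fun_prop)
    · have : R n = fun _ => 0 := funext fun ω => if_neg hn
      rw [this]
      exact hmem n (fun _ => 0) (.const 0)
  · refine sobolevBigO_of_gradedFamily hT hB hμ gρ (a := 1) ?_ hp (by norm_num)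
    filter_upwards [hev] with i hi
    funext ω
    have h2 : 2 ≤ i + 2 := by omega
    rw [hR _ h2, truncatedError_eq hH hT hB χ h2 hχ1 (hc _ hi) (hψ _ hi ω), mainTerm, ef _ h2,
      eg _ h2]
    have hq := Real.mul_self_sqrt (show (0 : ℝ) ≤ ((i + 2 : ℕ) : ℝ) by positivity)
    have hi' := hinv i
    generalize f (i + 2) (randomVector (diffVector P T B (i + 2)) ω) = x
    generalize g (i + 2) (randomVector (diffVector P T B (i + 2)) ω) = y
    generalize gridCorrection (i + 2) = c
    generalize √((i + 2 : ℕ) : ℝ) = q at *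
    generalize (((i + 2 : ℕ) : ℝ))⁻¹ = e at *
    generalize ((i + 2 : ℕ) : ℝ) = n at *
    linear_combination (-(χ x * (χ y * Real.log (1 + y)) - χ x * Real.log (1 + x) * χ y +
      c * (χ x * χ y)) + (y - x)) * hq - (n * e + 1) * (1 / 2 - n * c) * hi'
  · obtain ⟨F, hF, e⟩ := hZ n
    rw [e]
    exact hmem n F hF
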